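/- Consider, for $\lambda,\sigma,\rho>0$, the reactive Boussinesq system in the strip $(x,z)\in\mathbb R^2$, $t>0$, with period $\lambda$ in $x$ and period cell $D=[0,\lambda]\times\mathbb R$: $$\partial_t\omega+v\cdot\nabla\omega-\sigma\Delta\omega=\sigma\rho\,\partial_xT,\qquad \partial_tT+v\cdot\nabla T-\Delta T=f(T),\qquad \nabla\cdot v=0,\quad v=(u,w),\quad \omega=\partial_xw-\partial_zu .$$ The reaction $f\in C^\infty(\mathbb R)$ satisfies $f(0)=f(1)=0$ and is of one of three types: bistable ($f<0$ on $(0,\theta)$ and $f>0$ on $(\theta,1)$ for some $\theta\in(0,1)$); ignition ($f=0$ on $[0,\theta]$ and $f>0$ on $(\theta,1)$ for some $\theta\in(0,1)$); concave KPP ($f>0$ on $(0,1)$, $f''<-M$ on $[0,1]$ for some $M>0$, $f'(0)=1$, $f'(1)<0$). By a solution we mean functions $u,w,T$ that are continuous for $t\ge0$ and of class $C^3$ for $t>0$, are $\lambda$-periodic in $x$, satisfy the system for $t>0$, have $0\le T(\cdot,0)\le1$, satisfy the front conditions $T\to1$ as $z\to-\infty$, $T\to0$ as $z\to+\infty$,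 $v\to0$ as $|z|\to\infty$ (uniformly in $x$ and locally uniformly in $t\ge0$) and $\omega\to0$ as $|z|\to\infty$ (uniformly in $x$, for each $t>0$), and are such that $v,\nabla v,\partial_tv,\partial_xT\in L^\infty_{loc}((0,\infty);L^2(D))$. Theorem. There is an absolute constant $C_2>0$ and, for every $m_1$, a constant $C_1>0$ depending only on $m_1$, such that the following holds whenever $\max_{[0,1]}|f'|\le m_1$, $\lambda<C_1$ and $\rho<C_2/\lambda^3$ (with $\sigma>0$ arbitrary). Every solution satisfies $$\|\omega(\cdot,t)\|_{L^2(D)}+\|\partial_xT(\cdot,t)\|_{L^2(D)}\to0\qquad\text{as }t\to\infty .$$ Suppose moreover that $f$ is of concave KPP type and that the initial temperature is front-like: $T(x,z,0)\le e^{\alpha-z}$ and $1-T(x,z,0)\le e^{\alpha'+az}$ for all $(x,z)$, for some $\alpha,\alpha'\in\mathbb R$ and $a>0$. Then $\partial_tT(\cdot,t)\in L^1(D)$ for almost every $t>0$, the bulk burning rate $V(t)=\frac1\lambda\int_D\partial_tT(x,z,t)\,dx\,dz$ is integrable on $(0,t)$ for every $t>0$, and its average $\overline V(t)=\frac1t\int_0^tV(s)\,ds$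 satisfies $$\limsup_{t\to\infty}\overline V(t)\le2 .$$ -/

import Mathlib

open MeasureTheory Filter Topology Set
open scoped ContDiff ENNReal

noncomputable section

namespace ReactiveBoussinesq

/-! Scalar fields on the strip are functions `g x z t` of the horizontal variable `x`,
the vertical variable `z` and the time `t`. -/

/-- Partial derivative in `x`. -/
def dx (g : ℝ → ℝ → ℝ → ℝ) : ℝ → ℝ → ℝ → ℝ := fun x z t => deriv (fun y => g y z t) x

/-- Partial derivative in `z`. -/
def dz (g : ℝ → ℝ → ℝ → ℝ) : ℝ → ℝ → ℝ → ℝ := fun x z t => deriv (fun y => g x y t) z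

/-- Partial derivative in `t`. -/
def dt (g : ℝ → ℝ → ℝ → ℝ) : ℝ → ℝ → ℝ → ℝ := fun x z t => deriv (fun s => g x z s) t

/-- The Laplacian in the space variables `(x, z)`. -/
def lap (g : ℝ → ℝ → ℝ → ℝ) : ℝ → ℝ → ℝ → ℝ :=
  fun x z t => dx (dx g) x z t + dz (dz g) x z t

/-- The vorticity `w_x - u_z` of the velocity `(u, w)`. -/
def vort (u w : ℝ → ℝ → ℝ → ℝ) : ℝ → ℝ → ℝ → ℝ := fun x z t => dx w x z t - dz u x z t

/-- Lebesgue measure on one period cell `D = [0, L] × ℝ` of the strip. -/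
def cell (L : ℝ) : Measure (ℝ × ℝ) := volume.restrict (Icc 0 L ×ˢ univ)

/-- The `L²(D)` norm of the field `g` at time `t`, with values in `[0, ∞]`. -/
def normL2 (L : ℝ) (g : ℝ → ℝ → ℝ → ℝ) (t : ℝ) : ℝ≥0∞ :=
  eLpNorm (fun p : ℝ × ℝ => g p.1 p.2 t) 2 (cell L)

/-- `g ∈ L^∞_loc((0, ∞); L²(D))`. -/
def LocBddL2 (L : ℝ) (g : ℝ → ℝ → ℝ → ℝ) : Prop :=
  ∀ a b : ℝ, 0 < a → ∃ K : ℝ, ∀ t ∈ Icc a b, normL2 L g t ≤ ENNReal.ofReal K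

/-- `g` is periodic in `x` with period `L`, for all times `t ≥ 0`. -/
def PeriodicX (L : ℝ) (g : ℝ → ℝ → ℝ → ℝ) : Prop :=
  ∀ x z t, 0 ≤ t → g (x + L) z t = g x z t

/-- `g` is continuous for `t ≥ 0` and (jointly) three times continuously differentiable
for `t > 0`. -/
def Regular (g : ℝ → ℝ → ℝ → ℝ) : Prop :=
  ContinuousOn (fun p : ℝ × ℝ × ℝ => g p.1 p.2.1 p.2.2) {p | 0 ≤ p.2.2} ∧
    ContDiffOn ℝ 3 (fun p : ℝ × ℝ × ℝ => g p.1 p.2.1 p.2.2) {p | 0 < p.2.2}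

/-- `g x z t → c` as `z` runs along the filter `l`, uniformly in `x` and locally uniformly
in `t ≥ 0`. -/
def LimitsTo (g : ℝ → ℝ → ℝ → ℝ) (l : Filter ℝ) (c : ℝ) : Prop :=
  ∀ τ : ℝ, TendstoUniformlyOn (fun (z : ℝ) (p : ℝ × ℝ) => g p.1 z p.2) (fun _ => c) l
    (univ ×ˢ Icc 0 τ)

/-- Bistable reaction. -/
structure IsBistable (f : ℝ → ℝ) : Prop where
  smooth : ContDiff ℝ ∞ f
  zero : f 0 = 0
  one : f 1 = 0
  sign : ∃ θ ∈ Ioo (0 : ℝ) 1, (∀ s ∈ Ioo 0 θ, f s < 0) ∧ ∀ s ∈ Ioo θ 1, 0 < f s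

/-- Reaction of ignition type. -/
structure IsIgnition (f : ℝ → ℝ) : Prop where
  smooth : ContDiff ℝ ∞ f
  zero : f 0 = 0
  one : f 1 = 0
  sign : ∃ θ ∈ Ioo (0 : ℝ) 1, (∀ s ∈ Icc 0 θ, f s = 0) ∧ ∀ s ∈ Ioo θ 1, 0 < f s

/-- Concave KPP reaction, with the slope at zero normalized to one. -/
structure IsConcaveKPP (f : ℝ → ℝ) : Prop where
  smooth : ContDiff ℝ ∞ f
  zero : f 0 = 0
  one : f 1 = 0
  pos : ∀ s ∈ Ioo (0 : ℝ) 1, 0 < f s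
  concave : ∃ M > 0, ∀ s ∈ Icc (0 : ℝ) 1, deriv (deriv f) s < -M
  slope_zero : deriv f 0 = 1
  slope_one : deriv f 1 < 0

/-- The three types of nonlinearity. -/
def IsReaction (f : ℝ → ℝ) : Prop := IsBistable f ∨ IsIgnition f ∨ IsConcaveKPP f

/-- Global classical solutions `(u, w, T)` of the nondimensional reactive Boussinesq system
in the strip of period `L`, with reaction `f`, Prandtl number `σ` and Rayleigh number `ρ`,
under front boundary conditions, in the natural energy class. -/
structure IsSolution (f : ℝ → ℝ) (σ ρ L : ℝ) (u w T : ℝ → ℝ → ℝ → ℝ) : Prop where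
  regular_u : Regular u
  regular_w : Regular w
  regular_T : Regular T
  periodic_u : PeriodicX L u
  periodic_w : PeriodicX L w
  periodic_T : PeriodicX L T
  /-- incompressibility -/
  div_free : ∀ x z t, 0 < t → dx u x z t + dz w x z t = 0
  /-- vorticity equation -/
  vorticity_eq : ∀ x z t, 0 < t →
    dt (vort u w) x z t + u x z t * dx (vort u w) x z t + w x z t * dz (vort u w) x z t
      - σ * lap (vort u w) x z t = σ * ρ * dx T x z t
  /-- temperature equation -/
  temperature_eq : ∀ x z t, 0 < t →
    dt T x z t + u x z t * dx T x z t + w x z t * dz T x z t - lap T x z t = f (T x z t)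
  T_bot : LimitsTo T atBot 1
  T_top : LimitsTo T atTop 0
  u_infty : LimitsTo u (cocompact ℝ) 0
  w_infty : LimitsTo w (cocompact ℝ) 0
  vort_infty : ∀ t, 0 < t →
    TendstoUniformly (fun z x : ℝ => vort u w x z t) (fun _ => 0) (cocompact ℝ)
  /-- the initial temperature is between `0` and `1` -/
  T_init : ∀ x z, 0 ≤ T x z 0 ∧ T x z 0 ≤ 1
  L2_u : LocBddL2 L u
  L2_w : LocBddL2 L w
  L2_dx_u : LocBddL2 L (dx u)
  L2_dz_u : LocBddL2 L (dz u)
  L2_dx_w : LocBddL2 L (dx w)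
  L2_dz_w : LocBddL2 L (dz w)
  L2_dt_u : LocBddL2 L (dt u)
  L2_dt_w : LocBddL2 L (dt w)
  L2_dx_T : LocBddL2 L (dx T)

/-- Front-like initial temperature: it tends to `0` at least like `exp (-z)` as `z → ∞`, and
to `1` at some exponential rate as `z → -∞`. -/
def FrontLike (T : ℝ → ℝ → ℝ → ℝ) : Prop :=
  (∃ α : ℝ, ∀ x z, T x z 0 ≤ Real.exp (α - z)) ∧
    ∃ α a : ℝ, 0 < a ∧ ∀ x z, 1 - T x z 0 ≤ Real.exp (α + a * z)

/-- The bulk burning rate `V(t) = L⁻¹ ∫_D T_t dx dz`. -/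
def burningRate (L : ℝ) (T : ℝ → ℝ → ℝ → ℝ) (t : ℝ) : ℝ :=
  1 / L * ∫ p : ℝ × ℝ, dt T p.1 p.2 t ∂(cell L)

/-- The time average `t⁻¹ ∫₀ᵗ V(s) ds` of the bulk burning rate. -/
def avgBurningRate (L : ℝ) (T : ℝ → ℝ → ℝ → ℝ) (t : ℝ) : ℝ :=
  1 / t * ∫ s in (0 : ℝ)..t, burningRate L T s

end ReactiveBoussinesq

end

/-!
Write `S = T_x`, `ω` for the vorticity and `κ = 1 / (σ ρ L)`. All identities are derived on the
period cell against compactly supported weights `η` in `z` (`cutInt`), which are then removed by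
Fatou's lemma; on each horizontal slice, functions of zero mean in `x` satisfy Poincaré's inequality
with constant `L`, and this is where the smallness of the period enters.

*Relaxation.* The maximum principle (`comparison`) gives `0 ≤ T ≤ 1`. In the energy balance of
`½ ∫ (S² + κ ω²)` three source terms appear. The coupling `ω S` is controlled because `S` has zero
mean on slices. The reaction term `f'(T) S²` is controlled because `m₁ L² ≤ 1/4`. In the stretching
term `S v_x · ∇T` the gradient is moved away from `T`, which leaves `T v_x · ∇S` with `0 ≤ T ≤ 1`;
since `v_x = (-w_z, w_x)` and `ω_x = Δ w`, Poincaré's inequality and the Hessian identity bound it by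
`L²` times the dissipation of `ω`, which is admissible because `ρ L³ ≤ 1/4`. So the energy decreases
and its dissipation is integrable in time (`energy_rate`, `energy_antitone`, `integral_dDens_le`).

The dissipation does not control the horizontal mean of `ω`, which is minus the shear `p_z` of the mean
flow `p(z, t) = ∫ u dx`. The mean pressure gradient vanishes and `p_t = ∫ w ω dx + σ p_zz`
(`integral_dt_u`), where the flux is bounded by the dissipation, again because `w` has zero mean.
After a late time the remaining loss of energy is too small for the flux to increase `∫ p²` much;
hence `p_z` is square integrable in space-time (`exists_mean_shear_bound`), the energy itself is
integrable in time, and being monotone it tends to zero (`tendsto_energy`).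

*Burning rate.* The supremum of `|w|` is controlled by the Hessian of `w` in `L²`, whose square is
integrable in time, so the time integral of `sup |w|` grows slower than any `ε t`
(`exists_velocity_majorant`). For a concave KPP reaction `f(s) ≤ s`, and comparison with moving
exponentials gives `T ≤ exp (C + (2 + ε) t - z)`; behind the front `1 - T` decays exponentially
(`exists_T_le_exp`, `exists_one_sub_T_le_exp`). The mass balance of `T` therefore limits the mass
burnt up to time `t`, namely `∫₀ᵗ ∫ f(T)`, by `L (C + (2 + ε) t)` (`exists_integral_f_le`).

It remains to identify the burning rate with `∫ f(T) / L`, which requires `T_t ∈ L¹(D)` for almost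
every `t`. This follows from weighted estimates: the evolution of `T - T²` bounds
`∫∫ (1 + z²)² |∇T|²` (`exists_weighted_grad_bound`), and testing the temperature equation with
`(t - a) (1 + z²)² T_t` then bounds `∫∫ (t - a) (1 + z²)² T_t²` (`lintegral_dt_T_sq_lt_top`).
-/

open MeasureTheory Filter Topology Set
open scoped ContDiff ENNReal

noncomputable section

namespace ReactiveBoussinesq

/-! ### Integration over the period cell against vertical cutoffs -/

/-- `gx`, `gz` are the continuous partial derivatives of the continuous function `g` of `(x, z)`,
which is `L`-periodic in `x`. -/
structure HasGrad (L : ℝ) (g gx gz : ℝ → ℝ → ℝ) : Prop where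
  cont : Continuous fun q : ℝ × ℝ => g q.1 q.2
  cont_x : Continuous fun q : ℝ × ℝ => gx q.1 q.2
  cont_z : Continuous fun q : ℝ × ℝ => gz q.1 q.2
  hx : ∀ x z, HasDerivAt (fun y => g y z) (gx x z) x
  hz : ∀ x z, HasDerivAt (fun y => g x y) (gz x z) z
  per : ∀ x z, g (x + L) z = g x z

namespace HasGrad
variable {L : ℝ} {g gx gz h hx hz : ℝ → ℝ → ℝ}

theorem mul (hg : HasGrad L g gx gz) (hh : HasGrad L h hx hz) :
    HasGrad L (fun x z => g x z * h x z) (fun x z => gx x z * h x z + g x z * hx x z)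
      (fun x z => gz x z * h x z + g x z * hz x z) where
  cont := hg.cont.mul hh.cont
  cont_x := (hg.cont_x.mul hh.cont).add (hg.cont.mul hh.cont_x)
  cont_z := (hg.cont_z.mul hh.cont).add (hg.cont.mul hh.cont_z)
  hx x z := (hg.hx x z).mul (hh.hx x z)
  hz x z := (hg.hz x z).mul (hh.hz x z)
  per x z := by simp only [hg.per, hh.per]

theorem add (hg : HasGrad L g gx gz) (hh : HasGrad L h hx hz) :
    HasGrad L (fun x z => g x z + h x z) (fun x z => gx x z + hx x z)
      (fun x z => gz x z + hz x z) where
  cont := hg.cont.add hh.cont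
  cont_x := hg.cont_x.add hh.cont_x
  cont_z := hg.cont_z.add hh.cont_z
  hx x z := (hg.hx x z).add (hh.hx x z)
  hz x z := (hg.hz x z).add (hh.hz x z)
  per x z := by simp only [hg.per, hh.per]

theorem const_mul (c : ℝ) (hg : HasGrad L g gx gz) :
    HasGrad L (fun x z => c * g x z) (fun x z => c * gx x z) (fun x z => c * gz x z) where
  cont := hg.cont.const_mul c
  cont_x := hg.cont_x.const_mul c
  cont_z := hg.cont_z.const_mul c
  hx x z := (hg.hx x z).const_mul c
  hz x z := (hg.hz x z).const_mul c
  per x z := by simp only [hg.per]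

theorem sub (hg : HasGrad L g gx gz) (hh : HasGrad L h hx hz) :
    HasGrad L (fun x z => g x z - h x z) (fun x z => gx x z - hx x z)
      (fun x z => gz x z - hz x z) where
  cont := hg.cont.sub hh.cont
  cont_x := hg.cont_x.sub hh.cont_x
  cont_z := hg.cont_z.sub hh.cont_z
  hx x z := (hg.hx x z).sub (hh.hx x z)
  hz x z := (hg.hz x z).sub (hh.hz x z)
  per x z := by simp only [hg.per, hh.per]

theorem const (L c : ℝ) : HasGrad L (fun _ _ => c) (fun _ _ => 0) (fun _ _ => 0) where
  cont := continuous_const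
  cont_x := continuous_const
  cont_z := continuous_const
  hx x _ := hasDerivAt_const x c
  hz _ z := hasDerivAt_const z c
  per _ _ := rfl

end HasGrad

theorem cell_eq_prod (L : ℝ) : cell L = (volume.restrict (Icc 0 L)).prod volume := by
  rw [cell, Measure.volume_eq_prod, ← Measure.prod_restrict, Measure.restrict_univ]

instance (L : ℝ) : SFinite (cell L) := by rw [cell]; infer_instance

theorem integrable_cutoff {η : ℝ → ℝ} (hη : Continuous η) (hc : HasCompactSupport η) (L : ℝ)
    {F : ℝ → ℝ → ℝ} (hF : Continuous fun q : ℝ × ℝ => F q.1 q.2) :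
    Integrable (fun p : ℝ × ℝ => η p.2 * F p.1 p.2) (cell L) := by
  have h1 : IntegrableOn (fun p : ℝ × ℝ => η p.2 * F p.1 p.2) (Icc 0 L ×ˢ tsupport η) volume :=
    ((hη.comp continuous_snd).mul hF).continuousOn.integrableOn_compact
      (isCompact_Icc.prod hc)
  refine IntegrableOn.of_forall_sdiff_eq_zero h1 (measurableSet_Icc.prod MeasurableSet.univ) ?_
  rintro ⟨x, z⟩ ⟨h2, h3⟩
  have : z ∉ tsupport η := fun h => h3 ⟨h2.1, h⟩
  simp [image_eq_zero_of_notMem_tsupport this]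

/-- Fubini on the cell; the inner integral is written as an interval integral. -/
theorem integral_cell_eq {L : ℝ} (hL : 0 ≤ L) {F : ℝ × ℝ → ℝ} (hF : Integrable F (cell L)) :
    ∫ p, F p ∂(cell L) = ∫ z, ∫ x in (0 : ℝ)..L, F (x, z) := by
  rw [cell_eq_prod] at hF ⊢
  rw [integral_prod_symm _ hF]
  congr 1; ext z
  rw [intervalIntegral.integral_of_le hL, integral_Icc_eq_integral_Ioc]

theorem integrable_slice {L : ℝ} (hL : 0 ≤ L) {F : ℝ × ℝ → ℝ} (hF : Integrable F (cell L)) :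
    Integrable (fun z => ∫ x in (0 : ℝ)..L, F (x, z)) := by
  rw [cell_eq_prod] at hF
  have := hF.integral_prod_right
  refine this.congr (Eventually.of_forall fun z => ?_)
  simp only
  rw [intervalIntegral.integral_of_le hL, integral_Icc_eq_integral_Ioc]

/-- The integral over the period cell of `F` against the weight `η` in the vertical variable. -/
def cutInt (L : ℝ) (η : ℝ → ℝ) (F : ℝ → ℝ → ℝ) : ℝ :=
  ∫ p : ℝ × ℝ, η p.2 * F p.1 p.2 ∂(cell L)

section cutInt
variable {L : ℝ} {η : ℝ → ℝ} {F G : ℝ → ℝ → ℝ}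

theorem cutInt_congr (h : ∀ x z, F x z = G x z) : cutInt L η F = cutInt L η G := by
  simp only [cutInt, h]

theorem cutInt_const_mul (c : ℝ) : cutInt L η (fun x z => c * F x z) = c * cutInt L η F := by
  rw [cutInt, cutInt, ← integral_const_mul]
  congr 1; ext p; ring

theorem cutInt_neg : cutInt L η (fun x z => -F x z) = -cutInt L η F := by
  rw [cutInt, cutInt, ← integral_neg]
  congr 1; ext p; ring

theorem cutInt_add (hη : Continuous η) (hc : HasCompactSupport η)
    (hF : Continuous fun q : ℝ × ℝ => F q.1 q.2) (hG : Continuous fun q : ℝ × ℝ => G q.1 q.2) :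
    cutInt L η (fun x z => F x z + G x z) = cutInt L η F + cutInt L η G := by
  rw [cutInt, cutInt, cutInt,
    ← integral_add (integrable_cutoff hη hc L hF) (integrable_cutoff hη hc L hG)]
  congr 1; ext p; ring

theorem cutInt_sub (hη : Continuous η) (hc : HasCompactSupport η)
    (hF : Continuous fun q : ℝ × ℝ => F q.1 q.2) (hG : Continuous fun q : ℝ × ℝ => G q.1 q.2) :
    cutInt L η (fun x z => F x z - G x z) = cutInt L η F - cutInt L η G := by
  rw [cutInt, cutInt, cutInt,
    ← integral_sub (integrable_cutoff hη hc L hF) (integrable_cutoff hη hc L hG)]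
  congr 1; ext p; ring

theorem cutInt_nonneg (h0 : ∀ z, 0 ≤ η z) (h : ∀ x z, 0 ≤ F x z) : 0 ≤ cutInt L η F :=
  integral_nonneg fun p => mul_nonneg (h0 p.2) (h p.1 p.2)

theorem cutInt_mono (hη : Continuous η) (hc : HasCompactSupport η) (h0 : ∀ z, 0 ≤ η z)
    (hF : Continuous fun q : ℝ × ℝ => F q.1 q.2) (hG : Continuous fun q : ℝ × ℝ => G q.1 q.2)
    (h : ∀ x z, F x z ≤ G x z) : cutInt L η F ≤ cutInt L η G :=
  integral_mono (integrable_cutoff hη hc L hF) (integrable_cutoff hη hc L hG)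
    fun p => mul_le_mul_of_nonneg_left (h p.1 p.2) (h0 p.2)

/-- A cutoff inequality on the cell follows from the inequality on each horizontal slice. -/
theorem cutInt_mono_slice (hL : 0 ≤ L) (hη : Continuous η) (hc : HasCompactSupport η)
    (h0 : ∀ z, 0 ≤ η z)
    (hF : Continuous fun q : ℝ × ℝ => F q.1 q.2) (hG : Continuous fun q : ℝ × ℝ => G q.1 q.2)
    (h : ∀ z, ∫ x in (0 : ℝ)..L, F x z ≤ ∫ x in (0 : ℝ)..L, G x z) :
    cutInt L η F ≤ cutInt L η G := by
  rw [cutInt, cutInt, integral_cell_eq hL (integrable_cutoff hη hc L hF),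
    integral_cell_eq hL (integrable_cutoff hη hc L hG)]
  refine integral_mono (integrable_slice hL (integrable_cutoff hη hc L hF))
    (integrable_slice hL (integrable_cutoff hη hc L hG)) fun z => ?_
  simp only [intervalIntegral.integral_const_mul]
  exact mul_le_mul_of_nonneg_left (h z) (h0 z)

end cutInt

/-- The divergence theorem on the cell against a cutoff in `z`. -/
theorem cutInt_div {L : ℝ} (hL : 0 ≤ L) {η η' : ℝ → ℝ} (hη : ∀ z, HasDerivAt η (η' z) z)
    (hη' : Continuous η') (hc : HasCompactSupport η) {P Px Pz Q Qx Qz : ℝ → ℝ → ℝ}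
    (hP : HasGrad L P Px Pz) (hQ : HasGrad L Q Qx Qz) :
    cutInt L η (fun x z => Px x z + Qz x z) = -cutInt L η' Q := by
  have hηc : Continuous η := continuous_iff_continuousAt.2 fun z => (hη z).continuousAt
  have hη'd : η' = deriv η := funext fun z => (hη z).deriv.symm
  have hc' : HasCompactSupport η' := hη'd ▸ hc.deriv
  have i1 := integrable_cutoff hηc hc L hP.cont_x
  have i2 := integrable_cutoff hηc hc L hQ.cont_z
  have i3 := integrable_cutoff hη' hc' L hQ.cont
  have e1 : ∫ p : ℝ × ℝ, η p.2 * Px p.1 p.2 ∂(cell L) = 0 := by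
    rw [integral_cell_eq hL i1]
    have : ∀ z, ∫ x in (0 : ℝ)..L, η z * Px x z = 0 := fun z => by
      rw [intervalIntegral.integral_const_mul,
        intervalIntegral.integral_eq_sub_of_hasDerivAt (fun x _ => hP.hx x z)
          ((hP.cont_x.comp (by fun_prop : Continuous fun x : ℝ => (x, z))).intervalIntegrable _ _)]
      have := hP.per 0 z
      rw [zero_add] at this
      simp [this]
    simp [this]
  have e2 : ∫ p : ℝ × ℝ, (η p.2 * Qz p.1 p.2 + η' p.2 * Q p.1 p.2) ∂(cell L) = 0 := by
    have i := i2.add i3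
    rw [cell_eq_prod] at i ⊢
    rw [integral_prod (fun p : ℝ × ℝ => η p.2 * Qz p.1 p.2 + η' p.2 * Q p.1 p.2) i]
    have : ∀ x, ∫ z, (η z * Qz x z + η' z * Q x z) = 0 := fun x => by
      have hs : Continuous fun z : ℝ => (x, z) := by fun_prop
      refine integral_eq_zero_of_hasDerivAt_of_integrable (f := fun z => η z * Q x z)
        (fun z => ?_) ?_ ?_
      · exact ((hη z).mul (hQ.hz x z)).congr_deriv (add_comm _ _)
      · exact ((hηc.mul (hQ.cont_z.comp hs)).integrable_of_hasCompactSupport hc.mul_right).add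
          ((hη'.mul (hQ.cont.comp hs)).integrable_of_hasCompactSupport hc'.mul_right)
      · exact (hηc.mul (hQ.cont.comp hs)).integrable_of_hasCompactSupport hc.mul_right
    simp [this]
  rw [integral_add i2 i3] at e2
  rw [cutInt_add hηc hc hP.cont_x hQ.cont_z]
  simp only [cutInt]
  linarith

/-! ### Local integral identities -/

/-- `η` is a compactly supported `C²` function with derivatives `η'` and `η''`. -/
structure IsCutoff (η η' η'' : ℝ → ℝ) : Prop where
  deriv₁ : ∀ z, HasDerivAt η (η' z) z
  deriv₂ : ∀ z, HasDerivAt η' (η'' z) z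
  cont₂ : Continuous η''
  supp : HasCompactSupport η

namespace IsCutoff
variable {η η' η'' : ℝ → ℝ}

theorem cont (h : IsCutoff η η' η'') : Continuous η :=
  continuous_iff_continuousAt.2 fun z => (h.deriv₁ z).continuousAt

theorem cont₁ (h : IsCutoff η η' η'') : Continuous η' :=
  continuous_iff_continuousAt.2 fun z => (h.deriv₂ z).continuousAt

theorem supp₁ (h : IsCutoff η η' η'') : HasCompactSupport η' := by
  have : η' = deriv η := funext fun z => (h.deriv₁ z).deriv.symm
  exact this ▸ h.supp.deriv

theorem supp₂ (h : IsCutoff η η' η'') : HasCompactSupport η'' := by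
  have : η'' = deriv η' := funext fun z => (h.deriv₂ z).deriv.symm
  exact this ▸ h.supp₁.deriv

end IsCutoff

section identities
variable {L : ℝ} {η η' η'' : ℝ → ℝ}

/-- If `F` is a divergence plus `B`, its weighted integral is that of `B` up to a term carrying the
derivative of the weight. -/
theorem cutInt_of_eq_div (hL : 0 ≤ L) (hη : IsCutoff η η' η'')
    {P Px Pz Q Qx Qz F B : ℝ → ℝ → ℝ} (hP : HasGrad L P Px Pz) (hQ : HasGrad L Q Qx Qz)
    (hB : Continuous fun q : ℝ × ℝ => B q.1 q.2)
    (h : ∀ x z, F x z = Px x z + Qz x z + B x z) :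
    cutInt L η F = -cutInt L η' Q + cutInt L η B := by
  rw [← cutInt_div hL hη.deriv₁ hη.cont₁ hη.supp hP hQ,
    ← cutInt_add hη.cont hη.supp (hP.cont_x.add hQ.cont_z) hB]
  exact cutInt_congr h

theorem cutInt_deriv (hL : 0 ≤ L) (hη : IsCutoff η η' η'') {Q Qx Qz : ℝ → ℝ → ℝ}
    (hQ : HasGrad L Q Qx Qz) : cutInt L η' Qz = -cutInt L η'' Q := by
  rw [← cutInt_div hL hη.deriv₂ hη.cont₂ hη.supp₁ (HasGrad.const L 0) hQ]
  simp

variable {u ux uz w wx wz g gx gz gxx gxz gzx gzz : ℝ → ℝ → ℝ}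

/-- Local energy identity for the advection-diffusion operator with a divergence-free drift. -/
theorem cutInt_energy (hL : 0 ≤ L) (hη : IsCutoff η η' η'')
    (hu : HasGrad L u ux uz) (hw : HasGrad L w wx wz) (hdiv : ∀ x z, ux x z + wz x z = 0)
    (hg : HasGrad L g gx gz) (hgx : HasGrad L gx gxx gxz) (hgz : HasGrad L gz gzx gzz) (ν : ℝ) :
    cutInt L η (fun x z => g x z * (ν * (gxx x z + gzz x z) - u x z * gx x z - w x z * gz x z))
      = -(ν * cutInt L η (fun x z => gx x z ^ 2 + gz x z ^ 2))
        + ν / 2 * cutInt L η'' (fun x z => g x z ^ 2)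
        + 1 / 2 * cutInt L η' (fun x z => w x z * g x z ^ 2) := by
  have hP := ((hg.mul hgx).const_mul ν).sub ((hu.mul (hg.mul hg)).const_mul (1 / 2))
  have hQ := ((hg.mul hgz).const_mul ν).sub ((hw.mul (hg.mul hg)).const_mul (1 / 2))
  have c1 := hg.cont
  have c2 := hg.cont_x
  have c3 := hg.cont_z
  have c4 := hw.cont
  rw [cutInt_of_eq_div hL hη hP hQ
    (B := fun x z => -(ν * (gx x z ^ 2 + gz x z ^ 2))) (by fun_prop) (fun x z => by
      linear_combination (1 / 2 * g x z ^ 2) * hdiv x z),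
    cutInt_neg, cutInt_const_mul, cutInt_sub hη.cont₁ hη.supp₁ (by fun_prop) (by fun_prop),
    cutInt_const_mul, cutInt_const_mul]
  have e1 := cutInt_deriv hL hη (hg.mul hg)
  have e2 : cutInt L η' (fun x z => gz x z * g x z + g x z * gz x z)
      = 2 * cutInt L η' (fun x z => g x z * gz x z) := by
    rw [← cutInt_const_mul]; exact cutInt_congr fun x z => by ring
  have e3 : cutInt L η' (fun x z => w x z * (g x z * g x z))
      = cutInt L η' (fun x z => w x z * g x z ^ 2) := cutInt_congr fun x z => by ring
  have e4 : cutInt L η'' (fun x z => g x z * g x z)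
      = cutInt L η'' (fun x z => g x z ^ 2) := cutInt_congr fun x z => by ring
  rw [e3]
  rw [e2, e4] at e1
  linear_combination (-ν / 2) * e1

/-- The Hessian of `w` is controlled by its Laplacian. -/
theorem cutInt_hessian (hL : 0 ≤ L) (hη : IsCutoff η η' η'')
    {wxx wxz wzz wxzx wxzz wzzx wzzz : ℝ → ℝ → ℝ}
    (hwx : HasGrad L wx wxx wxz) (hwzz : HasGrad L wzz wzzx wzzz)
    (hwxz : HasGrad L wxz wxzx wxzz) (hcomm : ∀ x z, wzzx x z = wxzz x z) :
    cutInt L η (fun x z => wxx x z ^ 2 + 2 * wxz x z ^ 2 + wzz x z ^ 2)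
      = cutInt L η (fun x z => (wxx x z + wzz x z) ^ 2)
        + cutInt L η'' (fun x z => wx x z ^ 2) := by
  have c1 := hwx.cont_x
  have c2 := hwxz.cont
  have c3 := hwzz.cont
  have c4 := hwx.cont
  rw [cutInt_of_eq_div hL hη ((hwx.mul hwzz).const_mul (-2))
    ((hwx.mul hwxz).const_mul 2)
    (B := fun x z => (wxx x z + wzz x z) ^ 2) (by fun_prop) (fun x z => by
      linear_combination (2 * wx x z) * hcomm x z), cutInt_const_mul]
  have e1 := cutInt_deriv hL hη (hwx.mul hwx)
  have e2 : cutInt L η' (fun x z => wxz x z * wx x z + wx x z * wxz x z)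
      = 2 * cutInt L η' (fun x z => wx x z * wxz x z) := by
    rw [← cutInt_const_mul]; exact cutInt_congr fun x z => by ring
  have e4 : cutInt L η'' (fun x z => wx x z * wx x z)
      = cutInt L η'' (fun x z => wx x z ^ 2) := cutInt_congr fun x z => by ring
  rw [e2, e4] at e1
  linarith

/-- The stretching term `-S (v_x · ∇T)` of the equation for `S = T_x`, after moving the
gradient from `T` to `S`. -/
theorem cutInt_stretch (hL : 0 ≤ L) (hη : IsCutoff η η' η'')
    {T Tz S Sx Sz uxx uxz wxx wxz : ℝ → ℝ → ℝ}
    (hT : HasGrad L T S Tz) (hS : HasGrad L S Sx Sz)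
    (hux : HasGrad L ux uxx uxz) (hwx : HasGrad L wx wxx wxz)
    (hdiv : ∀ x z, uxx x z + wxz x z = 0) :
    cutInt L η (fun x z => -(S x z * (ux x z * S x z + wx x z * Tz x z)))
      = cutInt L η' (fun x z => T x z * (S x z * wx x z))
        + cutInt L η (fun x z => T x z * (ux x z * Sx x z + wx x z * Sz x z)) := by
  have c1 := hT.cont
  have c2 := hS.cont_x
  have c3 := hS.cont_z
  have c4 := hwx.cont
  have c5 := hux.cont
  rw [cutInt_of_eq_div hL hη ((hT.mul (hS.mul hux)).const_mul (-1))
    ((hT.mul (hS.mul hwx)).const_mul (-1))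
    (B := fun x z => T x z * (ux x z * Sx x z + wx x z * Sz x z)) (by fun_prop) (fun x z => by
      linear_combination (T x z * S x z) * hdiv x z), cutInt_const_mul]
  ring

/-- Local mass balance for a scalar carried by a divergence-free drift. -/
theorem cutInt_mass (hL : 0 ≤ L) (hη : IsCutoff η η' η'')
    (hu : HasGrad L u ux uz) (hw : HasGrad L w wx wz) (hdiv : ∀ x z, ux x z + wz x z = 0)
    (hg : HasGrad L g gx gz) (hgx : HasGrad L gx gxx gxz) (hgz : HasGrad L gz gzx gzz) :
    cutInt L η (fun x z => gxx x z + gzz x z - u x z * gx x z - w x z * gz x z)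
      = cutInt L η'' g + cutInt L η' (fun x z => w x z * g x z) := by
  have c1 := hg.cont
  have c2 := hg.cont_z
  have c3 := hw.cont
  rw [cutInt_of_eq_div hL hη (hgx.sub (hu.mul hg)) (hgz.sub (hw.mul hg))
    (B := fun x z => 0) (by fun_prop) (fun x z => by linear_combination g x z * hdiv x z),
    cutInt_sub hη.cont₁ hη.supp₁ (by fun_prop) (by fun_prop), cutInt_deriv hL hη hg]
  simp [cutInt]; ring

/-- The evolution of `g - g²` under advection and diffusion produces the Dirichlet energy. -/
theorem cutInt_concave (hL : 0 ≤ L) (hη : IsCutoff η η' η'')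
    (hu : HasGrad L u ux uz) (hw : HasGrad L w wx wz) (hdiv : ∀ x z, ux x z + wz x z = 0)
    (hg : HasGrad L g gx gz) (hgx : HasGrad L gx gxx gxz) (hgz : HasGrad L gz gzx gzz) :
    cutInt L η (fun x z => (1 - 2 * g x z)
        * (gxx x z + gzz x z - u x z * gx x z - w x z * gz x z))
      = cutInt L η'' (fun x z => g x z - g x z * g x z)
        + cutInt L η' (fun x z => w x z * (g x z - g x z * g x z))
        + 2 * cutInt L η (fun x z => gx x z ^ 2 + gz x z ^ 2) := by
  have c1 := hg.cont
  have c2 := hg.cont_z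
  have c3 := hw.cont
  have c4 := hg.cont_x
  have h1 := (HasGrad.const L 1).sub (hg.const_mul 2)
  have hh := hg.sub (hg.mul hg)
  rw [cutInt_of_eq_div hL hη ((h1.mul hgx).sub (hu.mul hh)) ((h1.mul hgz).sub (hw.mul hh))
    (B := fun x z => 2 * (gx x z ^ 2 + gz x z ^ 2)) (by fun_prop) (fun x z => by
      linear_combination (g x z - g x z * g x z) * hdiv x z),
    cutInt_sub hη.cont₁ hη.supp₁ (by fun_prop) (by fun_prop), cutInt_const_mul]
  have e1 := cutInt_deriv hL hη hh
  have e2 : cutInt L η' (fun x z => gz x z - (gz x z * g x z + g x z * gz x z))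
      = cutInt L η' (fun x z => (1 - 2 * g x z) * gz x z) := cutInt_congr fun x z => by ring
  rw [e2] at e1
  rw [e1]; ring

/-- Integration by parts of `∇g · ∇k`. -/
theorem cutInt_grad_mul (hL : 0 ≤ L) (hη : IsCutoff η η' η'') {k kx kz : ℝ → ℝ → ℝ}
    (hk : HasGrad L k kx kz) (hgx : HasGrad L gx gxx gxz) (hgz : HasGrad L gz gzx gzz) :
    cutInt L η (fun x z => gx x z * kx x z + gz x z * kz x z)
      = -cutInt L η' (fun x z => k x z * gz x z)
        - cutInt L η (fun x z => k x z * (gxx x z + gzz x z)) := by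
  have c1 := hk.cont
  have c2 := hgx.cont_x
  have c3 := hgz.cont_z
  rw [cutInt_of_eq_div hL hη (hk.mul hgx) (hk.mul hgz)
    (B := fun x z => -(k x z * (gxx x z + gzz x z))) (by fun_prop) (fun x z => by ring),
    cutInt_neg]
  ring

end identities

/-! ### Poincaré inequalities on horizontal slices -/

theorem sq_integral_le {a b : ℝ} (hab : a ≤ b) {h : ℝ → ℝ} (hh : Continuous h) :
    (∫ x in a..b, h x) ^ 2 ≤ (b - a) * ∫ x in a..b, h x ^ 2 := by
  rcases hab.eq_or_lt with rfl | hlt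
  · simp
  have key : ∀ c : ℝ, 0 ≤ (∫ x in a..b, h x ^ 2) - 2 * c * (∫ x in a..b, h x) + c ^ 2 * (b - a) := by
    intro c
    have h0 : 0 ≤ ∫ x in a..b, (h x - c) ^ 2 :=
      intervalIntegral.integral_nonneg hab fun x _ => sq_nonneg _
    have : ∫ x in a..b, (h x - c) ^ 2
        = (∫ x in a..b, h x ^ 2) - 2 * c * (∫ x in a..b, h x) + c ^ 2 * (b - a) := by
      have e : ∀ x, (h x - c) ^ 2 = h x ^ 2 - 2 * c * h x + c ^ 2 := fun x => by ring
      simp only [e]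
      rw [intervalIntegral.integral_add, intervalIntegral.integral_sub,
        intervalIntegral.integral_const_mul, intervalIntegral.integral_const, smul_eq_mul]
      · ring
      all_goals exact Continuous.intervalIntegrable (by fun_prop) _ _
    rwa [this] at h0
  have hpos : 0 < b - a := sub_pos.2 hlt
  have h1 := key ((∫ x in a..b, h x) / (b - a))
  have h2 : (∫ x in a..b, h x ^ 2) - 2 * ((∫ x in a..b, h x) / (b - a)) * (∫ x in a..b, h x)
      + ((∫ x in a..b, h x) / (b - a)) ^ 2 * (b - a)
      = (∫ x in a..b, h x ^ 2) - (∫ x in a..b, h x) ^ 2 / (b - a) := by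
    field_simp; ring
  rw [h2, sub_nonneg, div_le_iff₀ hpos] at h1
  linarith

section poincare
variable {L : ℝ} {φ φ' : ℝ → ℝ}

/-- A function of mean zero vanishes somewhere, so it is bounded by its derivative. -/
theorem sq_le_of_mean_zero (hL : 0 < L) (hφ : ∀ x, HasDerivAt φ (φ' x) x) (hφ' : Continuous φ')
    (h0 : ∫ x in (0 : ℝ)..L, φ x = 0) {x : ℝ} (hx : x ∈ Icc 0 L) :
    φ x ^ 2 ≤ L * ∫ y in (0 : ℝ)..L, φ' y ^ 2 := by
  have hc : Continuous φ := continuous_iff_continuousAt.2 fun z => (hφ z).continuousAt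
  -- a function of mean zero vanishes somewhere
  obtain ⟨ξ, hξ, hξ0⟩ : ∃ ξ ∈ Ioo 0 L, φ ξ = 0 :=
    exists_hasDerivAt_eq_zero (f := fun s => ∫ y in (0 : ℝ)..s, φ y) hL
      (intervalIntegral.continuous_primitive (fun a b => hc.intervalIntegrable a b) 0).continuousOn
      (by simp [h0]) fun s _ => hc.integral_hasStrictDerivAt 0 s |>.hasDerivAt
  have e : φ x = ∫ y in ξ..x, φ' y := by
    rw [intervalIntegral.integral_eq_sub_of_hasDerivAt (fun y _ => hφ y)
      (hφ'.intervalIntegrable _ _), hξ0, sub_zero]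
  have hsq : Continuous fun y => φ' y ^ 2 := hφ'.pow 2
  have hI : ∀ a b : ℝ, 0 ≤ a → a ≤ b → b ≤ L →
      (∫ y in a..b, φ' y) ^ 2 ≤ L * ∫ y in (0 : ℝ)..L, φ' y ^ 2 := by
    intro a b ha hab hb
    refine (sq_integral_le hab hφ').trans ?_
    have h1 : ∫ y in a..b, φ' y ^ 2 ≤ ∫ y in (0 : ℝ)..L, φ' y ^ 2 :=
      intervalIntegral.integral_mono_interval ha hab hb
        (Eventually.of_forall fun y => sq_nonneg _) (hsq.intervalIntegrable _ _)
    have h2 : 0 ≤ ∫ y in a..b, φ' y ^ 2 :=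
      intervalIntegral.integral_nonneg hab fun y _ => sq_nonneg _
    exact mul_le_mul (by linarith) h1 h2 hL.le
  rcases le_total ξ x with hle | hle
  · rw [e]; exact hI ξ x hξ.1.le hle hx.2
  · rw [e, intervalIntegral.integral_symm, neg_sq]; exact hI x ξ hx.1 hle hξ.2.le

theorem poincare (hL : 0 < L) (hφ : ∀ x, HasDerivAt φ (φ' x) x) (hφ' : Continuous φ')
    (h0 : ∫ x in (0 : ℝ)..L, φ x = 0) :
    ∫ x in (0 : ℝ)..L, φ x ^ 2 ≤ L ^ 2 * ∫ y in (0 : ℝ)..L, φ' y ^ 2 := by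
  have hc : Continuous φ := continuous_iff_continuousAt.2 fun z => (hφ z).continuousAt
  calc ∫ x in (0 : ℝ)..L, φ x ^ 2 ≤ ∫ _ in (0 : ℝ)..L, L * ∫ y in (0 : ℝ)..L, φ' y ^ 2 :=
        intervalIntegral.integral_mono_on hL.le ((hc.pow 2).intervalIntegrable _ _)
          (continuous_const.intervalIntegrable _ _)
          fun x hx => sq_le_of_mean_zero hL hφ hφ' h0 hx
    _ = _ := by rw [intervalIntegral.integral_const, smul_eq_mul]; ring

theorem mean_zero_sub (hL : 0 < L) (hφ : Continuous φ) :
    ∫ x in (0 : ℝ)..L, (φ x - (∫ y in (0 : ℝ)..L, φ y) / L) = 0 := by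
  rw [intervalIntegral.integral_sub (hφ.intervalIntegrable _ _)
    (continuous_const.intervalIntegrable _ _), intervalIntegral.integral_const, smul_eq_mul]
  field_simp; ring

/-- Poincaré's inequality for a function of arbitrary mean. -/
theorem poincare_mean (hL : 0 < L) (hφ : ∀ x, HasDerivAt φ (φ' x) x) (hφ' : Continuous φ') :
    ∫ x in (0 : ℝ)..L, φ x ^ 2
      ≤ L ^ 2 * (∫ y in (0 : ℝ)..L, φ' y ^ 2) + (∫ x in (0 : ℝ)..L, φ x) ^ 2 / L := by
  have hc : Continuous φ := continuous_iff_continuousAt.2 fun z => (hφ z).continuousAt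
  have h1 := poincare hL (fun x => (hφ x).sub_const ((∫ y in (0 : ℝ)..L, φ y) / L)) hφ'
    (mean_zero_sub hL hc)
  set m := (∫ y in (0 : ℝ)..L, φ y) / L with hm
  have hm' : ∫ y in (0 : ℝ)..L, φ y = m * L := by rw [hm]; field_simp
  have e : ∫ x in (0 : ℝ)..L, (φ x - m) ^ 2 = (∫ x in (0 : ℝ)..L, φ x ^ 2) - m ^ 2 * L := by
    have e : ∀ x, (φ x - m) ^ 2 = φ x ^ 2 - 2 * m * φ x + m ^ 2 := fun x => by ring
    simp only [e]
    rw [intervalIntegral.integral_add, intervalIntegral.integral_sub,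
      intervalIntegral.integral_const_mul, intervalIntegral.integral_const, smul_eq_mul, hm']
    · ring
    all_goals exact Continuous.intervalIntegrable (by fun_prop) _ _
  rw [e] at h1
  rw [hm']
  have : (m * L) ^ 2 / L = m ^ 2 * L := by field_simp
  rw [this]; linarith

/-- The product of a function of mean zero with another function only sees the derivative of
the latter. -/
theorem integral_mul_le_of_mean_zero (hL : 0 < L) {g : ℝ → ℝ} (hg : Continuous g)
    (hg0 : ∫ x in (0 : ℝ)..L, g x = 0)
    (hφ : ∀ x, HasDerivAt φ (φ' x) x) (hφ' : Continuous φ') {c : ℝ} (hc : 0 < c) :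
    |∫ x in (0 : ℝ)..L, g x * φ x|
      ≤ (∫ x in (0 : ℝ)..L, g x ^ 2) / (2 * c) + c / 2 * (L ^ 2 * ∫ x in (0 : ℝ)..L, φ' x ^ 2) := by
  have hcφ : Continuous φ := continuous_iff_continuousAt.2 fun z => (hφ z).continuousAt
  have h1 := poincare hL (fun x => (hφ x).sub_const ((∫ y in (0 : ℝ)..L, φ y) / L)) hφ'
    (mean_zero_sub hL hcφ)
  set m := (∫ y in (0 : ℝ)..L, φ y) / L with hm
  have e : ∫ x in (0 : ℝ)..L, g x * φ x = ∫ x in (0 : ℝ)..L, g x * (φ x - m) := by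
    simp only [mul_sub]
    rw [intervalIntegral.integral_sub, intervalIntegral.integral_mul_const, hg0]
    · simp
    all_goals exact Continuous.intervalIntegrable (by fun_prop) _ _
  have hi : ∀ f : ℝ → ℝ, Continuous f → IntervalIntegrable f volume 0 L :=
    fun f hf => hf.intervalIntegrable _ _
  rw [e]
  calc |∫ x in (0 : ℝ)..L, g x * (φ x - m)| ≤ ∫ x in (0 : ℝ)..L, |g x * (φ x - m)| :=
        intervalIntegral.abs_integral_le_integral_abs hL.le
    _ ≤ ∫ x in (0 : ℝ)..L, (g x ^ 2 / (2 * c) + c / 2 * (φ x - m) ^ 2) := by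
        refine intervalIntegral.integral_mono_on hL.le (hi _ (by fun_prop)) (hi _ (by fun_prop))
          fun x _ => ?_
        have h2 : 0 ≤ (|g x| - c * |φ x - m|) ^ 2 / (2 * c) := by positivity
        have h3 : (|g x| - c * |φ x - m|) ^ 2 / (2 * c)
            = |g x| ^ 2 / (2 * c) + c / 2 * |φ x - m| ^ 2 - |g x| * |φ x - m| := by
          field_simp; ring
        rw [abs_mul]
        rw [h3, sq_abs, sq_abs] at h2
        linarith
    _ = (∫ x in (0 : ℝ)..L, g x ^ 2) / (2 * c) + c / 2 * ∫ x in (0 : ℝ)..L, (φ x - m) ^ 2 := by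
        rw [intervalIntegral.integral_add (hi _ (by fun_prop)) (hi _ (by fun_prop)),
          intervalIntegral.integral_div, intervalIntegral.integral_const_mul]
    _ ≤ _ := by gcongr

end poincare

/-! ### Differentiation under the integral sign -/

/-- `g` is continuous in `(x, z, t)` for `t > 0`. -/
def ContPos (g : ℝ → ℝ → ℝ → ℝ) : Prop :=
  ContinuousOn (fun p : ℝ × ℝ × ℝ => g p.1 p.2.1 p.2.2) {p | 0 < p.2.2}

theorem ContPos.slice {g : ℝ → ℝ → ℝ → ℝ} (hg : ContPos g) {t : ℝ} (ht : 0 < t) :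
    Continuous fun q : ℝ × ℝ => g q.1 q.2 t :=
  continuousOn_univ.1 (ContinuousOn.comp (t := {p : ℝ × ℝ × ℝ | 0 < p.2.2})
    (f := fun q : ℝ × ℝ => ((q.1, q.2, t) : ℝ × ℝ × ℝ)) hg (by fun_prop) fun _ _ => ht)

/-- Freezing the field before the time `a > 0` makes it continuous at all times. -/
theorem ContPos.shift {g : ℝ → ℝ → ℝ → ℝ} (hg : ContPos g) {a : ℝ} (ha : 0 < a) :
    Continuous fun q : ℝ × ℝ × ℝ => g q.2.1 q.2.2 (max q.1 a) :=
  continuousOn_univ.1 (ContinuousOn.comp (t := {p : ℝ × ℝ × ℝ | 0 < p.2.2})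
    (f := fun q : ℝ × ℝ × ℝ => ((q.2.1, q.2.2, max q.1 a) : ℝ × ℝ × ℝ)) hg (by fun_prop)
    fun _ _ => lt_max_of_lt_right ha)

theorem cutInt_eq_setIntegral (L : ℝ) (η : ℝ → ℝ) (F : ℝ → ℝ → ℝ) :
    cutInt L η F = ∫ p in Icc 0 L ×ˢ tsupport η, η p.2 * F p.1 p.2 := by
  rw [cutInt, cell]
  have h : ∀ p ∈ (Icc 0 L ×ˢ (univ : Set ℝ)) \ (Icc 0 L ×ˢ tsupport η),
      η p.2 * F p.1 p.2 = 0 := by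
    rintro ⟨x, z⟩ ⟨h2, h3⟩
    have : z ∉ tsupport η := fun h => h3 ⟨h2.1, h⟩
    simp [image_eq_zero_of_notMem_tsupport this]
  exact (setIntegral_eq_of_subset_of_forall_sdiff_eq_zero
    (measurableSet_Icc.prod MeasurableSet.univ) (prod_mono subset_rfl (subset_univ _)) h)

section time
variable {L : ℝ} {η : ℝ → ℝ} {g gt : ℝ → ℝ → ℝ → ℝ}

theorem continuousOn_cutInt (hη : Continuous η) (hc : HasCompactSupport η) (hg : ContPos g) :
    ContinuousOn (fun t => cutInt L η (fun x z => g x z t)) (Ioi 0) := by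
  intro t ht
  have ht2 : 0 < t / 2 := half_pos ht
  have h1 : Continuous fun s => ∫ p in Icc 0 L ×ˢ tsupport η, η p.2 * g p.1 p.2 (max s (t / 2)) := by
    refine continuous_parametric_integral_of_continuous (f := fun s (p : ℝ × ℝ) =>
      η p.2 * g p.1 p.2 (max s (t / 2))) ?_ (isCompact_Icc.prod hc)
    have := hg.shift ht2
    exact (hη.comp (continuous_snd.comp continuous_snd)).mul this
  refine (h1.continuousAt.congr ?_).continuousWithinAt
  have ht' : t / 2 < t := half_lt_self ht
  filter_upwards [lt_mem_nhds ht'] with s hs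
  rw [cutInt_eq_setIntegral, max_eq_left hs.le]

theorem hasDerivAt_cutInt (hη : Continuous η) (hc : HasCompactSupport η) (hg : ContPos g)
    (hgt : ContPos gt) (hd : ∀ x z t, 0 < t → HasDerivAt (fun s => g x z s) (gt x z t) t)
    {t : ℝ} (ht : 0 < t) :
    HasDerivAt (fun t => cutInt L η (fun x z => g x z t)) (cutInt L η (fun x z => gt x z t)) t := by
  simp only [cutInt_eq_setIntegral]
  have hK : IsCompact ((Icc 0 L ×ˢ tsupport η) ×ˢ Icc (t / 2) (2 * t)) :=
    (isCompact_Icc.prod hc).prod isCompact_Icc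
  have hcont : ContinuousOn (fun q : (ℝ × ℝ) × ℝ => η q.1.2 * gt q.1.1 q.1.2 q.2)
      ((Icc 0 L ×ˢ tsupport η) ×ˢ Icc (t / 2) (2 * t)) := by
    refine ContinuousOn.mul (by fun_prop) (ContinuousOn.comp (t := {p : ℝ × ℝ × ℝ | 0 < p.2.2})
      (f := fun q : (ℝ × ℝ) × ℝ => ((q.1.1, q.1.2, q.2) : ℝ × ℝ × ℝ)) hgt (by fun_prop) ?_)
    intro q hq
    exact lt_of_lt_of_le (half_pos ht) hq.2.1
  obtain ⟨C, hC⟩ := hK.exists_bound_of_continuousOn hcont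
  have hfin : volume (Icc 0 L ×ˢ tsupport η) < ⊤ := (isCompact_Icc.prod hc).measure_lt_top
  have hmeas : MeasurableSet (Icc 0 L ×ˢ tsupport η) := (isCompact_Icc.prod hc).measurableSet
  have hcs : ∀ s, 0 < s → Continuous fun p : ℝ × ℝ => η p.2 * g p.1 p.2 s := fun s hs =>
    (hη.comp continuous_snd).mul (hg.slice hs)
  have hcs' : ∀ s, 0 < s → Continuous fun p : ℝ × ℝ => η p.2 * gt p.1 p.2 s := fun s hs =>
    (hη.comp continuous_snd).mul (hgt.slice hs)
  refine (hasDerivAt_integral_of_dominated_loc_of_deriv_le (bound := fun _ => C)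
    (F := fun s (p : ℝ × ℝ) => η p.2 * g p.1 p.2 s)
    (F' := fun s (p : ℝ × ℝ) => η p.2 * gt p.1 p.2 s)
    (Ioo_mem_nhds (half_lt_self ht) (by linarith : t < 2 * t)) ?_ ?_ ?_ ?_ ?_ ?_).2
  · filter_upwards [lt_mem_nhds ht] with s hs
    exact (hcs s hs).aestronglyMeasurable
  · exact (hcs t ht).continuousOn.integrableOn_compact (isCompact_Icc.prod hc)
  · exact (hcs' t ht).aestronglyMeasurable
  · refine (ae_restrict_iff' hmeas).2 (Eventually.of_forall fun p hp s hs => ?_)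
    exact hC (p, s) ⟨hp, hs.1.le, hs.2.le⟩
  · exact integrableOn_const hfin.ne
  · refine Eventually.of_forall fun p s hs => ?_
    exact (hd p.1 p.2 s ((half_pos ht).trans hs.1)).const_mul _

/-- Fundamental theorem of calculus in time for integrals against a cutoff. -/
theorem cutInt_sub_eq_integral (hη : Continuous η) (hc : HasCompactSupport η) (hg : ContPos g)
    (hgt : ContPos gt) (hd : ∀ x z t, 0 < t → HasDerivAt (fun s => g x z s) (gt x z t) t)
    {a b : ℝ} (ha : 0 < a) (hab : a ≤ b) :
    cutInt L η (fun x z => g x z b) - cutInt L η (fun x z => g x z a)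
      = ∫ t in a..b, cutInt L η (fun x z => gt x z t) := by
  have hsub : uIcc a b ⊆ Ioi 0 := by
    rw [uIcc_of_le hab]; exact fun s hs => ha.trans_le hs.1
  exact (intervalIntegral.integral_eq_sub_of_hasDerivAt
    (fun t ht => hasDerivAt_cutInt hη hc hg hgt hd (hsub ht))
    ((continuousOn_cutInt hη hc hgt).mono hsub).intervalIntegrable).symm

theorem intervalIntegrable_cutInt (hη : Continuous η) (hc : HasCompactSupport η) (hg : ContPos g)
    {a b : ℝ} (ha : 0 < a) (hab : a ≤ b) :
    IntervalIntegrable (fun t => cutInt L η (fun x z => g x z t)) volume a b := by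
  have hsub : uIcc a b ⊆ Ioi 0 := by
    rw [uIcc_of_le hab]; exact fun s hs => ha.trans_le hs.1
  exact ((continuousOn_cutInt hη hc hg).mono hsub).intervalIntegrable

end time

/-- Differentiation of a slice integral with respect to a parameter. -/
theorem hasDerivAt_integral_slice {L : ℝ} (hL : 0 ≤ L) {f f' : ℝ → ℝ → ℝ} {U : Set ℝ}
    (hU : IsOpen U) (hf : ContinuousOn (fun q : ℝ × ℝ => f q.1 q.2) (univ ×ˢ U))
    (hf' : ContinuousOn (fun q : ℝ × ℝ => f' q.1 q.2) (univ ×ˢ U))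
    (hd : ∀ x, ∀ s ∈ U, HasDerivAt (fun s => f x s) (f' x s) s) {s : ℝ} (hs : s ∈ U) :
    HasDerivAt (fun s => ∫ x in (0 : ℝ)..L, f x s) (∫ x in (0 : ℝ)..L, f' x s) s := by
  obtain ⟨ε, hε, hball⟩ := Metric.isOpen_iff.1 hU s hs
  have hIcc : Icc (s - ε / 2) (s + ε / 2) ⊆ U := fun y hy => hball (by
    rw [Metric.mem_ball, Real.dist_eq, abs_lt]; constructor <;> linarith [hy.1, hy.2])
  obtain ⟨C, hC⟩ := (isCompact_Icc.prod isCompact_Icc :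
    IsCompact (Icc 0 L ×ˢ Icc (s - ε / 2) (s + ε / 2))).exists_bound_of_continuousOn
      (hf'.mono (prod_mono (subset_univ _) hIcc))
  have hcs : ∀ k : ℝ → ℝ → ℝ, ContinuousOn (fun q : ℝ × ℝ => k q.1 q.2) (univ ×ˢ U) →
      ∀ y ∈ U, Continuous fun x => k x y := fun k hk y hy =>
    continuousOn_univ.1 (hk.comp (f := fun x : ℝ => ((x, y) : ℝ × ℝ)) (by fun_prop)
      fun x _ => ⟨mem_univ _, hy⟩)
  refine (intervalIntegral.hasDerivAt_integral_of_dominated_loc_of_deriv_le (bound := fun _ => C)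
    (F := fun s x => f x s) (F' := fun s x => f' x s)
    (Icc_mem_nhds (by linarith : s - ε / 2 < s) (by linarith : s < s + ε / 2))
    ?_ ?_ ?_ ?_ ?_ ?_).2
  · filter_upwards [hU.mem_nhds hs] with y hy
    exact (hcs f hf y hy).aestronglyMeasurable
  · exact (hcs f hf s hs).intervalIntegrable _ _
  · exact (hcs f' hf' s hs).aestronglyMeasurable
  · refine Eventually.of_forall fun x hx y hy => ?_
    rw [uIoc_of_le hL] at hx
    exact hC (x, y) ⟨⟨hx.1.le, hx.2⟩, hy⟩
  · exact continuous_const.intervalIntegrable _ _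
  · exact Eventually.of_forall fun x _ y hy => hd x y (hIcc hy)

theorem HasGrad.hasDerivAt_integral {L : ℝ} (hL : 0 ≤ L) {g gx gz : ℝ → ℝ → ℝ}
    (hg : HasGrad L g gx gz) (z : ℝ) :
    HasDerivAt (fun z => ∫ x in (0 : ℝ)..L, g x z) (∫ x in (0 : ℝ)..L, gz x z) z :=
  hasDerivAt_integral_slice hL isOpen_univ hg.cont.continuousOn hg.cont_z.continuousOn
    (fun x s _ => hg.hz x s) (mem_univ z)

/-- By periodicity an `x`-derivative has zero mean on each slice. -/
theorem HasGrad.integral_x_eq_zero {L : ℝ} {g gx gz : ℝ → ℝ → ℝ}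
    (hg : HasGrad L g gx gz) (z : ℝ) : ∫ x in (0 : ℝ)..L, gx x z = 0 := by
  rw [intervalIntegral.integral_eq_sub_of_hasDerivAt (fun x _ => hg.hx x z)
    ((hg.cont_x.comp (by fun_prop : Continuous fun x : ℝ => (x, z))).intervalIntegrable _ _)]
  have := hg.per 0 z
  rw [zero_add] at this
  simp [this]

/-! ### Smooth fields on the space-time strip -/

/-- `g` is of class `C^n` jointly in `(x, z, t)` for `t > 0`. -/
def Sm (n : ℕ) (g : ℝ → ℝ → ℝ → ℝ) : Prop :=
  ContDiffOn ℝ n (fun p : ℝ × ℝ × ℝ => g p.1 p.2.1 p.2.2) {p | 0 < p.2.2}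

/-- `g` is `L`-periodic in `x` for `t > 0`. -/
def Per (L : ℝ) (g : ℝ → ℝ → ℝ → ℝ) : Prop := ∀ x z t, 0 < t → g (x + L) z t = g x z t

theorem isOpen_pos : IsOpen {p : ℝ × ℝ × ℝ | 0 < p.2.2} :=
  isOpen_lt continuous_const (by fun_prop)

namespace Sm
variable {n : ℕ} {g h : ℝ → ℝ → ℝ → ℝ} {x z t : ℝ}

theorem mono {m : ℕ} (hg : Sm n g) (h : m ≤ n) : Sm m g :=
  ContDiffOn.of_le hg (by exact_mod_cast h)

theorem contPos (hg : Sm n g) : ContPos g := hg.continuousOn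

theorem sub (hg : Sm n g) (hh : Sm n h) : Sm n (fun x z t => g x z t - h x z t) :=
  ContDiffOn.sub hg hh

theorem hasFDerivAt (hg : Sm (n + 1) g) (ht : 0 < t) :
    HasFDerivAt (fun p : ℝ × ℝ × ℝ => g p.1 p.2.1 p.2.2)
      (fderiv ℝ (fun p : ℝ × ℝ × ℝ => g p.1 p.2.1 p.2.2) (x, z, t)) (x, z, t) :=
  ((ContDiffOn.contDiffAt hg (isOpen_pos.mem_nhds ht)).differentiableAt (by simp)).hasFDerivAt

theorem hasDerivAt_x' (hg : Sm (n + 1) g) (ht : 0 < t) : HasDerivAt (fun y => g y z t)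
    (fderiv ℝ (fun p : ℝ × ℝ × ℝ => g p.1 p.2.1 p.2.2) (x, z, t) (1, 0, 0)) x :=
  HasFDerivAt.comp_hasDerivAt x (f := fun y => ((y, z, t) : ℝ × ℝ × ℝ)) (hg.hasFDerivAt ht)
    ((hasDerivAt_id x).prodMk (hasDerivAt_const x (z, t)))

theorem hasDerivAt_z' (hg : Sm (n + 1) g) (ht : 0 < t) : HasDerivAt (fun y => g x y t)
    (fderiv ℝ (fun p : ℝ × ℝ × ℝ => g p.1 p.2.1 p.2.2) (x, z, t) (0, 1, 0)) z :=
  HasFDerivAt.comp_hasDerivAt z (f := fun y => ((x, y, t) : ℝ × ℝ × ℝ)) (hg.hasFDerivAt ht)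
    ((hasDerivAt_const z x).prodMk ((hasDerivAt_id z).prodMk (hasDerivAt_const z t)))

theorem hasDerivAt_t' (hg : Sm (n + 1) g) (ht : 0 < t) : HasDerivAt (fun s => g x z s)
    (fderiv ℝ (fun p : ℝ × ℝ × ℝ => g p.1 p.2.1 p.2.2) (x, z, t) (0, 0, 1)) t :=
  HasFDerivAt.comp_hasDerivAt t (f := fun y => ((x, z, y) : ℝ × ℝ × ℝ)) (hg.hasFDerivAt ht)
    ((hasDerivAt_const t x).prodMk ((hasDerivAt_const t z).prodMk (hasDerivAt_id t)))

theorem hasDerivAt_x (hg : Sm (n + 1) g) (ht : 0 < t) :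
    HasDerivAt (fun y => g y z t) (dx g x z t) x :=
  (hg.hasDerivAt_x' ht).differentiableAt.hasDerivAt

theorem hasDerivAt_z (hg : Sm (n + 1) g) (ht : 0 < t) :
    HasDerivAt (fun y => g x y t) (dz g x z t) z :=
  (hg.hasDerivAt_z' ht).differentiableAt.hasDerivAt

theorem hasDerivAt_t (hg : Sm (n + 1) g) (ht : 0 < t) :
    HasDerivAt (fun s => g x z s) (dt g x z t) t :=
  (hg.hasDerivAt_t' ht).differentiableAt.hasDerivAt

theorem fderiv_apply (hg : Sm (n + 1) g) (e : ℝ × ℝ × ℝ) :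
    ContDiffOn ℝ n (fun q => fderiv ℝ (fun p : ℝ × ℝ × ℝ => g p.1 p.2.1 p.2.2) q e)
      {p | 0 < p.2.2} :=
  (ContDiffOn.fderiv_of_isOpen hg isOpen_pos (by push_cast; exact le_rfl)).clm_apply
    contDiffOn_const

theorem dx (hg : Sm (n + 1) g) : Sm n (dx g) :=
  (hg.fderiv_apply (1, 0, 0)).congr fun _ hp => (hg.hasDerivAt_x' hp).deriv

theorem dz (hg : Sm (n + 1) g) : Sm n (dz g) :=
  (hg.fderiv_apply (0, 1, 0)).congr fun _ hp => (hg.hasDerivAt_z' hp).deriv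

theorem dt (hg : Sm (n + 1) g) : Sm n (dt g) :=
  (hg.fderiv_apply (0, 0, 1)).congr fun _ hp => (hg.hasDerivAt_t' hp).deriv

/-- Schwarz's theorem, in terms of directional derivatives. -/
theorem fderiv_fderiv_comm (hg : Sm 2 g) (ht : 0 < t) (e e' : ℝ × ℝ × ℝ) :
    fderiv ℝ (fun q => fderiv ℝ (fun p : ℝ × ℝ × ℝ => g p.1 p.2.1 p.2.2) q e) (x, z, t) e'
      = fderiv ℝ (fun q => fderiv ℝ (fun p : ℝ × ℝ × ℝ => g p.1 p.2.1 p.2.2) q e') (x, z, t) e := by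
  have hc := ContDiffOn.contDiffAt hg (isOpen_pos.mem_nhds (show ((x, z, t) : ℝ × ℝ × ℝ) ∈ _ from ht))
  have hd : DifferentiableAt ℝ (fderiv ℝ (fun p : ℝ × ℝ × ℝ => g p.1 p.2.1 p.2.2)) (x, z, t) :=
    (hc.fderiv_right (m := 1) (by norm_num)).differentiableAt (by simp)
  have hs : IsSymmSndFDerivAt ℝ (fun p : ℝ × ℝ × ℝ => g p.1 p.2.1 p.2.2) (x, z, t) :=
    hc.isSymmSndFDerivAt (by simp)
  have key : ∀ v : ℝ × ℝ × ℝ,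
      fderiv ℝ (fun q => fderiv ℝ (fun p : ℝ × ℝ × ℝ => g p.1 p.2.1 p.2.2) q v) (x, z, t)
        = (fderiv ℝ (fderiv ℝ (fun p : ℝ × ℝ × ℝ => g p.1 p.2.1 p.2.2)) (x, z, t)).flip v := by
    intro v
    have := hd.hasFDerivAt.clm_apply (hasFDerivAt_const v ((x, z, t) : ℝ × ℝ × ℝ))
    rw [this.fderiv]; simp
  rw [key, key]
  exact hs.eq e' e

theorem _root_.ReactiveBoussinesq.fderiv_congr_pos {g : ℝ → ℝ → ℝ → ℝ} {x z t : ℝ}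
    (ht : 0 < t) (G : ℝ × ℝ × ℝ → ℝ)
    (hG : ∀ x z t, 0 < t → g x z t = G (x, z, t)) :
    fderiv ℝ (fun p : ℝ × ℝ × ℝ => g p.1 p.2.1 p.2.2) (x, z, t) = fderiv ℝ G (x, z, t) := by
  refine Filter.EventuallyEq.fderiv_eq ?_
  filter_upwards [isOpen_pos.mem_nhds (show ((x, z, t) : ℝ × ℝ × ℝ) ∈ {p : ℝ × ℝ × ℝ | 0 < p.2.2} from ht)] with p hp
  exact hG _ _ _ hp

theorem dx_dz_comm (hg : Sm 2 g) (ht : 0 < t) :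
    ReactiveBoussinesq.dx (ReactiveBoussinesq.dz g) x z t
      = ReactiveBoussinesq.dz (ReactiveBoussinesq.dx g) x z t := by
  rw [(hg.dz.hasDerivAt_x (n := 0) ht).unique (hg.dz.hasDerivAt_x' ht),
    (hg.dx.hasDerivAt_z (n := 0) ht).unique (hg.dx.hasDerivAt_z' ht),
    fderiv_congr_pos (g := ReactiveBoussinesq.dz g) ht
      (fun q => fderiv ℝ (fun p : ℝ × ℝ × ℝ => g p.1 p.2.1 p.2.2) q (0, 1, 0))
      fun x z t ht => (hg.hasDerivAt_z' ht).deriv,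
    fderiv_congr_pos (g := ReactiveBoussinesq.dx g) ht
      (fun q => fderiv ℝ (fun p : ℝ × ℝ × ℝ => g p.1 p.2.1 p.2.2) q (1, 0, 0))
      fun x z t ht => (hg.hasDerivAt_x' ht).deriv]
  exact hg.fderiv_fderiv_comm ht _ _

theorem dx_dt_comm (hg : Sm 2 g) (ht : 0 < t) :
    ReactiveBoussinesq.dx (ReactiveBoussinesq.dt g) x z t
      = ReactiveBoussinesq.dt (ReactiveBoussinesq.dx g) x z t := by
  rw [(hg.dt.hasDerivAt_x (n := 0) ht).unique (hg.dt.hasDerivAt_x' ht),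
    (hg.dx.hasDerivAt_t (n := 0) ht).unique (hg.dx.hasDerivAt_t' ht),
    fderiv_congr_pos (g := ReactiveBoussinesq.dt g) ht
      (fun q => fderiv ℝ (fun p : ℝ × ℝ × ℝ => g p.1 p.2.1 p.2.2) q (0, 0, 1))
      fun x z t ht => (hg.hasDerivAt_t' ht).deriv,
    fderiv_congr_pos (g := ReactiveBoussinesq.dx g) ht
      (fun q => fderiv ℝ (fun p : ℝ × ℝ × ℝ => g p.1 p.2.1 p.2.2) q (1, 0, 0))
      fun x z t ht => (hg.hasDerivAt_x' ht).deriv]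
  exact hg.fderiv_fderiv_comm ht _ _

theorem dz_dt_comm (hg : Sm 2 g) (ht : 0 < t) :
    ReactiveBoussinesq.dz (ReactiveBoussinesq.dt g) x z t
      = ReactiveBoussinesq.dt (ReactiveBoussinesq.dz g) x z t := by
  rw [(hg.dt.hasDerivAt_z (n := 0) ht).unique (hg.dt.hasDerivAt_z' ht),
    (hg.dz.hasDerivAt_t (n := 0) ht).unique (hg.dz.hasDerivAt_t' ht),
    fderiv_congr_pos (g := ReactiveBoussinesq.dt g) ht
      (fun q => fderiv ℝ (fun p : ℝ × ℝ × ℝ => g p.1 p.2.1 p.2.2) q (0, 0, 1))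
      fun x z t ht => (hg.hasDerivAt_t' ht).deriv,
    fderiv_congr_pos (g := ReactiveBoussinesq.dz g) ht
      (fun q => fderiv ℝ (fun p : ℝ × ℝ × ℝ => g p.1 p.2.1 p.2.2) q (0, 1, 0))
      fun x z t ht => (hg.hasDerivAt_z' ht).deriv]
  exact hg.fderiv_fderiv_comm ht _ _

theorem hasGrad {L : ℝ} (hg : Sm (n + 1) g) (hp : Per L g) (ht : 0 < t) :
    HasGrad L (fun x z => g x z t) (fun x z => ReactiveBoussinesq.dx g x z t)
      (fun x z => ReactiveBoussinesq.dz g x z t) where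
  cont := hg.contPos.slice ht
  cont_x := hg.dx.contPos.slice ht
  cont_z := hg.dz.contPos.slice ht
  hx _ _ := hg.hasDerivAt_x ht
  hz _ _ := hg.hasDerivAt_z ht
  per x z := hp x z t ht

end Sm

namespace Per
variable {L : ℝ} {g : ℝ → ℝ → ℝ → ℝ}

theorem dx (hg : Per L g) : Per L (dx g) := fun x z t ht => by
  simp only [ReactiveBoussinesq.dx]
  rw [← deriv_comp_add_const]
  simp only [hg _ _ _ ht]

theorem dz (hg : Per L g) : Per L (dz g) := fun x z t ht => by
  simp only [ReactiveBoussinesq.dz, hg _ _ _ ht]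

theorem dt (hg : Per L g) : Per L (dt g) := fun x z t ht => by
  simp only [ReactiveBoussinesq.dt]
  refine Filter.EventuallyEq.deriv_eq ?_
  filter_upwards [lt_mem_nhds ht] with s hs using hg _ _ _ hs

theorem sub {h : ℝ → ℝ → ℝ → ℝ} (hg : Per L g) (hh : Per L h) :
    Per L (fun x z t => g x z t - h x z t) := fun x z t ht => by
  simp only [hg _ _ _ ht, hh _ _ _ ht]

end Per

/-! ### Pointwise consequences of the equations -/

namespace IsSolution
variable {f : ℝ → ℝ} {σ ρ L : ℝ} {u w T : ℝ → ℝ → ℝ → ℝ}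

theorem sm_u (h : IsSolution f σ ρ L u w T) : Sm 3 u := h.regular_u.2
theorem sm_w (h : IsSolution f σ ρ L u w T) : Sm 3 w := h.regular_w.2
theorem sm_T (h : IsSolution f σ ρ L u w T) : Sm 3 T := h.regular_T.2
theorem per_u (h : IsSolution f σ ρ L u w T) : Per L u := fun x z t ht => h.periodic_u x z t ht.le
theorem per_w (h : IsSolution f σ ρ L u w T) : Per L w := fun x z t ht => h.periodic_w x z t ht.le
theorem per_T (h : IsSolution f σ ρ L u w T) : Per L T := fun x z t ht => h.periodic_T x z t ht.le

theorem sm_vort (h : IsSolution f σ ρ L u w T) : Sm 2 (vort u w) := h.sm_w.dx.sub h.sm_u.dz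
theorem per_vort (h : IsSolution f σ ρ L u w T) : Per L (vort u w) := h.per_w.dx.sub h.per_u.dz

variable {x z t : ℝ}

theorem dx_u (h : IsSolution f σ ρ L u w T) (ht : 0 < t) : dx u x z t = -dz w x z t := by
  linarith [h.div_free x z t ht]

theorem dx_dx_u (h : IsSolution f σ ρ L u w T) (ht : 0 < t) :
    dx (dx u) x z t = -dz (dx w) x z t := by
  rw [← (h.sm_w.mono (by norm_num)).dx_dz_comm ht]
  have e : (fun y => dx u y z t) = fun y => -dz w y z t := funext fun y => h.dx_u ht
  exact (congrArg (fun k => deriv k x) e).trans deriv.fun_neg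

theorem dz_dx_u (h : IsSolution f σ ρ L u w T) (ht : 0 < t) :
    dz (dx u) x z t = -dz (dz w) x z t := by
  have e : (fun y => dx u x y t) = fun y => -dz w x y t := funext fun y => h.dx_u ht
  exact (congrArg (fun k => deriv k z) e).trans deriv.fun_neg

/-- Taking the divergence-free condition into account, `ω_x = Δ w`. -/
theorem dx_vort (h : IsSolution f σ ρ L u w T) (ht : 0 < t) :
    dx (vort u w) x z t = dx (dx w) x z t + dz (dz w) x z t := by
  have e := (h.sm_w.dx.hasDerivAt_x (x := x) (z := z) ht).sub (h.sm_u.dz.hasDerivAt_x (x := x) (z := z) ht)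
  have e' : dx (vort u w) x z t = dx (dx w) x z t - dx (dz u) x z t := e.deriv
  rw [e', (h.sm_u.mono (by norm_num)).dx_dz_comm ht, h.dz_dx_u ht]; ring

theorem dt_T (h : IsSolution f σ ρ L u w T) (ht : 0 < t) :
    dt T x z t = dx (dx T) x z t + dz (dz T) x z t - u x z t * dx T x z t
      - w x z t * dz T x z t + f (T x z t) := by
  have := h.temperature_eq x z t ht
  rw [lap] at this; linarith

theorem dt_vort (h : IsSolution f σ ρ L u w T) (ht : 0 < t) :
    dt (vort u w) x z t = σ * (dx (dx (vort u w)) x z t + dz (dz (vort u w)) x z t)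
      - u x z t * dx (vort u w) x z t - w x z t * dz (vort u w) x z t
      + σ * ρ * dx T x z t := by
  have := h.vorticity_eq x z t ht
  rw [lap] at this; linarith

theorem dx_dz_T (h : IsSolution f σ ρ L u w T) (ht : 0 < t) :
    dx (dz T) x z t = dz (dx T) x z t := (h.sm_T.mono (by norm_num)).dx_dz_comm ht

/-- The equation for `T_x`. -/
theorem dt_dx_T (h : IsSolution f σ ρ L u w T) (hf : Differentiable ℝ f) (ht : 0 < t) :
    dt (dx T) x z t = dx (dx (dx T)) x z t + dz (dz (dx T)) x z t - u x z t * dx (dx T) x z t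
      - w x z t * dz (dx T) x z t - (dx u x z t * dx T x z t + dx w x z t * dz T x z t)
      + deriv f (T x z t) * dx T x z t := by
  rw [← (h.sm_T.mono (by norm_num)).dx_dt_comm ht]
  have e1 : dx (dz (dz T)) x z t = dz (dz (dx T)) x z t := by
    rw [h.sm_T.dz.dx_dz_comm ht]
    exact congrArg (fun k => deriv k z) (funext fun y => h.dx_dz_T ht)
  have e2 := (((((h.sm_T.dx.dx.hasDerivAt_x (x := x) (z := z) ht).add
    (h.sm_T.dz.dz.hasDerivAt_x (x := x) (z := z) ht)).sub
    ((h.sm_u.hasDerivAt_x (x := x) (z := z) ht).mul (h.sm_T.dx.hasDerivAt_x (x := x) (z := z) ht))).sub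
    ((h.sm_w.hasDerivAt_x (x := x) (z := z) ht).mul (h.sm_T.dz.hasDerivAt_x (x := x) (z := z) ht))).add
    ((hf (T x z t)).hasDerivAt.comp x (h.sm_T.hasDerivAt_x (x := x) (z := z) ht)))
  have e3 : (fun y => dt T y z t) = fun y => dx (dx T) y z t + dz (dz T) y z t
      - u y z t * dx T y z t - w y z t * dz T y z t + f (T y z t) := funext fun y => h.dt_T ht
  have e4 : dx (dt T) x z t = _ := (congrArg (fun k => deriv k x) e3).trans e2.deriv
  rw [e4, e1, h.dx_dz_T ht]; ring

end IsSolution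

/-! ### Vertical cutoffs -/

/-- A smooth bump function on the line, equal to `1` on `[-1, 1]` and supported in `[-2, 2]`. -/
def bump : ContDiffBump (0 : ℝ) := ⟨1, 2, one_pos, one_lt_two⟩

/-- The cutoff at height `n + 1`. -/
def cut (n : ℕ) (z : ℝ) : ℝ := bump (z / (n + 1))

/-- The first derivative of `cut n`. -/
def cut₁ (n : ℕ) (z : ℝ) : ℝ := deriv bump (z / (n + 1)) / (n + 1)

/-- The second derivative of `cut n`. -/
def cut₂ (n : ℕ) (z : ℝ) : ℝ := deriv (deriv bump) (z / (n + 1)) / (n + 1) / (n + 1)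

theorem contDiff_bump {m : ℕ∞} : ContDiff ℝ m bump := bump.contDiff

theorem contDiff_deriv_bump : ContDiff ℝ 1 (deriv bump) :=
  ((contDiff_succ_iff_deriv (n := 1)).1 (contDiff_bump (m := 2))).2.2

theorem isCutoff_cut (n : ℕ) : IsCutoff (cut n) (cut₁ n) (cut₂ n) where
  deriv₁ z := by
    have h : DifferentiableAt ℝ bump (z / (n + 1)) :=
      (contDiff_bump (m := 1)).differentiable (by simp) _
    exact (h.hasDerivAt.comp z ((hasDerivAt_id z).div_const _)).congr_deriv (by
      simp [cut₁, div_eq_mul_inv])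
  deriv₂ z := by
    have h : DifferentiableAt ℝ (deriv bump) (z / (n + 1)) :=
      contDiff_deriv_bump.differentiable (by simp) _
    exact ((h.hasDerivAt.comp z ((hasDerivAt_id z).div_const ((n : ℝ) + 1))).div_const
      ((n : ℝ) + 1)).congr_deriv (by simp [cut₂, div_eq_mul_inv])
  cont₂ := by
    have h := contDiff_deriv_bump.continuous_deriv (by simp)
    exact ((h.comp (continuous_id.div_const _)).div_const _).div_const _
  supp := by
    have h : (0 : ℝ) < n + 1 := by positivity
    have e : cut n = bump ∘ Homeomorph.mulRight₀ ((n : ℝ) + 1)⁻¹ (inv_ne_zero h.ne') := by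
      ext z; simp [cut, div_eq_mul_inv]
    rw [e]
    exact bump.hasCompactSupport.comp_homeomorph _

theorem cut_nonneg (n : ℕ) (z : ℝ) : 0 ≤ cut n z := bump.nonneg

theorem cut_le_one (n : ℕ) (z : ℝ) : cut n z ≤ 1 := bump.le_one

theorem tendsto_cut (z : ℝ) : Tendsto (fun n => cut n z) atTop (𝓝 1) := by
  refine tendsto_const_nhds.congr' ?_
  filter_upwards [eventually_ge_atTop ⌈|z|⌉₊] with n hn
  refine (bump.one_of_mem_closedBall ?_).symm
  have h : (0 : ℝ) < n + 1 := by positivity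
  rw [mem_closedBall_zero_iff, Real.norm_eq_abs, abs_div, abs_of_pos h, div_le_iff₀ h]
  have := Nat.ceil_le.1 hn
  change |z| ≤ 1 * ((n : ℝ) + 1)
  linarith

/-- Uniform bounds on the derivatives of the cutoffs. -/
theorem exists_cut_bound : ∃ C : ℝ, 0 ≤ C ∧ ∀ n : ℕ,
    (∀ z, |cut₁ n z| ≤ C / (n + 1)) ∧ (∀ z, |cut₂ n z| ≤ C / (n + 1)) ∧
    ∫ z, |cut₂ n z| ≤ C / (n + 1) := by
  have c0 := (contDiff_bump (m := 1)).continuous_deriv (by simp)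
  have c1 := contDiff_deriv_bump.continuous_deriv (by simp)
  have s0 := bump.hasCompactSupport.deriv
  have s1 := s0.deriv
  obtain ⟨C₁, h1⟩ := s0.exists_bound_of_continuous c0
  obtain ⟨C₂, h2⟩ := s1.exists_bound_of_continuous c1
  set I := ∫ y, |deriv (deriv bump) y| with hI
  have hI0 : 0 ≤ I := integral_nonneg fun _ => abs_nonneg _
  have p1 : 0 ≤ C₁ := (norm_nonneg _).trans (h1 0)
  have p2 : 0 ≤ C₂ := (norm_nonneg _).trans (h2 0)
  refine ⟨C₁ + C₂ + I, by positivity, fun n => ?_⟩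
  have hn : (0 : ℝ) < n + 1 := by positivity
  have hn1 : (1 : ℝ) ≤ n + 1 := by linarith [(Nat.cast_nonneg n : (0 : ℝ) ≤ n)]
  have e1 : ∀ z, |cut₁ n z| = |deriv bump (z / (n + 1))| / (n + 1) := fun z => by
    rw [cut₁, abs_div, abs_of_pos hn]
  have e2 : ∀ z, |cut₂ n z| = |deriv (deriv bump) (z / (n + 1))| / (n + 1) / (n + 1) := fun z => by
    rw [cut₂, abs_div, abs_div, abs_of_pos hn]
  refine ⟨fun z => ?_, fun z => ?_, ?_⟩
  · rw [e1]
    gcongr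
    have := h1 (z / (n + 1)); rw [Real.norm_eq_abs] at this; linarith
  · rw [e2]
    refine (div_le_self (by positivity) hn1).trans ?_
    gcongr
    have := h2 (z / (n + 1)); rw [Real.norm_eq_abs] at this; linarith
  · have : ∫ z, |cut₂ n z| = I / (n + 1) := by
      simp only [e2]
      rw [integral_div, integral_div,
        Measure.integral_comp_div (fun y => |deriv (deriv bump) y|) ((n : ℝ) + 1), ← hI,
        abs_of_pos hn, smul_eq_mul]
      field_simp
    rw [this]
    gcongr
    linarith

theorem tendsto_div_nat (C : ℝ) : Tendsto (fun n : ℕ => C / ((n : ℝ) + 1)) atTop (𝓝 0) := by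
  have := (tendsto_one_div_add_atTop_nhds_zero_nat (𝕜 := ℝ)).const_mul C
  simpa [div_eq_mul_inv] using this

/-! ### Removing the cutoffs -/

theorem abs_cutInt_le {L c : ℝ} {η : ℝ → ℝ} {F : ℝ → ℝ → ℝ} (hη : ∀ z, |η z| ≤ c)
    (hF : Integrable (fun p : ℝ × ℝ => F p.1 p.2) (cell L)) :
    |cutInt L η F| ≤ c * ∫ p : ℝ × ℝ, |F p.1 p.2| ∂(cell L) := by
  rw [cutInt, ← integral_const_mul]
  refine (abs_integral_le_integral_abs).trans (integral_mono_of_nonneg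
    (Eventually.of_forall fun _ => abs_nonneg _) (hF.abs.const_mul c)
    (Eventually.of_forall fun p => ?_))
  simp only [abs_mul]
  exact mul_le_mul_of_nonneg_right (hη p.2) (abs_nonneg _)

theorem tendsto_cutInt {L : ℝ} {F : ℝ → ℝ → ℝ}
    (hF : Integrable (fun p : ℝ × ℝ => F p.1 p.2) (cell L)) :
    Tendsto (fun n => cutInt L (cut n) F) atTop (𝓝 (∫ p : ℝ × ℝ, F p.1 p.2 ∂(cell L))) := by
  refine tendsto_integral_of_dominated_convergence (fun p => |F p.1 p.2|) (fun n => ?_) hF.abs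
    (fun n => Eventually.of_forall fun p => ?_) (Eventually.of_forall fun p => ?_)
  · exact ((isCutoff_cut n).cont.comp continuous_snd).aestronglyMeasurable.mul
      hF.aestronglyMeasurable
  · rw [norm_mul, Real.norm_eq_abs, Real.norm_eq_abs, abs_of_nonneg (cut_nonneg n p.2)]
    exact mul_le_of_le_one_left (abs_nonneg _) (cut_le_one n p.2)
  · simpa using (tendsto_cut p.2).mul_const (F p.1 p.2)

theorem integral_sq_of_memLp {L : ℝ} {g : ℝ → ℝ → ℝ → ℝ} {t : ℝ}
    (hc : Continuous fun p : ℝ × ℝ => g p.1 p.2 t) (h : normL2 L g t ≠ ⊤) :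
    Integrable (fun p : ℝ × ℝ => g p.1 p.2 t ^ 2) (cell L) ∧
      normL2 L g t = ENNReal.ofReal (√(∫ p : ℝ × ℝ, g p.1 p.2 t ^ 2 ∂(cell L))) := by
  have hm : MemLp (fun p : ℝ × ℝ => g p.1 p.2 t) 2 (cell L) :=
    ⟨hc.aestronglyMeasurable, lt_top_iff_ne_top.2 h⟩
  refine ⟨hm.integrable_sq, ?_⟩
  rw [normL2, hm.eLpNorm_eq_integral_rpow_norm (by norm_num) (by norm_num), Real.sqrt_eq_rpow]
  simp

theorem LocBddL2.exists_bound {L : ℝ} {g : ℝ → ℝ → ℝ → ℝ} (h : LocBddL2 L g) (hg : ContPos g)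
    {a b : ℝ} (ha : 0 < a) : ∃ K : ℝ, 0 ≤ K ∧ ∀ t ∈ Icc a b,
      Integrable (fun p : ℝ × ℝ => g p.1 p.2 t ^ 2) (cell L) ∧
        ∫ p : ℝ × ℝ, g p.1 p.2 t ^ 2 ∂(cell L) ≤ K := by
  obtain ⟨K, hK⟩ := h a b ha
  refine ⟨K ^ 2, sq_nonneg _, fun t ht => ?_⟩
  obtain ⟨h1, h2⟩ := integral_sq_of_memLp (hg.slice (ha.trans_le ht.1))
    (ne_top_of_le_ne_top ENNReal.ofReal_ne_top (hK t ht))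
  refine ⟨h1, ?_⟩
  have h3 := hK t ht
  rw [h2] at h3
  have h0 : 0 ≤ ∫ p : ℝ × ℝ, g p.1 p.2 t ^ 2 ∂(cell L) := integral_nonneg fun _ => sq_nonneg _
  rcases le_or_gt 0 K with hK0 | hK0
  · exact (Real.sqrt_le_left hK0).1 ((ENNReal.ofReal_le_ofReal_iff hK0).1 h3)
  · rw [ENNReal.ofReal_of_nonpos hK0.le, nonpos_iff_eq_zero, ENNReal.ofReal_eq_zero] at h3
    have := (Real.sqrt_eq_zero h0).1 (le_antisymm h3 (Real.sqrt_nonneg _))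
    rw [this]; positivity

section fatou
variable {L : ℝ} {Q : ℝ → ℝ → ℝ → ℝ}

theorem ofReal_cutInt {η : ℝ → ℝ} (hη : Continuous η) (hc : HasCompactSupport η)
    (h0 : ∀ z, 0 ≤ η z) {F : ℝ → ℝ → ℝ} (hF : Continuous fun q : ℝ × ℝ => F q.1 q.2)
    (hF0 : ∀ x z, 0 ≤ F x z) :
    ENNReal.ofReal (cutInt L η F) = ∫⁻ p : ℝ × ℝ, ENNReal.ofReal (η p.2 * F p.1 p.2) ∂(cell L) :=
  ofReal_integral_eq_lintegral_ofReal (integrable_cutoff hη hc L hF)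
    (Eventually.of_forall fun p => mul_nonneg (h0 p.2) (hF0 p.1 p.2))

theorem ofReal_integral_cutInt {η : ℝ → ℝ} (hη : Continuous η) (hc : HasCompactSupport η)
    (h0 : ∀ z, 0 ≤ η z) (hQ : ContPos Q) (hQ0 : ∀ x z t, 0 < t → 0 ≤ Q x z t)
    {a b : ℝ} (ha : 0 < a) (hab : a ≤ b) :
    ENNReal.ofReal (∫ t in a..b, cutInt L η (fun x z => Q x z t))
      = ∫⁻ t in Ioc a b, ∫⁻ p : ℝ × ℝ, ENNReal.ofReal (η p.2 * Q p.1 p.2 t) ∂(cell L) := by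
  have hpos : ∀ t ∈ Ioc a b, 0 < t := fun t ht => ha.trans ht.1
  rw [intervalIntegral.integral_of_le hab, ofReal_integral_eq_lintegral_ofReal
    ((intervalIntegrable_iff_integrableOn_Ioc_of_le hab).1
      (intervalIntegrable_cutInt hη hc hQ ha hab))]
  · refine setLIntegral_congr_fun measurableSet_Ioc fun t ht => ?_
    exact ofReal_cutInt hη hc h0 (hQ.slice (hpos t ht)) fun x z => hQ0 x z t (hpos t ht)
  · exact (ae_restrict_iff' measurableSet_Ioc).2 (Eventually.of_forall fun t ht =>
      cutInt_nonneg h0 fun x z => hQ0 x z t (hpos t ht))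

/-- Fatou's lemma for a sequence of weights converging pointwise to one. -/
theorem lintegral_le_of_cutInt_le {η : ℕ → ℝ → ℝ} (hη : ∀ n, Continuous (η n))
    (hc : ∀ n, HasCompactSupport (η n)) (h0 : ∀ n z, 0 ≤ η n z)
    (hlim : ∀ z, Tendsto (fun n => η n z) atTop (𝓝 1)) (hQ : ContPos Q)
    (hQ0 : ∀ x z t, 0 < t → 0 ≤ Q x z t) {a b : ℝ} (ha : 0 < a) (hab : a ≤ b) {K : ℝ}
    {e : ℕ → ℝ} (he : Tendsto e atTop (𝓝 0))
    (h : ∀ n, ∫ t in a..b, cutInt L (η n) (fun x z => Q x z t) ≤ K + e n) :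
    ∫⁻ t in Ioc a b, ∫⁻ p : ℝ × ℝ, ENNReal.ofReal (Q p.1 p.2 t) ∂(cell L) ≤ ENNReal.ofReal K := by
  have hpos : ∀ t ∈ Ioc a b, 0 < t := fun t ht => ha.trans ht.1
  calc ∫⁻ t in Ioc a b, ∫⁻ p : ℝ × ℝ, ENNReal.ofReal (Q p.1 p.2 t) ∂(cell L)
      ≤ ∫⁻ t in Ioc a b, liminf (fun n => ∫⁻ p : ℝ × ℝ,
          ENNReal.ofReal (η n p.2 * Q p.1 p.2 t) ∂(cell L)) atTop := by
        refine setLIntegral_mono' measurableSet_Ioc fun t ht => ?_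
        refine le_trans (lintegral_mono fun p => ?_) (lintegral_liminf_le' fun n => ?_)
        · refine le_of_eq (Tendsto.liminf_eq ?_).symm
          refine (ENNReal.continuous_ofReal.tendsto _).comp ?_
          simpa using (hlim p.2).mul_const (Q p.1 p.2 t)
        · exact (((hη n).comp continuous_snd).mul (hQ.slice (hpos t ht))).measurable.ennreal_ofReal.aemeasurable
    _ ≤ liminf (fun n => ∫⁻ t in Ioc a b, ∫⁻ p : ℝ × ℝ,
          ENNReal.ofReal (η n p.2 * Q p.1 p.2 t) ∂(cell L)) atTop := by
        refine lintegral_liminf_le' fun n => ?_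
        have h1 : AEMeasurable (fun t => ENNReal.ofReal (cutInt L (η n) (fun x z => Q x z t)))
            (volume.restrict (Ioc a b)) :=
          ((continuousOn_cutInt (hη n) (hc n) hQ).mono fun t ht =>
            hpos t ht).aemeasurable measurableSet_Ioc |>.ennreal_ofReal
        refine h1.congr ((ae_restrict_iff' measurableSet_Ioc).2 (Eventually.of_forall fun t ht => ?_))
        exact ofReal_cutInt (hη n) (hc n) (h0 n) (hQ.slice (hpos t ht))
          fun x z => hQ0 x z t (hpos t ht)
    _ ≤ liminf (fun n => ENNReal.ofReal (K + e n)) atTop := by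
        refine liminf_le_liminf (Eventually.of_forall fun n => ?_)
        rw [← ofReal_integral_cutInt (hη n) (hc n) (h0 n) hQ hQ0 ha hab]
        exact ENNReal.ofReal_le_ofReal (h n)
    _ = ENNReal.ofReal K := by
        refine Tendsto.liminf_eq ((ENNReal.continuous_ofReal.tendsto _).comp ?_)
        simpa using he.const_add K

theorem cutInt_le_of_lintegral_le {η : ℝ → ℝ} (hη : Continuous η) (hc : HasCompactSupport η)
    (h0 : ∀ z, 0 ≤ η z) (h1 : ∀ z, η z ≤ 1) (hQ : ContPos Q)
    (hQ0 : ∀ x z t, 0 < t → 0 ≤ Q x z t) {a b : ℝ} (ha : 0 < a) (hab : a ≤ b) {K : ℝ}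
    (hK : 0 ≤ K) (h : ∫⁻ t in Ioc a b, ∫⁻ p : ℝ × ℝ, ENNReal.ofReal (Q p.1 p.2 t) ∂(cell L)
      ≤ ENNReal.ofReal K) :
    ∫ t in a..b, cutInt L η (fun x z => Q x z t) ≤ K := by
  rw [← ENNReal.ofReal_le_ofReal_iff hK, ofReal_integral_cutInt hη hc h0 hQ hQ0 ha hab]
  refine le_trans (setLIntegral_mono' measurableSet_Ioc fun t ht => lintegral_mono fun p => ?_) h
  exact ENNReal.ofReal_le_ofReal (mul_le_of_le_one_left (hQ0 _ _ _ (ha.trans ht.1)) (h1 p.2))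

/-- A cutoff bound with a vanishing error holds without the error. -/
theorem integral_cutInt_le_of_error (hQ : ContPos Q) (hQ0 : ∀ x z t, 0 < t → 0 ≤ Q x z t)
    {a b : ℝ} (ha : 0 < a) (hab : a ≤ b) {K : ℝ} {e : ℕ → ℝ} (he : Tendsto e atTop (𝓝 0))
    (h : ∀ n, ∫ t in a..b, cutInt L (cut n) (fun x z => Q x z t) ≤ K + e n) (n : ℕ) :
    ∫ t in a..b, cutInt L (cut n) (fun x z => Q x z t) ≤ K := by
  have hK : 0 ≤ K := by
    refine ge_of_tendsto (f := fun n => K + e n) (x := atTop)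
      (by simpa using he.const_add K : Tendsto (fun n => K + e n) atTop (𝓝 K)) (Eventually.of_forall fun n => le_trans ?_ (h n))
    exact intervalIntegral.integral_nonneg hab fun t ht => cutInt_nonneg (cut_nonneg n)
      fun x z => hQ0 x z t (ha.trans_le ht.1)
  exact cutInt_le_of_lintegral_le (isCutoff_cut n).cont (isCutoff_cut n).supp (cut_nonneg n)
    (cut_le_one n) hQ hQ0 ha hab hK (lintegral_le_of_cutInt_le (fun n => (isCutoff_cut n).cont)
      (fun n => (isCutoff_cut n).supp) cut_nonneg tendsto_cut hQ hQ0 ha hab he h)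

/-- Measurability in time is obtained after freezing the field before the time `a`. -/
theorem aemeasurable_lintegral_cell (hQ : ContPos Q) {a b : ℝ} (ha : 0 < a) :
    AEMeasurable (fun t => ∫⁻ p : ℝ × ℝ, ENNReal.ofReal (Q p.1 p.2 t) ∂(cell L))
      (volume.restrict (Ioc a b)) := by
  have h1 : Measurable fun t => ∫⁻ p : ℝ × ℝ, ENNReal.ofReal (Q p.1 p.2 (max t a)) ∂(cell L) :=
    Measurable.lintegral_prod_right' (f := fun q : ℝ × ℝ × ℝ =>
      ENNReal.ofReal (Q q.2.1 q.2.2 (max q.1 a))) (hQ.shift ha).measurable.ennreal_ofReal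
  refine h1.aemeasurable.congr ((ae_restrict_iff' measurableSet_Ioc).2
    (Eventually.of_forall fun t ht => ?_))
  simp only [max_eq_left ht.1.le]

end fatou

/-! ### Uniform bounds and the maximum principle -/

theorem exists_period_rep {L : ℝ} (hL : 0 < L) {g : ℝ → ℝ → ℝ → ℝ} (hg : PeriodicX L g)
    (x z t : ℝ) (ht : 0 ≤ t) : ∃ y ∈ Icc 0 L, g x z t = g y z t := by
  have hp : Function.Periodic (fun x => g x z t) L := fun x => hg x z t ht
  obtain ⟨y, hy, h⟩ := hp.exists_mem_Ico₀ hL x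
  exact ⟨y, ⟨hy.1, hy.2.le⟩, h⟩

theorem LimitsTo.exists_far {g : ℝ → ℝ → ℝ → ℝ} {c : ℝ} {l : Filter ℝ} (h : LimitsTo g l c)
    (τ : ℝ) {δ : ℝ} (hδ : 0 < δ) : ∀ᶠ z in l, ∀ x, ∀ t ∈ Icc 0 τ, |g x z t - c| < δ := by
  filter_upwards [Metric.tendstoUniformlyOn_iff.1 (h τ) δ hδ] with z hz x t ht
  have := hz (x, t) ⟨mem_univ _, ht⟩
  rwa [dist_comm, Real.dist_eq] at this

/-- A field with limits at both ends is bounded on bounded time intervals, by compactness of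
`[0, L] × [-N, N] × [0, τ]`. -/
theorem exists_bound_of_limits {L : ℝ} (hL : 0 < L) {g : ℝ → ℝ → ℝ → ℝ} (hg : Regular g)
    (hp : PeriodicX L g) {c c' : ℝ} (hb : LimitsTo g atBot c) (ht : LimitsTo g atTop c') (τ : ℝ) :
    ∃ B : ℝ, 0 ≤ B ∧ ∀ x z, ∀ t ∈ Icc 0 τ, |g x z t| ≤ B := by
  obtain ⟨N₁, h1⟩ := eventually_atBot.1 (hb.exists_far τ one_pos)
  obtain ⟨N₂, h2⟩ := eventually_atTop.1 (ht.exists_far τ one_pos)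
  have hK : IsCompact (Icc 0 L ×ˢ Icc N₁ N₂ ×ˢ Icc 0 τ) :=
    isCompact_Icc.prod (isCompact_Icc.prod isCompact_Icc)
  obtain ⟨C, hC⟩ := hK.exists_bound_of_continuousOn (hg.1.mono fun p hp => hp.2.2.1)
  refine ⟨max C 0 + |c| + |c'| + 1, by positivity, fun x z t ht => ?_⟩
  have hC0 := le_max_left C 0
  have hC1 := le_max_right C 0
  rcases le_or_gt z N₁ with hz | hz
  · have := h1 z hz x t ht
    have h3 : |g x z t| ≤ |g x z t - c| + |c| := by
      simpa using abs_add_le (g x z t - c) c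
    linarith [abs_nonneg c']
  rcases le_or_gt N₂ z with hz' | hz'
  · have := h2 z hz' x t ht
    have h3 : |g x z t| ≤ |g x z t - c'| + |c'| := by
      simpa using abs_add_le (g x z t - c') c'
    linarith [abs_nonneg c]
  · obtain ⟨y, hy, e⟩ := exists_period_rep hL hp x z t ht.1
    have := hC (y, z, t) ⟨hy, ⟨hz.le, hz'.le⟩, ht⟩
    rw [Real.norm_eq_abs] at this
    rw [e]
    simp only at this
    linarith [abs_nonneg c, abs_nonneg c']

theorem limitsTo_cocompact {g : ℝ → ℝ → ℝ → ℝ} {c : ℝ} (h : LimitsTo g (cocompact ℝ) c) :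
    LimitsTo g atBot c ∧ LimitsTo g atTop c := by
  constructor <;> intro τ v hv
  · exact (h τ v hv).filter_mono atBot_le_cocompact
  · exact (h τ v hv).filter_mono atTop_le_cocompact

theorem nonneg_of_hasDerivAt_of_max_left {G : ℝ → ℝ} {d t : ℝ} (ht : 0 < t) (h : HasDerivAt G d t)
    (hmax : ∀ s ∈ Icc 0 t, G s ≤ G t) : 0 ≤ d := by
  have h1 : Tendsto (slope G t) (𝓝[<] t) (𝓝 d) :=
    (hasDerivWithinAt_iff_tendsto_slope' (by simp : t ∉ Iio t)).1 h.hasDerivWithinAt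
  refine ge_of_tendsto h1 ?_
  have h0 : Ioo 0 t ∈ 𝓝[<] t := Ioo_mem_nhdsLT ht
  filter_upwards [h0] with s hs
  rw [slope_def_field]
  exact div_nonneg_of_nonpos (by linarith [hmax s ⟨hs.1.le, hs.2.le⟩]) (by linarith [hs.2])

/-- First and second derivative at a global maximum. -/
theorem deriv_deriv_of_max {φ : ℝ → ℝ} {x : ℝ} (hc : ContinuousAt φ x) (hmax : ∀ y, φ y ≤ φ x) :
    deriv φ x = 0 ∧ deriv (deriv φ) x ≤ 0 := by
  have hloc : IsLocalMax φ x := Eventually.of_forall hmax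
  refine ⟨hloc.deriv_eq_zero, ?_⟩
  by_contra! hpos
  have hmin := isLocalMin_of_deriv_deriv_pos hpos hloc.deriv_eq_zero hc
  -- a local minimum that is a global maximum forces `φ` to be locally constant
  have hconst : φ =ᶠ[𝓝 x] fun _ => φ x := by
    filter_upwards [hmin] with y hy using le_antisymm (hmax y) hy
  have : deriv (deriv φ) x = 0 := by
    rw [hconst.deriv.deriv_eq]; simp
  exact hpos.ne' this

/-- Parabolic comparison principle on the periodic strip: a function that is nonpositive
initially and at spatial infinity, and that grows at most exponentially at each of its positive
spatial maxima, stays nonpositive. -/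
theorem comparison {L K τ : ℝ} (hL : 0 < L) {g : ℝ → ℝ → ℝ → ℝ}
    (hcont : ContinuousOn (fun p : ℝ × ℝ × ℝ => g p.1 p.2.1 p.2.2) {p | 0 ≤ p.2.2})
    (hper : PeriodicX L g)
    (hfar : ∀ δ > 0, ∃ N : ℝ, ∀ x z, ∀ t ∈ Icc 0 τ, N ≤ |z| → g x z t < δ)
    (h0 : ∀ x z, g x z 0 ≤ 0)
    (hpt : ∀ x z t, 0 < t → t ≤ τ → 0 < g x z t → (∀ y, g y z t ≤ g x z t) →
      (∀ y, g x y t ≤ g x z t) → ∃ d, HasDerivAt (fun s => g x z s) d t ∧ d ≤ K * g x z t) :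
    ∀ x z, ∀ t ∈ Icc 0 τ, g x z t ≤ 0 := by
  intro x₀ z₀ t₀ ht₀
  by_contra! hpos
  set E : ℝ → ℝ := fun t => Real.exp (-(K + 1) * t) with hE
  have hEpos : ∀ t, 0 < E t := fun t => Real.exp_pos _
  set M := Real.exp (|K + 1| * τ) with hM
  have hMpos : 0 < M := Real.exp_pos _
  have hEM : ∀ t ∈ Icc 0 τ, E t ≤ M := fun t ht => by
    refine Real.exp_le_exp.2 ?_
    calc -(K + 1) * t ≤ |K + 1| * t := mul_le_mul_of_nonneg_right (neg_le_abs _) ht.1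
      _ ≤ |K + 1| * τ := mul_le_mul_of_nonneg_left ht.2 (abs_nonneg _)
  set m₀ := E t₀ * g x₀ z₀ t₀ with hm₀
  have hm₀pos : 0 < m₀ := mul_pos (hEpos _) hpos
  obtain ⟨N, hN⟩ := hfar (m₀ / M) (div_pos hm₀pos hMpos)
  have hfarE : ∀ x z, ∀ t ∈ Icc 0 τ, N ≤ |z| → E t * g x z t < m₀ := by
    intro x z t ht hz
    have h1 := hN x z t ht hz
    rcases le_or_gt (g x z t) 0 with h2 | h2
    · exact (mul_nonpos_of_nonneg_of_nonpos (hEpos t).le h2).trans_lt hm₀pos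
    · calc E t * g x z t ≤ M * g x z t := mul_le_mul_of_nonneg_right (hEM t ht) h2.le
        _ < M * (m₀ / M) := mul_lt_mul_of_pos_left h1 hMpos
        _ = m₀ := by field_simp
  have hz₀ : |z₀| < N := by
    by_contra! h; exact lt_irrefl _ (hfarE x₀ z₀ t₀ ht₀ h)
  obtain ⟨y₀, hy₀, e₀⟩ := exists_period_rep hL hper x₀ z₀ t₀ ht₀.1
  have hK : IsCompact (Icc 0 L ×ˢ Icc (-N) N ×ˢ Icc 0 τ) :=
    isCompact_Icc.prod (isCompact_Icc.prod isCompact_Icc)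
  have hmem₀ : ((y₀, z₀, t₀) : ℝ × ℝ × ℝ) ∈ Icc 0 L ×ˢ Icc (-N) N ×ˢ Icc 0 τ :=
    ⟨hy₀, abs_le.1 hz₀.le, ht₀⟩
  have hGc : ContinuousOn (fun p : ℝ × ℝ × ℝ => E p.2.2 * g p.1 p.2.1 p.2.2)
      (Icc 0 L ×ˢ Icc (-N) N ×ˢ Icc 0 τ) := by
    refine ContinuousOn.mul ?_ (hcont.mono fun p hp => hp.2.2.1)
    exact Continuous.continuousOn (by fun_prop)
  obtain ⟨⟨x₁, z₁, t₁⟩, hmem₁, hmax⟩ := hK.exists_isMaxOn ⟨_, hmem₀⟩ hGc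
  have ht₁ : t₁ ∈ Icc 0 τ := hmem₁.2.2
  have hge : m₀ ≤ E t₁ * g x₁ z₁ t₁ := by
    have := hmax hmem₀
    change E t₀ * g y₀ z₀ t₀ ≤ E t₁ * g x₁ z₁ t₁ at this
    rwa [← e₀] at this
  have hglob : ∀ x z, ∀ t ∈ Icc 0 τ, E t * g x z t ≤ E t₁ * g x₁ z₁ t₁ := by
    intro x z t ht
    rcases le_or_gt N |z| with hz | hz
    · exact (hfarE x z t ht hz).le.trans hge
    · obtain ⟨y, hy, e⟩ := exists_period_rep hL hper x z t ht.1
      rw [e]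
      exact hmax (show ((y, z, t) : ℝ × ℝ × ℝ) ∈ _ from ⟨hy, abs_le.1 hz.le, ht⟩)
  have hgpos : 0 < g x₁ z₁ t₁ := (mul_pos_iff_of_pos_left (hEpos t₁)).1 (hm₀pos.trans_le hge)
  have ht₁pos : 0 < t₁ := by
    rcases ht₁.1.eq_or_lt with h | h
    · rw [← h] at hgpos; exact absurd (h0 x₁ z₁) (not_le.2 hgpos)
    · exact h
  obtain ⟨d, hd, hdle⟩ := hpt x₁ z₁ t₁ ht₁pos ht₁.2 hgpos
    (fun y => le_of_mul_le_mul_left (hglob y z₁ t₁ ht₁) (hEpos t₁))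
    (fun y => le_of_mul_le_mul_left (hglob x₁ y t₁ ht₁) (hEpos t₁))
  have hEd : HasDerivAt E (E t₁ * -(K + 1)) t₁ := by
    exact (((hasDerivAt_id t₁).const_mul (-(K + 1))).exp).congr_deriv (by simp [hE])
  have h1 := nonneg_of_hasDerivAt_of_max_left ht₁pos (hEd.mul hd)
    fun s hs => hglob x₁ z₁ s ⟨hs.1, hs.2.trans ht₁.2⟩
  have h2 : E t₁ * -(K + 1) * g x₁ z₁ t₁ + E t₁ * d
      = E t₁ * (d - K * g x₁ z₁ t₁ - g x₁ z₁ t₁) := by ring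
  rw [h2] at h1
  have h3 := (mul_nonneg_iff_of_pos_left (hEpos t₁)).1 h1
  linarith

namespace IsSolution
variable {f : ℝ → ℝ} {σ ρ L : ℝ} {u w T : ℝ → ℝ → ℝ → ℝ}

theorem exists_bound_T (h : IsSolution f σ ρ L u w T) (hL : 0 < L) (τ : ℝ) :
    ∃ B : ℝ, 0 ≤ B ∧ ∀ x z, ∀ t ∈ Icc 0 τ, |T x z t| ≤ B :=
  exists_bound_of_limits hL h.regular_T h.periodic_T h.T_bot h.T_top τ

theorem exists_bound_u (h : IsSolution f σ ρ L u w T) (hL : 0 < L) (τ : ℝ) :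
    ∃ B : ℝ, 0 ≤ B ∧ ∀ x z, ∀ t ∈ Icc 0 τ, |u x z t| ≤ B :=
  exists_bound_of_limits hL h.regular_u h.periodic_u (limitsTo_cocompact h.u_infty).1
    (limitsTo_cocompact h.u_infty).2 τ

theorem exists_bound_w (h : IsSolution f σ ρ L u w T) (hL : 0 < L) (τ : ℝ) :
    ∃ B : ℝ, 0 ≤ B ∧ ∀ x z, ∀ t ∈ Icc 0 τ, |w x z t| ≤ B :=
  exists_bound_of_limits hL h.regular_w h.periodic_w (limitsTo_cocompact h.w_infty).1
    (limitsTo_cocompact h.w_infty).2 τ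

end IsSolution

theorem exists_lipschitz {f : ℝ → ℝ} (hf : ContDiff ℝ ∞ f) (B : ℝ) :
    ∃ K : ℝ, ∀ r s : ℝ, |r| ≤ B → |s| ≤ B → |f r - f s| ≤ K * |r - s| := by
  have hc : Continuous (deriv f) := hf.continuous_deriv (by simp)
  obtain ⟨K, hK⟩ := (isCompact_Icc (a := -B) (b := B)).exists_bound_of_continuousOn hc.continuousOn
  refine ⟨K, fun r s hr hs => ?_⟩
  exact (convex_Icc (-B) B).norm_image_sub_le_of_norm_deriv_le
    (fun x _ => hf.differentiable (by simp) x) hK (abs_le.1 hs) (abs_le.1 hr)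

theorem far_of_limits {g : ℝ → ℝ → ℝ → ℝ} {τ δ : ℝ}
    (h1 : ∀ᶠ z in atBot, ∀ x, ∀ t ∈ Icc 0 τ, g x z t < δ)
    (h2 : ∀ᶠ z in atTop, ∀ x, ∀ t ∈ Icc 0 τ, g x z t < δ) :
    ∃ N : ℝ, ∀ x z, ∀ t ∈ Icc 0 τ, N ≤ |z| → g x z t < δ := by
  obtain ⟨N₁, h1⟩ := eventually_atBot.1 h1
  obtain ⟨N₂, h2⟩ := eventually_atTop.1 h2
  refine ⟨max (-N₁) N₂, fun x z t ht hz => ?_⟩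
  rcases abs_cases z with ⟨e, _⟩ | ⟨e, _⟩
  · exact h2 z (by rw [← e]; exact (le_max_right _ _).trans hz) x t ht
  · exact h1 z (by linarith [le_max_left (-N₁) N₂]) x t ht

namespace IsSolution
variable {f : ℝ → ℝ} {σ ρ L : ℝ} {u w T : ℝ → ℝ → ℝ → ℝ}

/-- At a spatial maximum of `T` the advection vanishes and the diffusion has a sign. -/
theorem dt_T_le_of_max (h : IsSolution f σ ρ L u w T) {x z t : ℝ} (ht : 0 < t)
    (hx : ∀ y, T y z t ≤ T x z t) (hz : ∀ y, T x y t ≤ T x z t) :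
    dt T x z t ≤ f (T x z t) := by
  obtain ⟨h1, h2⟩ := deriv_deriv_of_max (h.sm_T.hasDerivAt_x ht).continuousAt hx
  obtain ⟨h3, h4⟩ := deriv_deriv_of_max (h.sm_T.hasDerivAt_z ht).continuousAt hz
  rw [h.dt_T ht, show dx T x z t = 0 from h1, show dz T x z t = 0 from h3]
  have h2' : dx (dx T) x z t ≤ 0 := h2
  have h4' : dz (dz T) x z t ≤ 0 := h4
  linarith

theorem le_dt_T_of_min (h : IsSolution f σ ρ L u w T) {x z t : ℝ} (ht : 0 < t)
    (hx : ∀ y, T x z t ≤ T y z t) (hz : ∀ y, T x z t ≤ T x y t) :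
    f (T x z t) ≤ dt T x z t := by
  obtain ⟨h1, h2⟩ := deriv_deriv_of_max (φ := fun y => -T y z t)
    (h.sm_T.hasDerivAt_x ht).continuousAt.neg (fun y => neg_le_neg (hx y))
  obtain ⟨h3, h4⟩ := deriv_deriv_of_max (φ := fun y => -T x y t)
    (h.sm_T.hasDerivAt_z ht).continuousAt.neg (fun y => neg_le_neg (hz y))
  have e1 : deriv (fun y => -T y z t) = fun y => -dx T y z t := funext fun y => deriv.fun_neg
  have e2 : deriv (fun y => -T x y t) = fun y => -dz T x y t := funext fun y => deriv.fun_neg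
  rw [e1] at h1 h2
  rw [e2] at h3 h4
  have h2' : -dx (dx T) x z t ≤ 0 := (deriv.fun_neg (f := fun y => dx T y z t)).symm.trans_le h2
  have h4' : -dz (dz T) x z t ≤ 0 := (deriv.fun_neg (f := fun y => dz T x y t)).symm.trans_le h4
  rw [h.dt_T ht, neg_eq_zero.1 h1, neg_eq_zero.1 h3]
  linarith

/-- The temperature stays between the two equilibria of the reaction. -/
theorem T_mem (h : IsSolution f σ ρ L u w T) (hL : 0 < L) (hf : ContDiff ℝ ∞ f) (hf0 : f 0 = 0)
    (hf1 : f 1 = 0) (x z t : ℝ) (ht : 0 ≤ t) : 0 ≤ T x z t ∧ T x z t ≤ 1 := by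
  obtain ⟨B, hB, hTB⟩ := h.exists_bound_T hL t
  obtain ⟨K, hK⟩ := exists_lipschitz hf (B + 1)
  constructor
  · have := comparison (τ := t) (K := K) hL (g := fun x z t => -T x z t) h.regular_T.1.neg
      (fun x z t ht => by simp only [h.periodic_T x z t ht])
      (fun δ hδ => far_of_limits
        (by
          filter_upwards [h.T_bot.exists_far t one_pos] with z hz x s hs
          linarith [(abs_lt.1 (hz x s hs)).1])
        (by
          filter_upwards [h.T_top.exists_far t hδ] with z hz x s hs
          linarith [(abs_lt.1 (hz x s hs)).1]))
      (fun x z => by linarith [(h.T_init x z).1])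
      (fun x z s hs hst hpos hx hz => ⟨-dt T x z s, (h.sm_T.hasDerivAt_t hs).neg, by
        have h1 := h.le_dt_T_of_min hs (fun y => neg_le_neg_iff.1 (hx y))
          (fun y => neg_le_neg_iff.1 (hz y))
        have h2 := hK (T x z s) 0 ((hTB x z s ⟨hs.le, hst⟩).trans (by linarith))
          (by rw [abs_zero]; linarith)
        rw [hf0, sub_zero, sub_zero, abs_of_neg (by linarith : T x z s < 0)] at h2
        linarith [(abs_le.1 h2).1]⟩) x z t ⟨ht, le_rfl⟩
    linarith
  · have := comparison (τ := t) (K := K) hL (g := fun x z t => T x z t - 1)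
      (h.regular_T.1.sub continuousOn_const)
      (fun x z t ht => by simp only [h.periodic_T x z t ht])
      (fun δ hδ => far_of_limits
        (by
          filter_upwards [h.T_bot.exists_far t hδ] with z hz x s hs
          linarith [(abs_lt.1 (hz x s hs)).2])
        (by
          filter_upwards [h.T_top.exists_far t one_pos] with z hz x s hs
          linarith [(abs_lt.1 (hz x s hs)).2]))
      (fun x z => by linarith [(h.T_init x z).2])
      (fun x z s hs hst hpos hx hz => ⟨dt T x z s, (h.sm_T.hasDerivAt_t hs).sub_const 1, by
        have h1 := h.dt_T_le_of_max hs (fun y => by linarith [hx y]) (fun y => by linarith [hz y])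
        have h2 := hK (T x z s) 1 ((hTB x z s ⟨hs.le, hst⟩).trans (by linarith))
          (by rw [abs_one]; linarith)
        rw [hf1, sub_zero, abs_of_pos hpos] at h2
        linarith [(abs_le.1 h2).2]⟩) x z t ⟨ht, le_rfl⟩
    linarith

end IsSolution

/-! ### The energy inequality -/

/-- A solution together with the smallness conditions under which it is shown to relax:
`m` bounds the slope of the reaction, the period is small relative to `m`, and `ρ L³ ≤ 1/4`. -/
structure SmallData (f : ℝ → ℝ) (m σ ρ L : ℝ) (u w T : ℝ → ℝ → ℝ → ℝ) : Prop where
  sol : IsSolution f σ ρ L u w T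
  smooth : ContDiff ℝ ∞ f
  zero : f 0 = 0
  one : f 1 = 0
  slope : ∀ s ∈ Icc (0 : ℝ) 1, |deriv f s| ≤ m
  σ_pos : 0 < σ
  ρ_pos : 0 < ρ
  L_pos : 0 < L
  small_L : m * L ^ 2 ≤ 1 / 4
  small_ρ : ρ * L ^ 3 ≤ 1 / 4

theorem abs_cutInt_le_of_abs_le {L c K : ℝ} {η : ℝ → ℝ} {F G : ℝ → ℝ → ℝ}
    (hη : ∀ z, |η z| ≤ c) (hF : Continuous fun q : ℝ × ℝ => F q.1 q.2)
    (hG : Integrable (fun p : ℝ × ℝ => G p.1 p.2) (cell L)) (hFG : ∀ x z, |F x z| ≤ G x z)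
    (hK : ∫ p : ℝ × ℝ, G p.1 p.2 ∂(cell L) ≤ K) : |cutInt L η F| ≤ c * K := by
  have hc : 0 ≤ c := (abs_nonneg _).trans (hη 0)
  have hFi : Integrable (fun p : ℝ × ℝ => F p.1 p.2) (cell L) :=
    hG.mono' hF.aestronglyMeasurable (Eventually.of_forall fun p => hFG p.1 p.2)
  refine (abs_cutInt_le hη hFi).trans (mul_le_mul_of_nonneg_left (le_trans ?_ hK) hc)
  exact integral_mono hFi.abs hG fun p => hFG p.1 p.2

namespace SmallData
variable {f : ℝ → ℝ} {m σ ρ L : ℝ} {u w T : ℝ → ℝ → ℝ → ℝ} {t : ℝ} {η η' η'' : ℝ → ℝ}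

theorem T_mem (D : SmallData f m σ ρ L u w T) (x z t : ℝ) (ht : 0 ≤ t) :
    0 ≤ T x z t ∧ T x z t ≤ 1 := D.sol.T_mem D.L_pos D.smooth D.zero D.one x z t ht

theorem m_nonneg (D : SmallData f m σ ρ L u w T) : 0 ≤ m :=
  (abs_nonneg _).trans (D.slope 0 (by simp))

/-- Slicewise Poincaré inequality for `v_x = (-w_z, w_x)`. -/
theorem cutInt_grad_w_le (D : SmallData f m σ ρ L u w T) (ht : 0 < t) (hη : IsCutoff η η' η'')
    (h0 : ∀ z, 0 ≤ η z) :
    cutInt L η (fun x z => dx w x z t ^ 2 + dz w x z t ^ 2)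
      ≤ L ^ 2 * cutInt L η (fun x z => dx (dx w) x z t ^ 2 + dz (dx w) x z t ^ 2) := by
  have hL := D.L_pos
  have hw := D.sol.sm_w.hasGrad D.sol.per_w ht
  have hu := D.sol.sm_u.hasGrad D.sol.per_u ht
  have hwx := D.sol.sm_w.dx.hasGrad D.sol.per_w.dx ht
  have hwz := D.sol.sm_w.dz.hasGrad D.sol.per_w.dz ht
  have c1 := hwx.cont
  have c2 := hwz.cont
  have c3 := hwx.cont_x
  have c4 := hwx.cont_z
  have c5 := hwz.cont_x
  rw [← cutInt_const_mul]
  refine cutInt_mono_slice hL.le hη.cont hη.supp h0 (by fun_prop) (by fun_prop) fun z => ?_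
  have hs : Continuous fun x : ℝ => (x, z) := by fun_prop
  have s1 := c1.comp hs
  have s2 := c2.comp hs
  have s3 := c3.comp hs
  have s4 := c4.comp hs
  have s5 := c5.comp hs
  simp only [Function.comp_def] at s1 s2 s3 s4 s5
  have m2 : ∫ x in (0 : ℝ)..L, dz w x z t = 0 := by
    have : ∀ x, dz w x z t = -dx u x z t := fun x => by
      rw [D.sol.dx_u ht, neg_neg]
    simp only [this, intervalIntegral.integral_neg, hu.integral_x_eq_zero, neg_zero]
  have p1 := poincare hL (fun x => hwx.hx x z) s3 (hw.integral_x_eq_zero z)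
  have p2 := poincare hL (fun x => hwz.hx x z) s5 m2
  have e : ∀ x, dx (dz w) x z t = dz (dx w) x z t := fun x =>
    (D.sol.sm_w.mono (by norm_num)).dx_dz_comm ht
  simp only [e] at p2
  rw [intervalIntegral.integral_add, intervalIntegral.integral_const_mul,
    intervalIntegral.integral_add]
  · linarith
  all_goals exact Continuous.intervalIntegrable (by fun_prop) _ _

/-- The Hessian of `w` is controlled by the vorticity gradient: `ω_x = Δ w`. -/
theorem cutInt_hessian_w (D : SmallData f m σ ρ L u w T) (ht : 0 < t) (hη : IsCutoff η η' η'') :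
    cutInt L η (fun x z => dx (dx w) x z t ^ 2 + 2 * dz (dx w) x z t ^ 2 + dz (dz w) x z t ^ 2)
      = cutInt L η (fun x z => dx (vort u w) x z t ^ 2)
        + cutInt L η'' (fun x z => dx w x z t ^ 2) := by
  have hwx := D.sol.sm_w.dx.hasGrad D.sol.per_w.dx ht
  have hwzz := D.sol.sm_w.dz.dz.hasGrad D.sol.per_w.dz.dz ht
  have hwxz := D.sol.sm_w.dx.dz.hasGrad D.sol.per_w.dx.dz ht
  rw [cutInt_hessian D.L_pos.le hη hwx hwzz hwxz fun x z => ?_]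
  · congr 1
    exact cutInt_congr fun x z => by rw [D.sol.dx_vort ht]
  · rw [D.sol.sm_w.dz.dx_dz_comm ht]
    exact congrArg (fun k => deriv k z)
      (funext fun y => (D.sol.sm_w.mono (by norm_num)).dx_dz_comm ht)

/-- The coupling `ω T_x` is absorbed by both dissipations, since `T_x` has mean zero. -/
theorem cutInt_coupling_le (D : SmallData f m σ ρ L u w T) (ht : 0 < t) (hη : IsCutoff η η' η'')
    (h0 : ∀ z, 0 ≤ η z) :
    cutInt L η (fun x z => 1 / L * (dx T x z t * vort u w x z t))
      ≤ 1 / 4 * cutInt L η (fun x z => dx (dx T) x z t ^ 2)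
        + L ^ 2 * cutInt L η (fun x z => dx (vort u w) x z t ^ 2) := by
  have hL := D.L_pos
  have hT := D.sol.sm_T.hasGrad D.sol.per_T ht
  have hS := D.sol.sm_T.dx.hasGrad D.sol.per_T.dx ht
  have hω := D.sol.sm_vort.hasGrad D.sol.per_vort ht
  have c1 := hS.cont
  have c2 := hS.cont_x
  have c3 := hω.cont
  have c4 := hω.cont_x
  rw [← cutInt_const_mul, ← cutInt_const_mul, ← cutInt_add hη.cont hη.supp (by fun_prop)
    (by fun_prop)]
  refine cutInt_mono_slice hL.le hη.cont hη.supp h0 (by fun_prop) (by fun_prop) fun z => ?_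
  have hs : Continuous fun x : ℝ => (x, z) := by fun_prop
  have s1 := c1.comp hs
  have s2 := c2.comp hs
  have s3 := c3.comp hs
  have s4 := c4.comp hs
  simp only [Function.comp_def] at s1 s2 s3 s4
  have m0 := hT.integral_x_eq_zero z
  have p1 := poincare hL (fun x => hS.hx x z) s2 m0
  have p2 := (abs_le.1 (integral_mul_le_of_mean_zero hL s1 m0 (fun x => hω.hx x z) s4
    (by positivity : 0 < 2 * L))).2
  rw [intervalIntegral.integral_const_mul, intervalIntegral.integral_add,
    intervalIntegral.integral_const_mul, intervalIntegral.integral_const_mul]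
  · set A := ∫ x in (0 : ℝ)..L, dx (dx T) x z t ^ 2
    set B := ∫ x in (0 : ℝ)..L, dx (vort u w) x z t ^ 2
    set I := ∫ x in (0 : ℝ)..L, dx T x z t * vort u w x z t
    set S2 := ∫ x in (0 : ℝ)..L, dx T x z t ^ 2
    have h3 : I ≤ L ^ 2 * A / (2 * (2 * L)) + 2 * L / 2 * (L ^ 2 * B) := by
      refine p2.trans ?_
      gcongr
    calc 1 / L * I ≤ 1 / L * (L ^ 2 * A / (2 * (2 * L)) + 2 * L / 2 * (L ^ 2 * B)) := by gcongr
      _ = 1 / 4 * A + L ^ 2 * B := by field_simp; ring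
  all_goals exact Continuous.intervalIntegrable (by fun_prop) _ _

/-- The reaction is absorbed by the dissipation because the period is small. -/
theorem cutInt_reaction_le (D : SmallData f m σ ρ L u w T) (ht : 0 < t) (hη : IsCutoff η η' η'')
    (h0 : ∀ z, 0 ≤ η z) :
    cutInt L η (fun x z => deriv f (T x z t) * dx T x z t ^ 2)
      ≤ 1 / 4 * cutInt L η (fun x z => dx (dx T) x z t ^ 2) := by
  have hL := D.L_pos
  have hT := D.sol.sm_T.hasGrad D.sol.per_T ht
  have hS := D.sol.sm_T.dx.hasGrad D.sol.per_T.dx ht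
  have cf : Continuous (deriv f) := D.smooth.continuous_deriv (by simp)
  have c0 := hT.cont
  have c1 := hS.cont
  have c2 := hS.cont_x
  have cf' := cf.comp c0
  simp only [Function.comp_def] at cf'
  refine (cutInt_mono (G := fun x z => m * dx T x z t ^ 2) hη.cont hη.supp h0 (by fun_prop)
    (by fun_prop) fun x z => ?_).trans ?_
  · exact mul_le_mul_of_nonneg_right ((le_abs_self _).trans (D.slope _ (D.T_mem x z t ht.le)))
      (sq_nonneg _)
  rw [← cutInt_const_mul]
  refine cutInt_mono_slice hL.le hη.cont hη.supp h0 (by fun_prop) (by fun_prop) fun z => ?_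
  have hs : Continuous fun x : ℝ => (x, z) := by fun_prop
  have p1 := poincare hL (fun x => hS.hx x z) (c2.comp hs) (hT.integral_x_eq_zero z)
  rw [intervalIntegral.integral_const_mul, intervalIntegral.integral_const_mul]
  have hA : 0 ≤ ∫ x in (0 : ℝ)..L, dx (dx T) x z t ^ 2 :=
    intervalIntegral.integral_nonneg hL.le fun _ _ => sq_nonneg _
  calc m * ∫ x in (0 : ℝ)..L, dx T x z t ^ 2
      ≤ m * (L ^ 2 * ∫ x in (0 : ℝ)..L, dx (dx T) x z t ^ 2) :=
        mul_le_mul_of_nonneg_left p1 D.m_nonneg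
    _ = (m * L ^ 2) * ∫ x in (0 : ℝ)..L, dx (dx T) x z t ^ 2 := by ring
    _ ≤ _ := mul_le_mul_of_nonneg_right D.small_L hA

/-- The stretching term costs a quarter of the dissipation of `T_x` and, by the Poincaré
inequality and the Hessian bound, a small multiple of the dissipation of the vorticity. -/
theorem cutInt_stretch_le (D : SmallData f m σ ρ L u w T) (ht : 0 < t) (hη : IsCutoff η η' η'')
    (h0 : ∀ z, 0 ≤ η z) :
    cutInt L η (fun x z => T x z t * (dx u x z t * dx (dx T) x z t + dx w x z t * dz (dx T) x z t))
      ≤ 1 / 4 * cutInt L η (fun x z => dx (dx T) x z t ^ 2 + dz (dx T) x z t ^ 2)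
        + L ^ 2 * cutInt L η (fun x z => dx (vort u w) x z t ^ 2)
        + L ^ 2 * cutInt L η'' (fun x z => dx w x z t ^ 2) := by
  have hT := D.sol.sm_T.hasGrad D.sol.per_T ht
  have hu := D.sol.sm_u.hasGrad D.sol.per_u ht
  have hS := D.sol.sm_T.dx.hasGrad D.sol.per_T.dx ht
  have hw := D.sol.sm_w.hasGrad D.sol.per_w ht
  have hwx := D.sol.sm_w.dx.hasGrad D.sol.per_w.dx ht
  have hwz := D.sol.sm_w.dz.hasGrad D.sol.per_w.dz ht
  have c1 := hT.cont
  have c2 := hS.cont_x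
  have c3 := hS.cont_z
  have c4 := hw.cont_x
  have c5 := hw.cont_z
  have c6 := hu.cont_x
  have c7 := hwx.cont_x
  have c8 := hwx.cont_z
  have c9 := hwz.cont_z
  have h1 := cutInt_grad_w_le D ht hη h0
  have h2 := cutInt_hessian_w D ht hη
  have h3 : cutInt L η (fun x z => dx (dx w) x z t ^ 2 + dz (dx w) x z t ^ 2)
      ≤ cutInt L η (fun x z =>
        dx (dx w) x z t ^ 2 + 2 * dz (dx w) x z t ^ 2 + dz (dz w) x z t ^ 2) :=
    cutInt_mono hη.cont hη.supp h0 (by fun_prop) (by fun_prop) fun x z => by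
      nlinarith [sq_nonneg (dz (dx w) x z t), sq_nonneg (dz (dz w) x z t)]
  have h4 : cutInt L η (fun x z => T x z t
        * (dx u x z t * dx (dx T) x z t + dx w x z t * dz (dx T) x z t))
      ≤ cutInt L η (fun x z => 1 / 4 * (dx (dx T) x z t ^ 2 + dz (dx T) x z t ^ 2)
        + (dx w x z t ^ 2 + dz w x z t ^ 2)) := by
    refine cutInt_mono hη.cont hη.supp h0 (by fun_prop) (by fun_prop) fun x z => ?_
    obtain ⟨hT0, hT1⟩ := D.T_mem x z t ht.le
    have hB : dx u x z t * dx (dx T) x z t + dx w x z t * dz (dx T) x z t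
        ≤ 1 / 4 * (dx (dx T) x z t ^ 2 + dz (dx T) x z t ^ 2)
          + (dx w x z t ^ 2 + dz w x z t ^ 2) := by
      rw [D.sol.dx_u ht]
      nlinarith [sq_nonneg (dz w x z t + 1 / 2 * dx (dx T) x z t),
        sq_nonneg (dx w x z t - 1 / 2 * dz (dx T) x z t)]
    have hB0 : 0 ≤ 1 / 4 * (dx (dx T) x z t ^ 2 + dz (dx T) x z t ^ 2)
          + (dx w x z t ^ 2 + dz w x z t ^ 2) := by positivity
    exact (mul_le_mul_of_nonneg_left hB hT0).trans (mul_le_of_le_one_left hB0 hT1)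
  rw [cutInt_add hη.cont hη.supp (by fun_prop) (by fun_prop), cutInt_const_mul] at h4
  have hL2 : 0 ≤ L ^ 2 := sq_nonneg L
  have h5 := mul_le_mul_of_nonneg_left (h3.trans h2.le) hL2
  linarith

/-- The smallness of `ρ L³` in the form in which it is used: the dissipation of the vorticity,
which carries the weight `1 / (ρ L)`, dominates `L²`-multiples of the Hessian of `w`. -/
theorem inv_ρL (D : SmallData f m σ ρ L u w T) : 4 * L ^ 2 ≤ 1 / (ρ * L) := by
  have h1 := D.small_ρ
  have h2 := mul_pos D.ρ_pos D.L_pos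
  rw [le_div_iff₀ h2]
  nlinarith

/-- Dissipation of the energy `½ ∫ η (T_x² + κ ω²)` with `κ = 1 / (σ ρ L)`, up to terms that
carry derivatives of the cutoff. -/
theorem energy_rate (D : SmallData f m σ ρ L u w T) (ht : 0 < t) (hη : IsCutoff η η' η'')
    (h0 : ∀ z, 0 ≤ η z) :
    cutInt L η (fun x z => dx T x z t * dt (dx T) x z t
        + 1 / (σ * ρ * L) * (vort u w x z t * dt (vort u w) x z t))
      ≤ -(1 / 4 * cutInt L η (fun x z => dx (dx T) x z t ^ 2 + dz (dx T) x z t ^ 2))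
        - 1 / (2 * (ρ * L)) *
          cutInt L η (fun x z => dx (vort u w) x z t ^ 2 + dz (vort u w) x z t ^ 2)
        + (1 / 2 * cutInt L η'' (fun x z => dx T x z t ^ 2)
          + 1 / 2 * cutInt L η' (fun x z => w x z t * dx T x z t ^ 2)
          + cutInt L η' (fun x z => T x z t * (dx T x z t * dx w x z t))
          + L ^ 2 * cutInt L η'' (fun x z => dx w x z t ^ 2)
          + 1 / (2 * (ρ * L)) * cutInt L η'' (fun x z => vort u w x z t ^ 2)
          + 1 / (2 * (σ * ρ * L)) * cutInt L η' (fun x z => w x z t * vort u w x z t ^ 2)) := by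
  have hL := D.L_pos
  have hσ := D.σ_pos
  have hρ := D.ρ_pos
  have hT := D.sol.sm_T.hasGrad D.sol.per_T ht
  have hu := D.sol.sm_u.hasGrad D.sol.per_u ht
  have hux := D.sol.sm_u.dx.hasGrad D.sol.per_u.dx ht
  have hw := D.sol.sm_w.hasGrad D.sol.per_w ht
  have hwx := D.sol.sm_w.dx.hasGrad D.sol.per_w.dx ht
  have hS := D.sol.sm_T.dx.hasGrad D.sol.per_T.dx ht
  have hSx := D.sol.sm_T.dx.dx.hasGrad D.sol.per_T.dx.dx ht
  have hSz := D.sol.sm_T.dx.dz.hasGrad D.sol.per_T.dx.dz ht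
  have hω := D.sol.sm_vort.hasGrad D.sol.per_vort ht
  have hωx := D.sol.sm_vort.dx.hasGrad D.sol.per_vort.dx ht
  have hωz := D.sol.sm_vort.dz.hasGrad D.sol.per_vort.dz ht
  have hdiv : ∀ x z, dx u x z t + dz w x z t = 0 := fun x z => D.sol.div_free x z t ht
  have cf : Continuous (deriv f) := D.smooth.continuous_deriv (by simp)
  have cf' := cf.comp hT.cont
  simp only [Function.comp_def] at cf'
  have a1 := hT.cont
  have a2 := hT.cont_z
  have a3 := hu.cont
  have a4 := hux.cont
  have a5 := hw.cont
  have a6 := hwx.cont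
  have a7 := hS.cont
  have a8 := hSx.cont
  have a9 := hSx.cont_x
  have b1 := hSz.cont
  have b2 := hSz.cont_z
  have b3 := hω.cont
  have b4 := hωx.cont
  have b5 := hωx.cont_x
  have b6 := hωz.cont
  have b7 := hωz.cont_z
  -- the five contributions
  have E1 := cutInt_energy hL.le hη hu hw hdiv hS hSx hSz 1
  have E2 := cutInt_stretch hL.le hη hT hS hux hwx fun x z => by
    rw [D.sol.dx_dx_u ht]; ring
  have E3 := cutInt_energy hL.le hη hu hw hdiv hω hωx hωz σ
  have B1 := cutInt_stretch_le D ht hη h0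
  have B2 := cutInt_reaction_le D ht hη h0
  have B3 := cutInt_coupling_le D ht hη h0
  have split : cutInt L η (fun x z => dx T x z t * dt (dx T) x z t
        + 1 / (σ * ρ * L) * (vort u w x z t * dt (vort u w) x z t))
      = cutInt L η (fun x z => dx T x z t * (1 * (dx (dx (dx T)) x z t + dz (dz (dx T)) x z t)
          - u x z t * dx (dx T) x z t - w x z t * dz (dx T) x z t))
        + cutInt L η (fun x z => -(dx T x z t * (dx u x z t * dx T x z t
          + dx w x z t * dz T x z t)))
        + cutInt L η (fun x z => deriv f (T x z t) * dx T x z t ^ 2)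
        + 1 / (σ * ρ * L) * cutInt L η (fun x z => vort u w x z t
          * (σ * (dx (dx (vort u w)) x z t + dz (dz (vort u w)) x z t)
          - u x z t * dx (vort u w) x z t - w x z t * dz (vort u w) x z t))
        + cutInt L η (fun x z => 1 / L * (dx T x z t * vort u w x z t)) := by
    rw [← cutInt_const_mul, ← cutInt_add hη.cont hη.supp (by fun_prop) (by fun_prop),
      ← cutInt_add hη.cont hη.supp (by fun_prop) (by fun_prop),
      ← cutInt_add hη.cont hη.supp (by fun_prop) (by fun_prop),
      ← cutInt_add hη.cont hη.supp (by fun_prop) (by fun_prop)]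
    refine cutInt_congr fun x z => ?_
    rw [D.sol.dt_dx_T (D.smooth.differentiable (by simp)) ht, D.sol.dt_vort ht]
    field_simp
    ring
  have X1 : cutInt L η (fun x z => dx (dx T) x z t ^ 2)
      ≤ cutInt L η (fun x z => dx (dx T) x z t ^ 2 + dz (dx T) x z t ^ 2) :=
    cutInt_mono hη.cont hη.supp h0 (by fun_prop) (by fun_prop) fun x z => by
      nlinarith [sq_nonneg (dz (dx T) x z t)]
  have Y1 : cutInt L η (fun x z => dx (vort u w) x z t ^ 2)
      ≤ cutInt L η (fun x z => dx (vort u w) x z t ^ 2 + dz (vort u w) x z t ^ 2) :=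
    cutInt_mono hη.cont hη.supp h0 (by fun_prop) (by fun_prop) fun x z => by
      nlinarith [sq_nonneg (dz (vort u w) x z t)]
  have Y0 : 0 ≤ cutInt L η (fun x z => dx (vort u w) x z t ^ 2 + dz (vort u w) x z t ^ 2) :=
    cutInt_nonneg h0 fun x z => by positivity
  have k := D.inv_ρL
  rw [split, E1, E2, E3]
  set Y := cutInt L η (fun x z => dx (vort u w) x z t ^ 2 + dz (vort u w) x z t ^ 2)
  set X := cutInt L η (fun x z => dx (dx T) x z t ^ 2 + dz (dx T) x z t ^ 2)
  set Yx := cutInt L η (fun x z => dx (vort u w) x z t ^ 2)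
  set Xx := cutInt L η (fun x z => dx (dx T) x z t ^ 2)
  have k1 : L ^ 2 * Yx ≤ L ^ 2 * Y := mul_le_mul_of_nonneg_left Y1 (sq_nonneg L)
  have k2 : 2 * (L ^ 2 * Y) ≤ 1 / (2 * (ρ * L)) * Y := by
    have e : 1 / (2 * (ρ * L)) = 1 / 2 * (1 / (ρ * L)) := by field_simp
    rw [e]
    have := mul_le_mul_of_nonneg_right k Y0
    linarith
  have k3 : ∀ A B C : ℝ, 1 / (σ * ρ * L) * (-(σ * A) + σ / 2 * B + 1 / 2 * C)
      = -(2 * (1 / (2 * (ρ * L)) * A)) + 1 / (2 * (ρ * L)) * B + 1 / (2 * (σ * ρ * L)) * C := by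
    intro A B C; field_simp
  rw [k3]
  linarith

end SmallData

/-! ### Decay of the energy -/

/-- The energy density `½ (T_x² + κ ω²)`, `κ = 1 / (σ ρ L)`. -/
def eDens (σ ρ L : ℝ) (u w T : ℝ → ℝ → ℝ → ℝ) : ℝ → ℝ → ℝ → ℝ :=
  fun x z t => 1 / 2 * dx T x z t ^ 2 + 1 / (2 * (σ * ρ * L)) * vort u w x z t ^ 2

/-- The dissipation density `|∇T_x|² + |∇ω|²`. -/
def dDens (u w T : ℝ → ℝ → ℝ → ℝ) : ℝ → ℝ → ℝ → ℝ :=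
  fun x z t => dx (dx T) x z t ^ 2 + dz (dx T) x z t ^ 2
    + (dx (vort u w) x z t ^ 2 + dz (vort u w) x z t ^ 2)

/-- The squared Hessian of `w`. -/
def hDens (w : ℝ → ℝ → ℝ → ℝ) : ℝ → ℝ → ℝ → ℝ :=
  fun x z t => dx (dx w) x z t ^ 2 + 2 * dz (dx w) x z t ^ 2 + dz (dz w) x z t ^ 2

/-- The energy `½ ∫_D (T_x² + κ ω²)`. -/
def energy (σ ρ L : ℝ) (u w T : ℝ → ℝ → ℝ → ℝ) (t : ℝ) : ℝ :=
  ∫ p : ℝ × ℝ, eDens σ ρ L u w T p.1 p.2 t ∂(cell L)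

/-- The fraction of the dissipation that survives in the energy inequality. -/
def dissCoeff (ρ L : ℝ) : ℝ := min (1 / 4) (1 / (2 * (ρ * L)))

namespace SmallData
variable {f : ℝ → ℝ} {m σ ρ L : ℝ} {u w T : ℝ → ℝ → ℝ → ℝ} {a b : ℝ}

theorem contPos_eDens (D : SmallData f m σ ρ L u w T) : ContPos (eDens σ ρ L u w T) := by
  have c1 := D.sol.sm_T.dx.contPos
  have c2 := D.sol.sm_vort.contPos
  unfold ContPos eDens at *
  fun_prop

theorem contPos_dDens (D : SmallData f m σ ρ L u w T) : ContPos (dDens u w T) := by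
  have c1 := D.sol.sm_T.dx.dx.contPos
  have c2 := D.sol.sm_T.dx.dz.contPos
  have c3 := D.sol.sm_vort.dx.contPos
  have c4 := D.sol.sm_vort.dz.contPos
  unfold ContPos dDens at *
  fun_prop

theorem contPos_hDens (D : SmallData f m σ ρ L u w T) : ContPos (hDens w) := by
  have c1 := D.sol.sm_w.dx.dx.contPos
  have c2 := D.sol.sm_w.dx.dz.contPos
  have c3 := D.sol.sm_w.dz.dz.contPos
  unfold ContPos hDens at *
  fun_prop

theorem κ_pos (D : SmallData f m σ ρ L u w T) : 0 < 1 / (2 * (σ * ρ * L)) := by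
  have := D.σ_pos
  have := D.ρ_pos
  have := D.L_pos
  positivity

theorem dissCoeff_pos (D : SmallData f m σ ρ L u w T) : 0 < dissCoeff ρ L := by
  have := D.ρ_pos
  have := D.L_pos
  exact lt_min (by norm_num) (by positivity)

theorem exists_bound_vort (D : SmallData f m σ ρ L u w T) (ha : 0 < a) :
    ∃ K : ℝ, 0 ≤ K ∧ ∀ t ∈ Icc a b,
      Integrable (fun p : ℝ × ℝ => vort u w p.1 p.2 t ^ 2) (cell L) ∧
        ∫ p : ℝ × ℝ, vort u w p.1 p.2 t ^ 2 ∂(cell L) ≤ K := by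
  obtain ⟨K₁, h1, hK₁⟩ := D.sol.L2_dx_w.exists_bound D.sol.sm_w.dx.contPos (b := b) ha
  obtain ⟨K₂, h2, hK₂⟩ := D.sol.L2_dz_u.exists_bound D.sol.sm_u.dz.contPos (b := b) ha
  refine ⟨2 * (K₁ + K₂), by positivity, fun t ht => ?_⟩
  obtain ⟨i1, j1⟩ := hK₁ t ht
  obtain ⟨i2, j2⟩ := hK₂ t ht
  have i3 := (i1.add i2).const_mul 2
  have hle : ∀ p : ℝ × ℝ, vort u w p.1 p.2 t ^ 2
      ≤ 2 * (dx w p.1 p.2 t ^ 2 + dz u p.1 p.2 t ^ 2) := fun p => by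
    simp only [vort]
    nlinarith [sq_nonneg (dx w p.1 p.2 t + dz u p.1 p.2 t)]
  have i4 : Integrable (fun p : ℝ × ℝ => vort u w p.1 p.2 t ^ 2) (cell L) := by
    refine i3.mono' ((D.sol.sm_vort.contPos.slice (ha.trans_le ht.1)).pow 2).aestronglyMeasurable
      (Eventually.of_forall fun p => ?_)
    rw [Real.norm_eq_abs, abs_of_nonneg (sq_nonneg _)]
    exact hle p
  refine ⟨i4, (integral_mono i4 i3 hle).trans ?_⟩
  rw [integral_const_mul]
  have : ∫ p : ℝ × ℝ, ((fun p : ℝ × ℝ => dx w p.1 p.2 t ^ 2)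
      + fun p : ℝ × ℝ => dz u p.1 p.2 t ^ 2) p ∂(cell L) = _ := integral_add i1 i2
  rw [this]
  linarith

theorem integrable_eDens (D : SmallData f m σ ρ L u w T) {t : ℝ} (ht : 0 < t) :
    Integrable (fun p : ℝ × ℝ => eDens σ ρ L u w T p.1 p.2 t) (cell L) := by
  obtain ⟨K₁, h1, hK₁⟩ := D.sol.L2_dx_T.exists_bound D.sol.sm_T.dx.contPos (b := t) ht
  obtain ⟨K₂, h2, hK₂⟩ := D.exists_bound_vort (b := t) ht
  exact ((hK₁ t ⟨le_rfl, le_rfl⟩).1.const_mul _).add ((hK₂ t ⟨le_rfl, le_rfl⟩).1.const_mul _)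

theorem eDens_nonneg (D : SmallData f m σ ρ L u w T) (x z t : ℝ) :
    0 ≤ eDens σ ρ L u w T x z t := by
  have := D.κ_pos
  unfold eDens; positivity

theorem dDens_nonneg (u w T : ℝ → ℝ → ℝ → ℝ) (x z t : ℝ) : 0 ≤ dDens u w T x z t := by
  unfold dDens; positivity

theorem hDens_nonneg (w : ℝ → ℝ → ℝ → ℝ) (x z t : ℝ) : 0 ≤ hDens w x z t := by
  unfold hDens; positivity

theorem energy_nonneg (D : SmallData f m σ ρ L u w T) (t : ℝ) : 0 ≤ energy σ ρ L u w T t :=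
  integral_nonneg fun p => D.eDens_nonneg p.1 p.2 t

/-- The energy inequality localized by `cut n`, with an error of order `1 / n`. -/
theorem cutInt_energy_le (D : SmallData f m σ ρ L u w T) (ha : 0 < a) (hab : a ≤ b) :
    ∃ C : ℝ, ∀ n : ℕ, cutInt L (cut n) (fun x z => eDens σ ρ L u w T x z b)
      + dissCoeff ρ L * ∫ t in a..b, cutInt L (cut n) (fun x z => dDens u w T x z t)
      ≤ cutInt L (cut n) (fun x z => eDens σ ρ L u w T x z a) + C / (n + 1) := by
  obtain ⟨K₁, k1, hK₁⟩ := D.sol.L2_dx_T.exists_bound D.sol.sm_T.dx.contPos (b := b) ha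
  obtain ⟨K₂, k2, hK₂⟩ := D.exists_bound_vort (b := b) ha
  obtain ⟨K₃, k3, hK₃⟩ := D.sol.L2_dx_w.exists_bound D.sol.sm_w.dx.contPos (b := b) ha
  obtain ⟨B, hB0, hB⟩ := D.sol.exists_bound_w D.L_pos b
  obtain ⟨C, hC0, hC⟩ := exists_cut_bound
  have hκ := D.κ_pos
  have hρL : 0 < 1 / (2 * (ρ * L)) := by
    have := D.ρ_pos
    have := D.L_pos
    positivity
  set R := 1 / 2 * (C * K₁) + 1 / 2 * (C * (B * K₁)) + C * (K₁ + K₃) + L ^ 2 * (C * K₃)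
    + 1 / (2 * (ρ * L)) * (C * K₂) + 1 / (2 * (σ * ρ * L)) * (C * (B * K₂)) with hR
  refine ⟨R * (b - a), fun n => ?_⟩
  obtain ⟨hC1, hC2, -⟩ := hC n
  have hn : (0 : ℝ) < n + 1 := by positivity
  have hcut := isCutoff_cut n
  set et : ℝ → ℝ → ℝ → ℝ := fun x z t => dx T x z t * dt (dx T) x z t
        + 1 / (σ * ρ * L) * (vort u w x z t * dt (vort u w) x z t) with het
  have het_cont : ContPos et := by
    have c1 := D.sol.sm_T.dx.contPos
    have c2 := D.sol.sm_T.dx.dt.contPos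
    have c3 := D.sol.sm_vort.contPos
    have c4 := D.sol.sm_vort.dt.contPos
    unfold ContPos at *
    fun_prop
  have hderiv : ∀ x z t, 0 < t →
      HasDerivAt (fun s => eDens σ ρ L u w T x z s) (et x z t) t := fun x z t ht => by
    have h1 := D.sol.sm_T.dx.hasDerivAt_t (x := x) (z := z) ht
    have h2 := D.sol.sm_vort.hasDerivAt_t (x := x) (z := z) ht
    refine (((h1.pow 2).const_mul (1 / 2)).add
      ((h2.pow 2).const_mul (1 / (2 * (σ * ρ * L))))).congr_deriv ?_
    have := D.σ_pos
    have := D.ρ_pos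
    have := D.L_pos
    simp only [het]
    field_simp
    norm_num
    ring
  have hrate : ∀ t ∈ Icc a b, cutInt L (cut n) (fun x z => et x z t)
      ≤ -(dissCoeff ρ L * cutInt L (cut n) (fun x z => dDens u w T x z t)) + R / (n + 1) := by
    intro t ht
    have ht0 : 0 < t := ha.trans_le ht.1
    obtain ⟨i1, j1⟩ := hK₁ t ht
    obtain ⟨i2, j2⟩ := hK₂ t ht
    obtain ⟨i3, j3⟩ := hK₃ t ht
    have a1 := D.sol.sm_T.contPos.slice ht0
    have a2 := D.sol.sm_T.dx.contPos.slice ht0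
    have a3 := D.sol.sm_w.contPos.slice ht0
    have a4 := D.sol.sm_w.dx.contPos.slice ht0
    have a5 := D.sol.sm_vort.contPos.slice ht0
    have a6 := D.sol.sm_T.dx.dx.contPos.slice ht0
    have a7 := D.sol.sm_T.dx.dz.contPos.slice ht0
    have a8 := D.sol.sm_vort.dx.contPos.slice ht0
    have a9 := D.sol.sm_vort.dz.contPos.slice ht0
    have hBt : ∀ x z, |w x z t| ≤ B := fun x z => hB x z t ⟨ht0.le, ht.2⟩
    have habs : ∀ s : ℝ, |s ^ 2| ≤ s ^ 2 := fun s => (abs_of_nonneg (sq_nonneg s)).le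
    have hBm : ∀ x z (s : ℝ), |w x z t * s ^ 2| ≤ B * s ^ 2 := fun x z s => by
      rw [abs_mul, abs_of_nonneg (sq_nonneg s)]
      exact mul_le_mul_of_nonneg_right (hBt x z) (sq_nonneg s)
    have r1 := (abs_le.1 (abs_cutInt_le_of_abs_le (F := fun x z => dx T x z t ^ 2) hC2
      (by fun_prop) i1 (fun x z => habs _) j1)).2
    have r2 := (abs_le.1 (abs_cutInt_le_of_abs_le (F := fun x z => w x z t * dx T x z t ^ 2)
      (G := fun x z => B * dx T x z t ^ 2) (K := B * K₁) hC1
      (by fun_prop) (i1.const_mul B) (fun x z => hBm x z _)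
      (by rw [integral_const_mul]; exact mul_le_mul_of_nonneg_left j1 hB0))).2
    have r3 := (abs_le.1 (abs_cutInt_le_of_abs_le
      (F := fun x z => T x z t * (dx T x z t * dx w x z t))
      (G := fun x z => dx T x z t ^ 2 + dx w x z t ^ 2) (K := K₁ + K₃) hC1
      (by fun_prop) (i1.add i3) (fun x z => by
        obtain ⟨hT0, hT1⟩ := D.T_mem x z t ht0.le
        rw [abs_mul, abs_of_nonneg hT0]
        refine (mul_le_of_le_one_left (abs_nonneg _) hT1).trans ?_
        rw [abs_le]
        constructor <;> nlinarith [sq_nonneg (dx T x z t + dx w x z t),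
          sq_nonneg (dx T x z t - dx w x z t), sq_nonneg (dx T x z t), sq_nonneg (dx w x z t)])
      (by rw [integral_add i1 i3]; linarith))).2
    have r4 := (abs_le.1 (abs_cutInt_le_of_abs_le (F := fun x z => dx w x z t ^ 2) hC2
      (by fun_prop) i3 (fun x z => habs _) j3)).2
    have r5 := (abs_le.1 (abs_cutInt_le_of_abs_le (F := fun x z => vort u w x z t ^ 2) hC2
      (by fun_prop) i2 (fun x z => habs _) j2)).2
    have r6 := (abs_le.1 (abs_cutInt_le_of_abs_le (F := fun x z => w x z t * vort u w x z t ^ 2)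
      (G := fun x z => B * vort u w x z t ^ 2) (K := B * K₂) hC1
      (by fun_prop) (i2.const_mul B) (fun x z => hBm x z _)
      (by rw [integral_const_mul]; exact mul_le_mul_of_nonneg_left j2 hB0))).2
    have hmain := D.energy_rate ht0 hcut (cut_nonneg n)
    have hsplit : cutInt L (cut n) (fun x z => dDens u w T x z t)
        = cutInt L (cut n) (fun x z => dx (dx T) x z t ^ 2 + dz (dx T) x z t ^ 2)
          + cutInt L (cut n) (fun x z => dx (vort u w) x z t ^ 2 + dz (vort u w) x z t ^ 2) := by
      unfold dDens
      exact cutInt_add hcut.cont hcut.supp (by fun_prop) (by fun_prop)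
    have X0 : 0 ≤ cutInt L (cut n) (fun x z => dx (dx T) x z t ^ 2 + dz (dx T) x z t ^ 2) :=
      cutInt_nonneg (cut_nonneg n) fun x z => by positivity
    have Y0 : 0 ≤ cutInt L (cut n)
        (fun x z => dx (vort u w) x z t ^ 2 + dz (vort u w) x z t ^ 2) :=
      cutInt_nonneg (cut_nonneg n) fun x z => by positivity
    have x1 := mul_le_mul_of_nonneg_right (min_le_left (1 / 4) (1 / (2 * (ρ * L)))) X0
    have y1 := mul_le_mul_of_nonneg_right (min_le_right (1 / 4) (1 / (2 * (ρ * L)))) Y0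
    have hRn : R / (n + 1) = 1 / 2 * (C / (n + 1) * K₁) + 1 / 2 * (C / (n + 1) * (B * K₁))
        + C / (n + 1) * (K₁ + K₃) + L ^ 2 * (C / (n + 1) * K₃)
        + 1 / (2 * (ρ * L)) * (C / (n + 1) * K₂)
        + 1 / (2 * (σ * ρ * L)) * (C / (n + 1) * (B * K₂)) := by
      rw [hR]; ring
    rw [hsplit, hRn, dissCoeff]
    have r4' := mul_le_mul_of_nonneg_left r4 (sq_nonneg L)
    have r5' := mul_le_mul_of_nonneg_left r5 hρL.le
    have r6' := mul_le_mul_of_nonneg_left r6 hκ.le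
    simp only [het]
    linarith
  have hFTC := cutInt_sub_eq_integral (L := L) hcut.cont hcut.supp D.contPos_eDens het_cont hderiv
    ha hab
  have ii := intervalIntegrable_cutInt (L := L) hcut.cont hcut.supp het_cont ha hab
  have hd := intervalIntegrable_cutInt (L := L) hcut.cont hcut.supp D.contPos_dDens ha hab
  have hdn : IntervalIntegrable
      (fun t => -(dissCoeff ρ L * cutInt L (cut n) (fun x z => dDens u w T x z t))) volume a b :=
    (hd.const_mul (dissCoeff ρ L)).neg
  have hint := intervalIntegral.integral_mono_on
    (g := fun t => -(dissCoeff ρ L * cutInt L (cut n) (fun x z => dDens u w T x z t))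
      + R / (n + 1)) hab ii
    (hdn.add (intervalIntegrable_const (c := R / (n + 1)))) hrate
  rw [← hFTC] at hint
  have e : ∫ t in a..b, (-(dissCoeff ρ L * cutInt L (cut n) (fun x z => dDens u w T x z t))
        + R / ((n : ℝ) + 1))
      = -(dissCoeff ρ L * ∫ t in a..b, cutInt L (cut n) (fun x z => dDens u w T x z t))
        + (b - a) * (R / (n + 1)) := by
    rw [intervalIntegral.integral_add hdn intervalIntegrable_const,
      intervalIntegral.integral_neg, intervalIntegral.integral_const_mul,
      intervalIntegral.integral_const, smul_eq_mul]
  rw [e] at hint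
  have e2 : R * (b - a) / (n + 1) = (b - a) * (R / (n + 1)) := by ring
  rw [e2]
  linarith

/-- The total dissipation is controlled by the loss of energy. -/
theorem integral_dDens_le (D : SmallData f m σ ρ L u w T) (ha : 0 < a) (hab : a ≤ b) (n : ℕ) :
    ∫ t in a..b, cutInt L (cut n) (fun x z => dDens u w T x z t)
      ≤ (energy σ ρ L u w T a - energy σ ρ L u w T b) / dissCoeff ρ L := by
  obtain ⟨C, hC⟩ := D.cutInt_energy_le ha hab
  have hc := D.dissCoeff_pos
  have ta := tendsto_cutInt (F := fun x z => eDens σ ρ L u w T x z a) (D.integrable_eDens ha)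
  have tb := tendsto_cutInt (F := fun x z => eDens σ ρ L u w T x z b)
    (D.integrable_eDens (ha.trans_le hab))
  refine integral_cutInt_le_of_error D.contPos_dDens (fun x z t _ => dDens_nonneg u w T x z t) ha hab
    (e := fun n => (cutInt L (cut n) (fun x z => eDens σ ρ L u w T x z a) - energy σ ρ L u w T a
      - (cutInt L (cut n) (fun x z => eDens σ ρ L u w T x z b) - energy σ ρ L u w T b)
      + C / (n + 1)) / dissCoeff ρ L) ?_ (fun n => ?_) n
  · have := (((ta.sub_const (energy σ ρ L u w T a)).sub
      (tb.sub_const (energy σ ρ L u w T b))).add (tendsto_div_nat C)).div_const (dissCoeff ρ L)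
    simpa [energy] using this
  · rw [← add_div, le_div_iff₀ hc]
    have := hC n
    linarith

theorem energy_antitone (D : SmallData f m σ ρ L u w T) (ha : 0 < a) (hab : a ≤ b) :
    energy σ ρ L u w T b ≤ energy σ ρ L u w T a := by
  have h1 := D.integral_dDens_le ha hab 0
  have h2 : 0 ≤ ∫ t in a..b, cutInt L (cut 0) (fun x z => dDens u w T x z t) :=
    intervalIntegral.integral_nonneg hab fun t _ => cutInt_nonneg (cut_nonneg 0)
      fun x z => dDens_nonneg u w T x z t
  have h3 := mul_nonneg (h2.trans h1) D.dissCoeff_pos.le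
  rw [div_mul_cancel₀ _ D.dissCoeff_pos.ne'] at h3
  linarith

theorem integral_hDens_le (D : SmallData f m σ ρ L u w T) (ha : 0 < a) (hab : a ≤ b) (n : ℕ) :
    ∫ t in a..b, cutInt L (cut n) (fun x z => hDens w x z t)
      ≤ (energy σ ρ L u w T a - energy σ ρ L u w T b) / dissCoeff ρ L := by
  obtain ⟨K, k0, hK⟩ := D.sol.L2_dx_w.exists_bound D.sol.sm_w.dx.contPos (b := b) ha
  obtain ⟨C, hC0, hC⟩ := exists_cut_bound
  refine integral_cutInt_le_of_error D.contPos_hDens (fun x z t _ => hDens_nonneg w x z t) ha hab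
    (e := fun n => C * K * (b - a) / (n + 1)) (tendsto_div_nat _) (fun n => ?_) n
  have hcut := isCutoff_cut n
  have hd := intervalIntegrable_cutInt (L := L) hcut.cont hcut.supp D.contPos_dDens ha hab
  have ih := intervalIntegrable_cutInt (L := L) hcut.cont hcut.supp D.contPos_hDens ha hab
  have hle : ∀ t ∈ Icc a b, cutInt L (cut n) (fun x z => hDens w x z t)
      ≤ cutInt L (cut n) (fun x z => dDens u w T x z t) + C / (n + 1) * K := by
    intro t ht
    have ht0 : 0 < t := ha.trans_le ht.1
    obtain ⟨i, j⟩ := hK t ht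
    have a4 := D.sol.sm_w.dx.contPos.slice ht0
    have a8 := D.sol.sm_vort.dx.contPos.slice ht0
    have r := (abs_le.1 (abs_cutInt_le_of_abs_le (F := fun x z => dx w x z t ^ 2) (hC n).2.1
      (by fun_prop) i (fun x z => (abs_of_nonneg (sq_nonneg _)).le) j)).2
    have hm : cutInt L (cut n) (fun x z => dx (vort u w) x z t ^ 2)
        ≤ cutInt L (cut n) (fun x z => dDens u w T x z t) :=
      cutInt_mono hcut.cont hcut.supp (cut_nonneg n) (by fun_prop) (D.contPos_dDens.slice ht0)
        fun x z => by
          unfold dDens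
          nlinarith [sq_nonneg (dz (vort u w) x z t), sq_nonneg (dx (dx T) x z t),
            sq_nonneg (dz (dx T) x z t)]
    have := D.cutInt_hessian_w ht0 hcut
    unfold hDens
    linarith
  have h1 := intervalIntegral.integral_mono_on
    (g := fun t => cutInt L (cut n) (fun x z => dDens u w T x z t) + C / (n + 1) * K) hab ih (hd.add intervalIntegrable_const) hle
  have e : ∫ t in a..b, (cutInt L (cut n) (fun x z => dDens u w T x z t)
        + C / ((n : ℝ) + 1) * K)
      = (∫ t in a..b, cutInt L (cut n) (fun x z => dDens u w T x z t))
        + (b - a) * (C / (n + 1) * K) := by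
    rw [intervalIntegral.integral_add hd intervalIntegrable_const,
      intervalIntegral.integral_const, smul_eq_mul]
  rw [e] at h1
  have h2 := D.integral_dDens_le ha hab n
  have e2 : C * K * (b - a) / ((n : ℝ) + 1) = (b - a) * (C / (n + 1) * K) := by ring
  rw [e2]
  linarith

end SmallData

/-! ### The mean horizontal flow -/

theorem ContPos.mean {g : ℝ → ℝ → ℝ → ℝ} (hg : ContPos g) (L : ℝ) :
    ContPos (fun _ z t => ∫ y in (0 : ℝ)..L, g y z t) := by
  intro p hp
  have hp2 : 0 < p.2.2 / 2 := half_pos hp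
  have h1 : Continuous fun q : ℝ × ℝ × ℝ => ∫ y in (0 : ℝ)..L, g y q.2.1 (max q.2.2 (p.2.2 / 2)) := by
    refine intervalIntegral.continuous_parametric_intervalIntegral_of_continuous'
      (f := fun (q : ℝ × ℝ × ℝ) y => g y q.2.1 (max q.2.2 (p.2.2 / 2))) ?_ 0 L
    exact (hg.shift hp2).comp (by fun_prop : Continuous fun r : (ℝ × ℝ × ℝ) × ℝ =>
      ((r.1.2.2, r.2, r.1.2.1) : ℝ × ℝ × ℝ))
  refine (h1.continuousAt.congr ?_).continuousWithinAt
  have ht' : p.2.2 / 2 < p.2.2 := half_lt_self hp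
  have hc : Tendsto (fun q : ℝ × ℝ × ℝ => q.2.2) (𝓝 p) (𝓝 p.2.2) :=
    (by fun_prop : Continuous fun q : ℝ × ℝ × ℝ => q.2.2).tendsto p
  filter_upwards [hc.eventually (lt_mem_nhds ht')] with q hq
  rw [max_eq_left hq.le]

namespace HasGrad
variable {L : ℝ} {g gx gz : ℝ → ℝ → ℝ}

theorem ii (hg : HasGrad L g gx gz) (z a b : ℝ) :
    IntervalIntegrable (fun x => g x z) volume a b :=
  (hg.cont.comp (by fun_prop : Continuous fun x : ℝ => (x, z))).intervalIntegrable _ _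

theorem ii_x (hg : HasGrad L g gx gz) (z a b : ℝ) :
    IntervalIntegrable (fun x => gx x z) volume a b :=
  (hg.cont_x.comp (by fun_prop : Continuous fun x : ℝ => (x, z))).intervalIntegrable _ _

theorem ii_z (hg : HasGrad L g gx gz) (z a b : ℝ) :
    IntervalIntegrable (fun x => gz x z) volume a b :=
  (hg.cont_z.comp (by fun_prop : Continuous fun x : ℝ => (x, z))).intervalIntegrable _ _

end HasGrad

theorem hasGrad_of_z {L : ℝ} {g g' : ℝ → ℝ} (hg : ∀ z, HasDerivAt g (g' z) z)
    (hc : Continuous g') : HasGrad L (fun _ z => g z) (fun _ _ => 0) (fun _ z => g' z) where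
  cont := (continuous_iff_continuousAt.2 fun z => (hg z).continuousAt).comp continuous_snd
  cont_x := continuous_const
  cont_z := hc.comp continuous_snd
  hx x _ := hasDerivAt_const x _
  hz _ z := hg z
  per _ _ := rfl

theorem integral_cell_of_z {L : ℝ} (hL : 0 ≤ L) {g : ℝ → ℝ} (hg : Integrable g) :
    Integrable (fun p : ℝ × ℝ => g p.2) (cell L) ∧
      ∫ p : ℝ × ℝ, g p.2 ∂(cell L) = L * ∫ z, g z := by
  have h : Integrable (fun p : ℝ × ℝ => g p.2) (cell L) := by
    rw [cell_eq_prod]; exact hg.comp_snd _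
  refine ⟨h, ?_⟩
  rw [integral_cell_eq hL h]
  simp [integral_const_mul]

theorem intervalIntegral_le_integral_of_nonneg {g : ℝ → ℝ} (hg : Integrable g) (h0 : ∀ z, 0 ≤ g z)
    {a b : ℝ} (hab : a ≤ b) : ∫ z in a..b, g z ≤ ∫ z, g z := by
  rw [intervalIntegral.integral_of_le hab]
  exact setIntegral_le_integral hg (Eventually.of_forall h0)

/-- A nonnegative integrable function on the line is bounded by the integral of the absolute
value of its derivative. -/
theorem le_integral_abs_deriv {g g' : ℝ → ℝ} (hg : ∀ z, HasDerivAt g (g' z) z)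
    (hc : Continuous g') (hi : Integrable g) (hi' : Integrable g') (z : ℝ) :
    g z ≤ ∫ y, |g' y| := by
  by_contra! hlt
  set δ := g z - ∫ y, |g' y| with hδ
  have hδ0 : 0 < δ := sub_pos.2 hlt
  have hge : ∀ y, δ ≤ g y := by
    intro y
    have h1 : g z - g y = ∫ s in y..z, g' s :=
      (intervalIntegral.integral_eq_sub_of_hasDerivAt (fun s _ => hg s)
        (hc.intervalIntegrable _ _)).symm
    have h2 : |∫ s in y..z, g' s| ≤ ∫ s, |g' s| := by
      rw [← Real.norm_eq_abs]
      refine (intervalIntegral.norm_integral_le_integral_norm_uIoc (f := g') (a := y) (b := z)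
        (μ := volume)).trans ?_
      exact setIntegral_le_integral hi'.abs (Eventually.of_forall fun _ => abs_nonneg _)
    rw [← h1] at h2
    linarith [(abs_le.1 h2).2]
  -- a positive lower bound contradicts integrability on the line
  have hconst : Integrable (fun _ : ℝ => δ) := by
    refine hi.mono' aestronglyMeasurable_const (Eventually.of_forall fun y => ?_)
    rw [Real.norm_eq_abs, abs_of_pos hδ0]; exact hge y
  rw [integrable_const_iff] at hconst
  rcases hconst with h | h
  · exact hδ0.ne' h
  · simpa using h.measure_univ_lt_top

namespace IsSolution
variable {f : ℝ → ℝ} {σ ρ L : ℝ} {u w T : ℝ → ℝ → ℝ → ℝ} {t : ℝ}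

/-- The vertical flux is independent of `z` by incompressibility and tends to zero at infinity. -/
theorem integral_w_eq_zero (h : IsSolution f σ ρ L u w T) (hL : 0 < L) (ht : 0 < t) (z : ℝ) :
    ∫ x in (0 : ℝ)..L, w x z t = 0 := by
  have hw := h.sm_w.hasGrad h.per_w ht
  have hu := h.sm_u.hasGrad h.per_u ht
  have hd : ∀ z, HasDerivAt (fun z => ∫ x in (0 : ℝ)..L, w x z t) 0 z := fun z => by
    refine (hw.hasDerivAt_integral hL.le z).congr_deriv ?_
    have : ∀ x, dz w x z t = -dx u x z t := fun x => by rw [h.dx_u ht, neg_neg]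
    simp only [this, intervalIntegral.integral_neg, hu.integral_x_eq_zero, neg_zero]
  have hconst : ∀ y, ∫ x in (0 : ℝ)..L, w x y t = ∫ x in (0 : ℝ)..L, w x z t := fun y =>
    is_const_of_deriv_eq_zero (fun z => (hd z).differentiableAt) (fun z => (hd z).deriv) y z
  by_contra hne
  have hpos : 0 < |∫ x in (0 : ℝ)..L, w x z t| / L := div_pos (abs_pos.2 hne) hL
  obtain ⟨y, hy⟩ := ((limitsTo_cocompact h.w_infty).2.exists_far t (half_pos hpos)).exists
  have h1 : |∫ x in (0 : ℝ)..L, w x y t| ≤ |∫ x in (0 : ℝ)..L, w x z t| / L / 2 * |L - 0| := by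
    rw [← Real.norm_eq_abs]
    refine intervalIntegral.norm_integral_le_of_norm_le_const fun x _ => ?_
    have := hy x t ⟨ht.le, le_rfl⟩
    rw [sub_zero] at this
    exact this.le
  rw [hconst y, sub_zero, abs_of_pos hL] at h1
  have h2 : |∫ x in (0 : ℝ)..L, w x z t| / L / 2 * L = |∫ x in (0 : ℝ)..L, w x z t| / 2 := by
    field_simp
  rw [h2] at h1
  linarith [abs_pos.2 hne]

/-- The horizontal mean of `u_z` is minus that of the vorticity. -/
theorem integral_dz_u (h : IsSolution f σ ρ L u w T) (ht : 0 < t) (z : ℝ) :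
    ∫ x in (0 : ℝ)..L, vort u w x z t = -∫ x in (0 : ℝ)..L, dz u x z t := by
  have hw := h.sm_w.hasGrad h.per_w ht
  have hu := h.sm_u.hasGrad h.per_u ht
  simp only [vort]
  rw [intervalIntegral.integral_sub (hw.ii_x _ _ _) (hu.ii_z _ _ _), hw.integral_x_eq_zero, zero_sub]

/-- The residual of the equation for the mean horizontal flow does not depend on `z`. -/
theorem hasDerivAt_residual (h : IsSolution f σ ρ L u w T) (hL : 0 < L) (ht : 0 < t) (z : ℝ) :
    HasDerivAt (fun z => (∫ x in (0 : ℝ)..L, dt u x z t)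
      - (∫ x in (0 : ℝ)..L, w x z t * vort u w x z t)
      - σ * ∫ x in (0 : ℝ)..L, dz (dz u) x z t) 0 z := by
  have hT := h.sm_T.hasGrad h.per_T ht
  have hu := h.sm_u.hasGrad h.per_u ht
  have hw := h.sm_w.hasGrad h.per_w ht
  have hut := h.sm_u.dt.hasGrad h.per_u.dt ht
  have hwt := h.sm_w.dt.hasGrad h.per_w.dt ht
  have huzz := h.sm_u.dz.dz.hasGrad h.per_u.dz.dz ht
  have hwzz := h.sm_w.dz.dz.hasGrad h.per_w.dz.dz ht
  have hω := h.sm_vort.hasGrad h.per_vort ht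
  have hωx := h.sm_vort.dx.hasGrad h.per_vort.dx ht
  have hX := (((hwt.sub (hωx.const_mul σ)).sub (hwzz.const_mul σ)).add (hu.mul hω)).sub
    (hT.const_mul (σ * ρ))
  have key := hX.integral_x_eq_zero z
  refine (((hut.hasDerivAt_integral hL.le z).sub ((hw.mul hω).hasDerivAt_integral hL.le z)).sub
    ((huzz.hasDerivAt_integral hL.le z).const_mul σ)).congr_deriv ?_
  have i1 : IntervalIntegrable (fun x => dz (dt u) x z t) volume 0 L :=
    hut.ii_z _ _ _
  have i2 : IntervalIntegrable (fun x => dz w x z t * vort u w x z t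
      + w x z t * dz (vort u w) x z t) volume 0 L :=
    (hw.mul hω).ii_z _ _ _
  have i3 : IntervalIntegrable (fun x => σ * dz (dz (dz u)) x z t) volume 0 L :=
    (huzz.const_mul σ).ii_z _ _ _
  rw [← intervalIntegral.integral_const_mul, ← intervalIntegral.integral_sub i1 i2,
    ← intervalIntegral.integral_sub (i1.sub i2) i3]
  refine Eq.trans (intervalIntegral.integral_congr fun x _ => ?_) key
  -- the integrand is an `x`-derivative
  have e1 : dz (dt u) x z t = dx (dt w) x z t - dt (vort u w) x z t := by
    rw [(h.sm_u.mono (by norm_num)).dz_dt_comm ht, (h.sm_w.mono (by norm_num)).dx_dt_comm ht]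
    have e := (h.sm_w.dx.hasDerivAt_t (x := x) (z := z) ht).sub
      (h.sm_u.dz.hasDerivAt_t (x := x) (z := z) ht)
    have e' : dt (vort u w) x z t = dt (dx w) x z t - dt (dz u) x z t := e.deriv
    rw [e']; ring
  have e2 : dz (dz (vort u w)) x z t = dx (dz (dz w)) x z t - dz (dz (dz u)) x z t := by
    have a1 : ∀ y, dz (vort u w) x y t = dz (dx w) x y t - dz (dz u) x y t := fun y =>
      ((h.sm_w.dx.hasDerivAt_z (x := x) (z := y) ht).sub
        (h.sm_u.dz.hasDerivAt_z (x := x) (z := y) ht)).deriv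
    have a2 : dz (dz (vort u w)) x z t = dz (dz (dx w)) x z t - dz (dz (dz u)) x z t :=
      (congrArg (fun k => deriv k z) (funext a1)).trans
        ((h.sm_w.dx.dz.hasDerivAt_z (x := x) (z := z) ht).sub
          (h.sm_u.dz.dz.hasDerivAt_z (x := x) (z := z) ht)).deriv
    rw [a2, h.sm_w.dz.dx_dz_comm ht]
    congr 1
    exact congrArg (fun k => deriv k z)
      (funext fun y => ((h.sm_w.mono (by norm_num)).dx_dz_comm ht).symm)
  rw [e1, h.dt_vort ht, e2]
  linear_combination (-vort u w x z t) * h.div_free x z t ht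

/-- The mean horizontal flow solves a heat equation forced by the vorticity flux: the mean
pressure gradient vanishes because `u_t` and `w ω` are square integrable. -/
theorem integral_dt_u (h : IsSolution f σ ρ L u w T) (hL : 0 < L) (ht : 0 < t)
    (hω2 : Integrable (fun p : ℝ × ℝ => vort u w p.1 p.2 t ^ 2) (cell L)) (z : ℝ) :
    ∫ x in (0 : ℝ)..L, dt u x z t = (∫ x in (0 : ℝ)..L, w x z t * vort u w x z t)
      + σ * ∫ x in (0 : ℝ)..L, dz (dz u) x z t := by
  set F : ℝ → ℝ := fun z => (∫ x in (0 : ℝ)..L, dt u x z t)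
      - (∫ x in (0 : ℝ)..L, w x z t * vort u w x z t)
      - σ * ∫ x in (0 : ℝ)..L, dz (dz u) x z t with hF
  have hu := h.sm_u.hasGrad h.per_u ht
  have huz := h.sm_u.dz.hasGrad h.per_u.dz ht
  have huzz := h.sm_u.dz.dz.hasGrad h.per_u.dz.dz ht
  have hut := h.sm_u.dt.hasGrad h.per_u.dt ht
  have hw := h.sm_w.hasGrad h.per_w ht
  have hω := h.sm_vort.hasGrad h.per_vort ht
  set c := F z with hc
  have hFc : ∀ y, F y = c := fun y => is_const_of_deriv_eq_zero
    (fun z => (h.hasDerivAt_residual hL ht z).differentiableAt)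
    (fun z => (h.hasDerivAt_residual hL ht z).deriv) y z
  suffices hc0 : c = 0 by
    have : F z = 0 := hc0
    simp only [hF] at this
    linarith
  obtain ⟨B, hB0, hB⟩ := h.exists_bound_w hL t
  obtain ⟨K, hK0, hK⟩ := h.L2_dt_u.exists_bound h.sm_u.dt.contPos (b := t) ht
  have hut2 := (hK t ⟨le_rfl, le_rfl⟩).1
  -- the square integrable part of the residual
  set k : ℝ → ℝ → ℝ := fun x z => dt u x z t - w x z t * vort u w x z t with hk
  have hkG := hut.sub (hw.mul hω)
  have hkc : Continuous fun p : ℝ × ℝ => k p.1 p.2 := hkG.cont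
  have hk2 : Integrable (fun p : ℝ × ℝ => k p.1 p.2 ^ 2) (cell L) := by
    refine ((hut2.add (hω2.const_mul (B ^ 2))).const_mul 2).mono' (hkc.pow 2).aestronglyMeasurable
      (Eventually.of_forall fun p => ?_)
    rw [Real.norm_eq_abs, abs_of_nonneg (sq_nonneg _)]
    have hw2 : (w p.1 p.2 t * vort u w p.1 p.2 t) ^ 2 ≤ B ^ 2 * vort u w p.1 p.2 t ^ 2 := by
      rw [mul_pow]
      exact mul_le_mul_of_nonneg_right
        (sq_le_sq' (abs_le.1 (hB p.1 p.2 t ⟨ht.le, le_rfl⟩)).1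
          (abs_le.1 (hB p.1 p.2 t ⟨ht.le, le_rfl⟩)).2) (sq_nonneg _)
    simp only [hk, Pi.add_apply]
    nlinarith [sq_nonneg (dt u p.1 p.2 t + w p.1 p.2 t * vort u w p.1 p.2 t)]
  set I := ∫ z, ∫ x in (0 : ℝ)..L, k x z ^ 2 with hI
  have hki := integrable_slice hL.le hk2
  have hI0 : 0 ≤ I := integral_nonneg fun z =>
    intervalIntegral.integral_nonneg hL.le fun x _ => sq_nonneg _
  have hcs : ∀ z : ℝ, Continuous fun x : ℝ => (x, z) := fun z => by fun_prop
  set m : ℝ → ℝ := fun z => ∫ x in (0 : ℝ)..L, k x z with hm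
  have hmc : Continuous m := continuous_iff_continuousAt.2 fun z =>
    (hkG.hasDerivAt_integral hL.le z).continuousAt
  have hm2 : ∀ z, m z ^ 2 ≤ L * ∫ x in (0 : ℝ)..L, k x z ^ 2 := fun z => by
    simpa using sq_integral_le hL.le (hkc.comp (hcs z))
  set q : ℝ → ℝ := fun z => ∫ x in (0 : ℝ)..L, dz u x z t with hq
  have hqd : ∀ z, HasDerivAt q (∫ x in (0 : ℝ)..L, dz (dz u) x z t) z :=
    huz.hasDerivAt_integral hL.le
  have hqc : Continuous fun z => ∫ x in (0 : ℝ)..L, dz (dz u) x z t :=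
    continuous_iff_continuousAt.2 fun z => (huzz.hasDerivAt_integral hL.le z).continuousAt
  have hFm : ∀ z, c = m z - σ * ∫ x in (0 : ℝ)..L, dz (dz u) x z t := fun z => by
    rw [← hFc z]
    simp only [hF, hm, hk]
    rw [intervalIntegral.integral_sub (hut.ii _ _ _) ((hw.mul hω).ii _ _ _)]
  have hqfar : ∀ᶠ N in atTop, |q N| ≤ L := by
    have h1 := (Metric.tendstoUniformly_iff.1 (h.vort_infty t ht) 1 one_pos).filter_mono
      (atTop_le_cocompact (α := ℝ))
    filter_upwards [h1] with N hN
    have h2 : |∫ x in (0 : ℝ)..L, vort u w x N t| ≤ 1 * |L - 0| := by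
      rw [← Real.norm_eq_abs]
      refine intervalIntegral.norm_integral_le_of_norm_le_const fun x _ => ?_
      have := hN x
      rw [dist_comm, Real.dist_eq, sub_zero] at this
      exact this.le
    rw [h.integral_dz_u ht, abs_neg, sub_zero, abs_of_pos hL, one_mul] at h2
    exact h2
  set M := |σ| * (L + |q 0|) with hM
  have hN : ∀ᶠ N : ℝ in atTop, c ^ 2 ≤ 2 * (L * I) / N + 2 * M ^ 2 / N ^ 2 := by
    filter_upwards [hqfar, eventually_gt_atTop 0] with N hqN hN0
    have e1 : c * N = (∫ z in (0 : ℝ)..N, m z) - σ * (q N - q 0) := by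
      rw [← intervalIntegral.integral_eq_sub_of_hasDerivAt (fun z _ => hqd z)
        (hqc.intervalIntegrable _ _), ← intervalIntegral.integral_const_mul,
        ← intervalIntegral.integral_sub (hmc.intervalIntegrable _ _)
          ((hqc.const_mul σ).intervalIntegrable _ _), ← intervalIntegral.integral_congr
          (f := fun _ => c) (fun z _ => hFm z), intervalIntegral.integral_const, smul_eq_mul]
      ring
    have e2 : (∫ z in (0 : ℝ)..N, m z) ^ 2 ≤ N * (L * I) := by
      have h1 := sq_integral_le hN0.le hmc
      rw [sub_zero] at h1
      refine h1.trans (mul_le_mul_of_nonneg_left ?_ hN0.le)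
      calc ∫ z in (0 : ℝ)..N, m z ^ 2
          ≤ ∫ z in (0 : ℝ)..N, L * ∫ x in (0 : ℝ)..L, k x z ^ 2 :=
            intervalIntegral.integral_mono_on hN0.le ((hmc.pow 2).intervalIntegrable _ _)
              ((hki.const_mul L).intervalIntegrable) fun z _ => hm2 z
        _ = L * ∫ z in (0 : ℝ)..N, ∫ x in (0 : ℝ)..L, k x z ^ 2 :=
            intervalIntegral.integral_const_mul _ _
        _ ≤ L * I := mul_le_mul_of_nonneg_left (intervalIntegral_le_integral_of_nonneg hki
            (fun z => intervalIntegral.integral_nonneg hL.le fun x _ => sq_nonneg _) hN0.le) hL.le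
    have e3 : (σ * (q N - q 0)) ^ 2 ≤ M ^ 2 := by
      rw [← sq_abs, abs_mul]
      refine pow_le_pow_left₀ (by positivity) ?_ 2
      refine mul_le_mul_of_nonneg_left ?_ (abs_nonneg _)
      exact (abs_sub _ _).trans (by linarith)
    have e4 : (c * N) ^ 2 ≤ 2 * (N * (L * I)) + 2 * M ^ 2 := by
      rw [e1]
      nlinarith [sq_nonneg ((∫ z in (0 : ℝ)..N, m z) + σ * (q N - q 0))]
    have e5 : 2 * (L * I) / N + 2 * M ^ 2 / N ^ 2 = (2 * (N * (L * I)) + 2 * M ^ 2) / N ^ 2 := by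
      field_simp
    rw [e5, le_div_iff₀ (by positivity)]
    linarith [mul_pow c N 2]
  have hlim : Tendsto (fun N : ℝ => 2 * (L * I) / N + 2 * M ^ 2 / N ^ 2) atTop (𝓝 0) := by
    have h1 : Tendsto (fun N : ℝ => 2 * (L * I) / N) atTop (𝓝 0) :=
      tendsto_const_nhds.div_atTop tendsto_id
    have h2 : Tendsto (fun N : ℝ => 2 * M ^ 2 / N ^ 2) atTop (𝓝 0) :=
      tendsto_const_nhds.div_atTop (tendsto_pow_atTop two_ne_zero)
    simpa using h1.add h2
  have h0 := ge_of_tendsto hlim hN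
  exact pow_eq_zero_iff two_ne_zero |>.1 (le_antisymm h0 (sq_nonneg c))

end IsSolution

/-! ### Relaxation of the vorticity and of `T_x` -/

/-- Cauchy-Schwarz on each slice. -/
theorem integral_sq_mean_le {L : ℝ} (hL : 0 ≤ L) {g gx gz : ℝ → ℝ → ℝ} (hg : HasGrad L g gx gz)
    (hi : Integrable (fun p : ℝ × ℝ => g p.1 p.2 ^ 2) (cell L)) :
    Integrable (fun z => (∫ x in (0 : ℝ)..L, g x z) ^ 2) ∧
      ∫ z, (∫ x in (0 : ℝ)..L, g x z) ^ 2 ≤ L * ∫ p : ℝ × ℝ, g p.1 p.2 ^ 2 ∂(cell L) := by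
  have hc : Continuous fun z => ∫ x in (0 : ℝ)..L, g x z := continuous_iff_continuousAt.2 fun z =>
    (hg.hasDerivAt_integral hL z).continuousAt
  have hs := (integrable_slice hL hi).const_mul L
  have hle : ∀ z, (∫ x in (0 : ℝ)..L, g x z) ^ 2 ≤ L * ∫ x in (0 : ℝ)..L, g x z ^ 2 := fun z => by
    simpa using sq_integral_le hL
      (hg.cont.comp (by fun_prop : Continuous fun x : ℝ => (x, z)))
  have hint : Integrable (fun z => (∫ x in (0 : ℝ)..L, g x z) ^ 2) := by
    refine hs.mono' (hc.pow 2).aestronglyMeasurable (Eventually.of_forall fun z => ?_)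
    rw [Real.norm_eq_abs, abs_of_nonneg (sq_nonneg _)]
    exact hle z
  refine ⟨hint, (integral_mono hint hs hle).trans ?_⟩
  rw [integral_const_mul, integral_cell_eq hL hi]

/-- The horizontal integral of `u`. -/
def meanU (L : ℝ) (u : ℝ → ℝ → ℝ → ℝ) (z t : ℝ) : ℝ := ∫ x in (0 : ℝ)..L, u x z t

/-- The squared `L²(D)` norm of the horizontal integral of `u`. -/
def meanEnergy (L : ℝ) (u : ℝ → ℝ → ℝ → ℝ) (t : ℝ) : ℝ :=
  ∫ p : ℝ × ℝ, meanU L u p.2 t ^ 2 ∂(cell L)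

namespace SmallData
variable {f : ℝ → ℝ} {m σ ρ L : ℝ} {u w T : ℝ → ℝ → ℝ → ℝ} {a b t : ℝ} {η η' η'' : ℝ → ℝ}

theorem integrable_vort_sq (D : SmallData f m σ ρ L u w T) (ht : 0 < t) :
    Integrable (fun p : ℝ × ℝ => vort u w p.1 p.2 t ^ 2) (cell L) := by
  obtain ⟨K, -, hK⟩ := D.exists_bound_vort (b := t) ht
  exact (hK t ⟨le_rfl, le_rfl⟩).1

theorem integrable_dx_T_sq (D : SmallData f m σ ρ L u w T) (ht : 0 < t) :
    Integrable (fun p : ℝ × ℝ => dx T p.1 p.2 t ^ 2) (cell L) := by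
  obtain ⟨K, -, hK⟩ := D.sol.L2_dx_T.exists_bound D.sol.sm_T.dx.contPos (b := t) ht
  exact (hK t ⟨le_rfl, le_rfl⟩).1

theorem integral_sq_le_energy (D : SmallData f m σ ρ L u w T) (ht : 0 < t) :
    (∫ p : ℝ × ℝ, dx T p.1 p.2 t ^ 2 ∂(cell L)) ≤ 2 * energy σ ρ L u w T t ∧
      (∫ p : ℝ × ℝ, vort u w p.1 p.2 t ^ 2 ∂(cell L))
        ≤ 2 * (σ * ρ * L) * energy σ ρ L u w T t := by
  have hκ := D.κ_pos
  have i1 := D.integrable_dx_T_sq ht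
  have i2 := D.integrable_vort_sq ht
  have e : energy σ ρ L u w T t = 1 / 2 * (∫ p : ℝ × ℝ, dx T p.1 p.2 t ^ 2 ∂(cell L))
      + 1 / (2 * (σ * ρ * L)) * ∫ p : ℝ × ℝ, vort u w p.1 p.2 t ^ 2 ∂(cell L) := by
    unfold energy eDens
    rw [integral_add (i1.const_mul _) (i2.const_mul _), integral_const_mul, integral_const_mul]
  have h1 : 0 ≤ ∫ p : ℝ × ℝ, dx T p.1 p.2 t ^ 2 ∂(cell L) := integral_nonneg fun _ => sq_nonneg _
  have h2 : 0 ≤ ∫ p : ℝ × ℝ, vort u w p.1 p.2 t ^ 2 ∂(cell L) :=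
    integral_nonneg fun _ => sq_nonneg _
  have h3 := mul_nonneg hκ.le h2
  constructor
  · linarith
  · have h4 : 1 / (2 * (σ * ρ * L)) * (∫ p : ℝ × ℝ, vort u w p.1 p.2 t ^ 2 ∂(cell L))
      ≤ energy σ ρ L u w T t := by linarith
    rw [one_div_mul_eq_div, div_le_iff₀ (one_div_pos.1 hκ)] at h4
    linarith

theorem hasDerivAt_meanU_z (D : SmallData f m σ ρ L u w T) (ht : 0 < t) (z : ℝ) :
    HasDerivAt (fun z => meanU L u z t) (meanU L (dz u) z t) z :=
  (D.sol.sm_u.hasGrad D.sol.per_u ht).hasDerivAt_integral D.L_pos.le z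

theorem hasDerivAt_meanU_dz (D : SmallData f m σ ρ L u w T) (ht : 0 < t) (z : ℝ) :
    HasDerivAt (fun z => meanU L (dz u) z t) (meanU L (dz (dz u)) z t) z :=
  (D.sol.sm_u.dz.hasGrad D.sol.per_u.dz ht).hasDerivAt_integral D.L_pos.le z

theorem continuous_meanU_dz_dz (D : SmallData f m σ ρ L u w T) (ht : 0 < t) :
    Continuous fun z => meanU L (dz (dz u)) z t :=
  continuous_iff_continuousAt.2 fun z =>
    ((D.sol.sm_u.dz.dz.hasGrad D.sol.per_u.dz.dz ht).hasDerivAt_integral D.L_pos.le z).continuousAt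

theorem hasDerivAt_meanU_t (D : SmallData f m σ ρ L u w T) (ht : 0 < t) (z : ℝ) :
    HasDerivAt (fun t => meanU L u z t) (meanU L (dt u) z t) t := by
  have hmaps : ∀ q ∈ (univ : Set ℝ) ×ˢ Ioi (0 : ℝ),
      ((q.1, z, q.2) : ℝ × ℝ × ℝ) ∈ {p : ℝ × ℝ × ℝ | 0 < p.2.2} := fun q hq => hq.2
  refine hasDerivAt_integral_slice D.L_pos.le (f := fun x t => u x z t)
    (f' := fun x t => dt u x z t) isOpen_Ioi ?_ ?_ (fun x s hs => D.sol.sm_u.hasDerivAt_t hs) ht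
  · exact D.sol.sm_u.contPos.comp (f := fun q : ℝ × ℝ => ((q.1, z, q.2) : ℝ × ℝ × ℝ))
      (by fun_prop) hmaps
  · exact D.sol.sm_u.dt.contPos.comp (f := fun q : ℝ × ℝ => ((q.1, z, q.2) : ℝ × ℝ × ℝ))
      (by fun_prop) hmaps

theorem integrable_meanU_sq (D : SmallData f m σ ρ L u w T) (ht : 0 < t) :
    Integrable (fun z => meanU L u z t ^ 2) := by
  obtain ⟨K, -, hK⟩ := D.sol.L2_u.exists_bound D.sol.sm_u.contPos (b := t) ht
  exact (integral_sq_mean_le D.L_pos.le (D.sol.sm_u.hasGrad D.sol.per_u ht)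
    (hK t ⟨le_rfl, le_rfl⟩).1).1

theorem integrable_meanU_dz_sq (D : SmallData f m σ ρ L u w T) (ht : 0 < t) :
    Integrable (fun z => meanU L (dz u) z t ^ 2) ∧ ∫ z, meanU L (dz u) z t ^ 2
      ≤ L * (2 * (σ * ρ * L) * energy σ ρ L u w T t) := by
  obtain ⟨h1, h2⟩ := integral_sq_mean_le D.L_pos.le (D.sol.sm_vort.hasGrad D.sol.per_vort ht)
    (D.integrable_vort_sq ht)
  have e : ∀ z, (∫ x in (0 : ℝ)..L, vort u w x z t) ^ 2 = meanU L (dz u) z t ^ 2 := fun z => by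
    rw [D.sol.integral_dz_u ht, neg_sq, meanU]
  simp only [e] at h1 h2
  exact ⟨h1, h2.trans (mul_le_mul_of_nonneg_left (D.integral_sq_le_energy ht).2 D.L_pos.le)⟩

theorem meanEnergy_eq (D : SmallData f m σ ρ L u w T) (ht : 0 < t) :
    meanEnergy L u t = L * ∫ z, meanU L u z t ^ 2 :=
  (integral_cell_of_z D.L_pos.le (D.integrable_meanU_sq ht)).2

theorem exists_bound_meanEnergy (D : SmallData f m σ ρ L u w T) (ha : 0 < a) :
    ∃ K : ℝ, ∀ t ∈ Icc a b, meanEnergy L u t ≤ K := by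
  obtain ⟨K, -, hK⟩ := D.sol.L2_u.exists_bound D.sol.sm_u.contPos (b := b) ha
  refine ⟨L * (L * K), fun t ht => ?_⟩
  have ht0 : 0 < t := ha.trans_le ht.1
  rw [D.meanEnergy_eq ht0]
  have hL := D.L_pos
  obtain ⟨i, j⟩ := hK t ht
  have := (integral_sq_mean_le hL.le (D.sol.sm_u.hasGrad D.sol.per_u ht0) i).2
  gcongr
  exact this.trans (mul_le_mul_of_nonneg_left j hL.le)

/-- Agmon's inequality for the mean flow. -/
theorem abs_meanU_le (D : SmallData f m σ ρ L u w T) (ht : 0 < t) (z : ℝ) :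
    |meanU L u z t| ≤ 1 + meanEnergy L u t / L
      + L * (2 * (σ * ρ * L) * energy σ ρ L u w T t) := by
  have hL := D.L_pos
  have i1 := D.integrable_meanU_sq ht
  obtain ⟨i2, j2⟩ := D.integrable_meanU_dz_sq ht
  have hd := D.hasDerivAt_meanU_z ht
  have hd' := D.hasDerivAt_meanU_dz ht
  have c1 : Continuous fun z => meanU L u z t :=
    continuous_iff_continuousAt.2 fun z => (hd z).continuousAt
  have c2 : Continuous fun z => meanU L (dz u) z t :=
    continuous_iff_continuousAt.2 fun z => (hd' z).continuousAt
  have hle : ∀ z, |meanU L (dz u) z t * meanU L u z t + meanU L u z t * meanU L (dz u) z t|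
      ≤ meanU L u z t ^ 2 + meanU L (dz u) z t ^ 2 := fun z => by
    rw [abs_le]
    constructor <;> nlinarith [sq_nonneg (meanU L u z t + meanU L (dz u) z t),
      sq_nonneg (meanU L u z t - meanU L (dz u) z t)]
  have i3 : Integrable fun z =>
      meanU L (dz u) z t * meanU L u z t + meanU L u z t * meanU L (dz u) z t :=
    (i1.add i2).mono' (by fun_prop : Continuous fun z => meanU L (dz u) z t * meanU L u z t
      + meanU L u z t * meanU L (dz u) z t).aestronglyMeasurable (Eventually.of_forall hle)
  have h1 := le_integral_abs_deriv (g := fun z => meanU L u z t * meanU L u z t)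
    (fun z => (hd z).mul (hd z)) (by fun_prop)
    (i1.congr (Eventually.of_forall fun z => pow_two _)) i3 z
  have h2 := integral_mono i3.abs (i1.add i2) hle
  have h3 : ∫ z, ((fun z => meanU L u z t ^ 2) + fun z => meanU L (dz u) z t ^ 2 : ℝ → ℝ) z
      = (∫ z, meanU L u z t ^ 2) + ∫ z, meanU L (dz u) z t ^ 2 := integral_add i1 i2
  have h4 : meanEnergy L u t / L = ∫ z, meanU L u z t ^ 2 := by
    rw [D.meanEnergy_eq ht]; field_simp
  have h5 : |meanU L u z t| ≤ 1 + meanU L u z t * meanU L u z t := by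
    rw [abs_le]
    constructor <;> nlinarith [sq_nonneg (meanU L u z t + 1), sq_nonneg (meanU L u z t - 1)]
  rw [h4]
  linarith

/-- The mean vorticity flux is quadratic in quantities whose time integral is controlled. -/
theorem cutInt_flux_le (D : SmallData f m σ ρ L u w T) (ht : 0 < t) (hη : IsCutoff η η' η'')
    (h0 : ∀ z, 0 ≤ η z) :
    cutInt L η (fun _ z => |∫ y in (0 : ℝ)..L, w y z t * vort u w y z t|)
      ≤ L * (L ^ 4 + L ^ 2) / 2 * (cutInt L η (fun x z => hDens w x z t)
        + cutInt L η (fun x z => dDens u w T x z t)) := by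
  have hL := D.L_pos
  have hw := D.sol.sm_w.hasGrad D.sol.per_w ht
  have hwx := D.sol.sm_w.dx.hasGrad D.sol.per_w.dx ht
  have hω := D.sol.sm_vort.hasGrad D.sol.per_vort ht
  have ch : Continuous fun q : ℝ × ℝ => hDens w q.1 q.2 t := D.contPos_hDens.slice ht
  have cd : Continuous fun q : ℝ × ℝ => dDens u w T q.1 q.2 t := D.contPos_dDens.slice ht
  have cm : Continuous fun z => ∫ y in (0 : ℝ)..L, w y z t * vort u w y z t :=
    continuous_iff_continuousAt.2 fun z => ((hw.mul hω).hasDerivAt_integral hL.le z).continuousAt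
  rw [← cutInt_add hη.cont hη.supp ch cd, ← cutInt_const_mul]
  refine cutInt_mono_slice hL.le hη.cont hη.supp h0 (cm.comp continuous_snd).abs (by fun_prop) fun z => ?_
  have hs : Continuous fun x : ℝ => (x, z) := by fun_prop
  have sh : Continuous fun x => hDens w x z t := ch.comp hs
  have sd : Continuous fun x => dDens u w T x z t := cd.comp hs
  have s1 : Continuous fun x => dx (dx w) x z t := hwx.cont_x.comp hs
  have s2 : Continuous fun x => dx (vort u w) x z t := hω.cont_x.comp hs
  have p0 := integral_mul_le_of_mean_zero hL (hw.cont.comp hs) (D.sol.integral_w_eq_zero hL ht z)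
    (fun x => hω.hx x z) s2 one_pos
  have p1 := poincare hL (fun x => hw.hx x z) (hw.cont_x.comp hs) (D.sol.integral_w_eq_zero hL ht z)
  have p2 := poincare hL (fun x => hwx.hx x z) s1 (hw.integral_x_eq_zero z)
  have hsh : ∫ x in (0 : ℝ)..L, dx (dx w) x z t ^ 2 ≤ ∫ x in (0 : ℝ)..L, hDens w x z t := by
    refine intervalIntegral.integral_mono_on hL.le ((s1.pow 2).intervalIntegrable _ _)
      (sh.intervalIntegrable _ _) fun x _ => ?_
    unfold hDens
    nlinarith [sq_nonneg (dz (dx w) x z t), sq_nonneg (dz (dz w) x z t)]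
  have hsd : ∫ x in (0 : ℝ)..L, dx (vort u w) x z t ^ 2 ≤ ∫ x in (0 : ℝ)..L, dDens u w T x z t := by
    refine intervalIntegral.integral_mono_on hL.le ((s2.pow 2).intervalIntegrable _ _)
      (sd.intervalIntegrable _ _) fun x _ => ?_
    unfold dDens
    nlinarith [sq_nonneg (dx (dx T) x z t), sq_nonneg (dz (dx T) x z t),
      sq_nonneg (dz (vort u w) x z t)]
  have h1 : 0 ≤ ∫ x in (0 : ℝ)..L, hDens w x z t :=
    intervalIntegral.integral_nonneg hL.le fun x _ => hDens_nonneg w x z t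
  have h2 : 0 ≤ ∫ x in (0 : ℝ)..L, dDens u w T x z t :=
    intervalIntegral.integral_nonneg hL.le fun x _ => dDens_nonneg u w T x z t
  rw [intervalIntegral.integral_const, intervalIntegral.integral_const_mul,
    intervalIntegral.integral_add (sh.intervalIntegrable _ _) (sd.intervalIntegrable _ _),
    sub_zero, smul_eq_mul]
  simp only [Function.comp_def] at p0 p1
  set H := ∫ x in (0 : ℝ)..L, hDens w x z t
  set Q := ∫ x in (0 : ℝ)..L, dDens u w T x z t
  set W := ∫ x in (0 : ℝ)..L, w x z t ^ 2
  have hW : W ≤ L ^ 4 * H := by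
    calc W ≤ L ^ 2 * (L ^ 2 * H) := by
          refine p1.trans (mul_le_mul_of_nonneg_left ?_ (sq_nonneg L))
          exact p2.trans (mul_le_mul_of_nonneg_left hsh (sq_nonneg L))
      _ = L ^ 4 * H := by ring
  have hQ := mul_le_mul_of_nonneg_left hsd (sq_nonneg L)
  have hm : |∫ y in (0 : ℝ)..L, w y z t * vort u w y z t| ≤ 1 / 2 * (L ^ 4 + L ^ 2) * (H + Q) := by
    have t1 : 0 ≤ L ^ 2 * H := by positivity
    have t2 : 0 ≤ L ^ 4 * Q := by positivity
    linarith
  calc L * |∫ y in (0 : ℝ)..L, w y z t * vort u w y z t|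
      ≤ L * (1 / 2 * (L ^ 4 + L ^ 2) * (H + Q)) := mul_le_mul_of_nonneg_left hm hL.le
    _ = L * (L ^ 4 + L ^ 2) / 2 * (H + Q) := by ring

/-- The constant in front of the energy loss in the estimates of the mean flow. -/
def fluxCoeff (ρ L : ℝ) : ℝ := 2 * (L * (L ^ 4 + L ^ 2) / 2 * (2 / dissCoeff ρ L))

theorem fluxCoeff_nonneg (D : SmallData f m σ ρ L u w T) : 0 ≤ fluxCoeff ρ L := by
  have := D.dissCoeff_pos
  have := D.L_pos
  unfold fluxCoeff; positivity

/-- The energy inequality for the mean flow, localized by `cut n`. -/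
theorem cutInt_meanU_le (D : SmallData f m σ ρ L u w T) (ha : 0 < a) (hab : a ≤ b) {M : ℝ}
    (hM : ∀ t ∈ Icc a b, ∀ z, |meanU L u z t| ≤ M) :
    ∃ C : ℝ, ∀ n : ℕ, cutInt L (cut n) (fun _ z => meanU L u z b ^ 2)
      + 2 * σ * ∫ t in a..b, cutInt L (cut n) (fun _ z => meanU L (dz u) z t ^ 2)
      ≤ cutInt L (cut n) (fun _ z => meanU L u z a ^ 2)
        + M * (fluxCoeff ρ L * (energy σ ρ L u w T a - energy σ ρ L u w T b)) + C / (n + 1) := by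
  have hL := D.L_pos
  have hσ := D.σ_pos
  have hM0 : 0 ≤ M := (abs_nonneg _).trans (hM a ⟨le_rfl, hab⟩ 0)
  obtain ⟨K, hK⟩ := D.exists_bound_meanEnergy (b := b) ha
  obtain ⟨C, hC0, hC⟩ := exists_cut_bound
  refine ⟨σ * (C * K) * (b - a), fun n => ?_⟩
  have hcut := isCutoff_cut n
  have cu : ContPos (fun _ z t => meanU L u z t) := D.sol.sm_u.contPos.mean L
  have cut' : ContPos (fun _ z t => meanU L (dt u) z t) := D.sol.sm_u.dt.contPos.mean L
  have cuz : ContPos (fun _ z t => meanU L (dz u) z t) := D.sol.sm_u.dz.contPos.mean L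
  have c1 : ContPos (fun _ z t => meanU L u z t ^ 2) := ContinuousOn.pow cu 2
  have c2 : ContPos (fun _ z t => 2 * (meanU L u z t * meanU L (dt u) z t)) :=
    ContinuousOn.mul continuousOn_const (ContinuousOn.mul cu cut')
  have c3 : ContPos (fun _ z t => meanU L (dz u) z t ^ 2) := ContinuousOn.pow cuz 2
  have hrate : ∀ t ∈ Icc a b,
      cutInt L (cut n) (fun _ z => 2 * (meanU L u z t * meanU L (dt u) z t))
      ≤ -(2 * σ * cutInt L (cut n) (fun _ z => meanU L (dz u) z t ^ 2))
        + 2 * M * (L * (L ^ 4 + L ^ 2) / 2) * (cutInt L (cut n) (fun x z => hDens w x z t)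
          + cutInt L (cut n) (fun x z => dDens u w T x z t)) + σ * (C / (n + 1) * K) := by
    intro t ht
    have ht0 : 0 < t := ha.trans_le ht.1
    have hp := hasGrad_of_z (L := L) (D.hasDerivAt_meanU_z ht0)
      (continuous_iff_continuousAt.2 fun z => (D.hasDerivAt_meanU_dz ht0 z).continuousAt)
    have hq := hasGrad_of_z (L := L) (D.hasDerivAt_meanU_dz ht0) (D.continuous_meanU_dz_dz ht0)
    have z0 := HasGrad.const L 0
    have E := cutInt_energy hL.le hcut z0 z0 (fun _ _ => add_zero 0) hp z0 hq σ
    have hw := D.sol.sm_w.hasGrad D.sol.per_w ht0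
    have hω := D.sol.sm_vort.hasGrad D.sol.per_vort ht0
    have cm : Continuous fun z => ∫ y in (0 : ℝ)..L, w y z t * vort u w y z t :=
      continuous_iff_continuousAt.2 fun z => ((hw.mul hω).hasDerivAt_integral hL.le z).continuousAt
    have d1 := hp.cont
    have d2 := hq.cont
    have d3 := hq.cont_z
    have d4 : Continuous fun q : ℝ × ℝ => ∫ y in (0 : ℝ)..L, w y q.2 t * vort u w y q.2 t :=
      cm.comp continuous_snd
    have hsplit : cutInt L (cut n) (fun _ z => 2 * (meanU L u z t * meanU L (dt u) z t))
        = 2 * (cutInt L (cut n) (fun _ z => meanU L u z t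
            * ∫ y in (0 : ℝ)..L, w y z t * vort u w y z t)
          + cutInt L (cut n) (fun _ z => meanU L u z t * (σ * (0 + meanU L (dz (dz u)) z t)
            - 0 * 0 - 0 * meanU L (dz u) z t))) := by
      rw [cutInt_const_mul, ← cutInt_add hcut.cont hcut.supp (by fun_prop) (by fun_prop)]
      congr 1
      refine cutInt_congr fun x z => ?_
      have := D.sol.integral_dt_u hL ht0 (D.integrable_vort_sq ht0) z
      simp only [meanU]
      rw [this]; ring
    have hflux : cutInt L (cut n) (fun _ z => meanU L u z t
            * ∫ y in (0 : ℝ)..L, w y z t * vort u w y z t)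
        ≤ M * cutInt L (cut n) (fun _ z => |∫ y in (0 : ℝ)..L, w y z t * vort u w y z t|) := by
      rw [← cutInt_const_mul]
      refine cutInt_mono hcut.cont hcut.supp (cut_nonneg n) (by fun_prop) (by fun_prop)
        fun x z => ?_
      refine (le_abs_self _).trans ?_
      rw [abs_mul]
      exact mul_le_mul_of_nonneg_right (hM t ht z) (abs_nonneg _)
    have hfl := mul_le_mul_of_nonneg_left (D.cutInt_flux_le ht0 hcut (cut_nonneg n)) hM0
    have herr := (abs_le.1 (abs_cutInt_le_of_abs_le (L := L) (F := fun _ z => meanU L u z t ^ 2)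
      (G := fun _ z => meanU L u z t ^ 2) (K := K) (hC n).2.1 (by fun_prop)
      (integral_cell_of_z hL.le (D.integrable_meanU_sq ht0)).1
      (fun x z => (abs_of_nonneg (sq_nonneg _)).le) (hK t ht))).2
    have hz : cutInt L (cut₁ n) (fun _ z => 0 * meanU L u z t ^ 2) = 0 := by simp [cutInt]
    have hq2 : cutInt L (cut n) (fun _ z => (0 : ℝ) ^ 2 + meanU L (dz u) z t ^ 2)
        = cutInt L (cut n) (fun _ z => meanU L (dz u) z t ^ 2) :=
      cutInt_congr fun _ z => by ring
    rw [hz, hq2] at E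
    have herr' := mul_le_mul_of_nonneg_left herr hσ.le
    rw [hsplit, E]
    linarith
  have hFTC := cutInt_sub_eq_integral (L := L) hcut.cont hcut.supp c1 c2 (fun x z t ht => by
    refine ((D.hasDerivAt_meanU_t ht z).pow 2).congr_deriv ?_
    norm_num; ring) ha hab
  have ii := intervalIntegrable_cutInt (L := L) hcut.cont hcut.supp c2 ha hab
  have iq := intervalIntegrable_cutInt (L := L) hcut.cont hcut.supp c3 ha hab
  have ih := intervalIntegrable_cutInt (L := L) hcut.cont hcut.supp D.contPos_hDens ha hab
  have id := intervalIntegrable_cutInt (L := L) hcut.cont hcut.supp D.contPos_dDens ha hab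
  have iqn : IntervalIntegrable (fun t => -(2 * σ *
      cutInt L (cut n) (fun _ z => meanU L (dz u) z t ^ 2))) volume a b := (iq.const_mul _).neg
  have ihd : IntervalIntegrable (fun t => 2 * M * (L * (L ^ 4 + L ^ 2) / 2) *
      (cutInt L (cut n) (fun x z => hDens w x z t)
        + cutInt L (cut n) (fun x z => dDens u w T x z t))) volume a b := (ih.add id).const_mul _
  have hint := intervalIntegral.integral_mono_on hab ii
    ((iqn.add ihd).add (intervalIntegrable_const (c := σ * (C / (n + 1) * K)))) hrate
  have e1 := intervalIntegral.integral_add (iqn.add ihd)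
    (intervalIntegrable_const (c := σ * (C / (n + 1) * K)) (a := a) (b := b) (μ := volume))
  have e2 := intervalIntegral.integral_add iqn ihd
  rw [e1, e2, intervalIntegral.integral_neg, intervalIntegral.integral_const_mul,
    intervalIntegral.integral_const_mul, intervalIntegral.integral_add ih id,
    intervalIntegral.integral_const, smul_eq_mul, ← hFTC] at hint
  have hH := D.integral_hDens_le ha hab n
  have hQ := D.integral_dDens_le ha hab n
  have hMc : 0 ≤ 2 * M * (L * (L ^ 4 + L ^ 2) / 2) := by positivity
  have hHQ := mul_le_mul_of_nonneg_left (add_le_add hH hQ) hMc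
  have e3 : 2 * M * (L * (L ^ 4 + L ^ 2) / 2)
        * ((energy σ ρ L u w T a - energy σ ρ L u w T b) / dissCoeff ρ L
          + (energy σ ρ L u w T a - energy σ ρ L u w T b) / dissCoeff ρ L)
      = M * (fluxCoeff ρ L * (energy σ ρ L u w T a - energy σ ρ L u w T b)) := by
    unfold fluxCoeff; ring
  have e4 : σ * (C * K) * (b - a) / ((n : ℝ) + 1) = (b - a) * (σ * (C / (n + 1) * K)) := by ring
  rw [e3] at hHQ
  rw [e4]
  linarith

/-- The energy inequality for the mean flow, and the resulting bound on the mean shear. -/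
theorem meanEnergy_le (D : SmallData f m σ ρ L u w T) (ha : 0 < a) (hab : a ≤ b) {M : ℝ}
    (hM : ∀ t ∈ Icc a b, ∀ z, |meanU L u z t| ≤ M) :
    meanEnergy L u b ≤ meanEnergy L u a
        + M * (fluxCoeff ρ L * (energy σ ρ L u w T a - energy σ ρ L u w T b)) ∧
      ∀ n, ∫ t in a..b, cutInt L (cut n) (fun _ z => meanU L (dz u) z t ^ 2)
        ≤ (meanEnergy L u a
          + M * (fluxCoeff ρ L * (energy σ ρ L u w T a - energy σ ρ L u w T b))) / (2 * σ) := by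
  have hσ := D.σ_pos
  obtain ⟨C, hC⟩ := D.cutInt_meanU_le ha hab hM
  have cuz : ContPos (fun _ z t => meanU L (dz u) z t) := D.sol.sm_u.dz.contPos.mean L
  have c3 : ContPos (fun _ z t => meanU L (dz u) z t ^ 2) := ContinuousOn.pow cuz 2
  have hq0 : ∀ n, 0 ≤ ∫ t in a..b, cutInt L (cut n) (fun _ z => meanU L (dz u) z t ^ 2) :=
    fun n => intervalIntegral.integral_nonneg hab fun t _ =>
      cutInt_nonneg (cut_nonneg n) fun _ _ => sq_nonneg _
  have hlim : ∀ t, 0 < t → Tendsto (fun n => cutInt L (cut n) (fun _ z => meanU L u z t ^ 2)) atTop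
      (𝓝 (meanEnergy L u t)) := fun t ht =>
    tendsto_cutInt (F := fun _ z => meanU L u z t ^ 2)
      (integral_cell_of_z D.L_pos.le (D.integrable_meanU_sq ht)).1
  have la := hlim a ha
  have lb := hlim b (ha.trans_le hab)
  constructor
  · refine le_of_tendsto_of_tendsto' lb (g := fun n : ℕ =>
      cutInt L (cut n) (fun _ z => meanU L u z a ^ 2)
        + M * (fluxCoeff ρ L * (energy σ ρ L u w T a - energy σ ρ L u w T b)) + C / (n + 1)) ?_ ?_
    · simpa using (la.add_const
        (M * (fluxCoeff ρ L * (energy σ ρ L u w T a - energy σ ρ L u w T b)))).add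
          (tendsto_div_nat C)
    · intro n
      have := hC n
      have := mul_nonneg (by positivity : 0 ≤ 2 * σ) (hq0 n)
      linarith
  · refine integral_cutInt_le_of_error c3 (fun _ _ _ _ => sq_nonneg _) ha hab
      (e := fun n => (cutInt L (cut n) (fun _ z => meanU L u z a ^ 2) - meanEnergy L u a
        + C / (n + 1)) / (2 * σ)) ?_ fun n => ?_
    · simpa using ((la.sub_const (meanEnergy L u a)).add (tendsto_div_nat C)).div_const (2 * σ)
    · rw [← add_div, le_div_iff₀ (by positivity)]
      have h1 := hC n
      have h2 : 0 ≤ cutInt L (cut n) (fun _ z => meanU L u z b ^ 2) :=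
        cutInt_nonneg (cut_nonneg n) fun _ _ => sq_nonneg _
      linarith

/-- The energy loss after a late time is arbitrarily small. -/
theorem exists_energy_loss_le (D : SmallData f m σ ρ L u w T) {ε : ℝ} (hε : 0 < ε) :
    ∃ a, 1 ≤ a ∧ ∀ t, a ≤ t → energy σ ρ L u w T a - energy σ ρ L u w T t ≤ ε := by
  have hb : BddBelow (energy σ ρ L u w T '' Ici 1) :=
    ⟨0, by rintro _ ⟨t, -, rfl⟩; exact D.energy_nonneg t⟩
  have hne : (energy σ ρ L u w T '' Ici 1).Nonempty := ⟨_, 1, self_mem_Ici, rfl⟩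
  obtain ⟨_, ⟨a, ha, rfl⟩, hlt⟩ := exists_lt_of_csInf_lt hne
    (lt_add_of_pos_right (sInf (energy σ ρ L u w T '' Ici 1)) hε)
  refine ⟨a, ha, fun t ht => ?_⟩
  have := csInf_le hb ⟨t, le_trans (mem_Ici.1 ha) ht, rfl⟩
  linarith

/-- The mean shear is square integrable in space and time. -/
theorem exists_mean_shear_bound (D : SmallData f m σ ρ L u w T) :
    ∃ a, 1 ≤ a ∧ ∃ K : ℝ, ∀ b, a ≤ b → ∀ n,
      ∫ t in a..b, cutInt L (cut n) (fun _ z => meanU L (dz u) z t ^ 2) ≤ K := by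
  have hL := D.L_pos
  have hσ := D.σ_pos
  have hF := D.fluxCoeff_nonneg
  -- the loss is small enough for the forcing to be absorbed by half of the maximal mean energy
  obtain ⟨a, ha1, ha⟩ := D.exists_energy_loss_le
    (ε := min 1 (L / 2) / (fluxCoeff ρ L + 1)) (by positivity)
  have ha0 : 0 < a := by linarith
  have hloss : ∀ t, a ≤ t →
      0 ≤ fluxCoeff ρ L * (energy σ ρ L u w T a - energy σ ρ L u w T t) ∧
      fluxCoeff ρ L * (energy σ ρ L u w T a - energy σ ρ L u w T t) ≤ 1 ∧
      fluxCoeff ρ L * (energy σ ρ L u w T a - energy σ ρ L u w T t) ≤ L / 2 := by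
    intro t ht
    have h0 := D.energy_antitone ha0 ht
    have h1 := ha t ht
    rw [le_div_iff₀ (by linarith)] at h1
    have h2 : fluxCoeff ρ L * (energy σ ρ L u w T a - energy σ ρ L u w T t) ≤ min 1 (L / 2) := by
      linarith
    exact ⟨mul_nonneg hF (by linarith), h2.trans (min_le_left _ _), h2.trans (min_le_right _ _)⟩
  set c := 1 + L * (2 * (σ * ρ * L) * energy σ ρ L u w T a) with hc
  have hσρL : 0 ≤ L * (2 * (σ * ρ * L)) := by
    have := D.ρ_pos
    positivity
  have hE0 : ∀ t, 0 ≤ meanEnergy L u t := fun t => integral_nonneg fun _ => sq_nonneg _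
  refine ⟨a, ha1, (meanEnergy L u a + (c + 2 * (meanEnergy L u a + c) / L)) / (2 * σ),
    fun b hab n => ?_⟩
  obtain ⟨K, hK⟩ := D.exists_bound_meanEnergy (b := b) ha0
  have hbdd : BddAbove (meanEnergy L u '' Icc a b) :=
    ⟨K, by rintro _ ⟨t, ht, rfl⟩; exact hK t ht⟩
  set S := sSup (meanEnergy L u '' Icc a b) with hS
  have hES : ∀ t ∈ Icc a b, meanEnergy L u t ≤ S := fun t ht => le_csSup hbdd ⟨t, ht, rfl⟩
  have hM : ∀ t ∈ Icc a b, ∀ z, |meanU L u z t| ≤ c + S / L := by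
    intro t ht z
    have ht0 : 0 < t := ha0.trans_le ht.1
    have h1 := D.abs_meanU_le ht0 z
    have h2 := mul_le_mul_of_nonneg_left (D.energy_antitone ha0 ht.1) hσρL
    have h3 : meanEnergy L u t / L ≤ S / L := div_le_div_of_nonneg_right (hES t ht) hL.le
    rw [hc]
    linarith
  have hc0 : 0 ≤ c := by
    have := mul_nonneg hσρL (D.energy_nonneg a)
    rw [hc]; linarith
  have hS0 : 0 ≤ S := (hE0 a).trans (hES a ⟨le_rfl, hab⟩)
  have hbound : ∀ t, a ≤ t →
      (c + S / L) * (fluxCoeff ρ L * (energy σ ρ L u w T a - energy σ ρ L u w T t))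
        ≤ c + S / 2 := by
    intro t ht
    obtain ⟨l0, l1, l2⟩ := hloss t ht
    have h1 := mul_le_mul_of_nonneg_left l1 hc0
    have h2 := mul_le_mul_of_nonneg_left l2 (div_nonneg hS0 hL.le)
    have h3 : S / L * (L / 2) = S / 2 := by field_simp
    rw [h3] at h2
    linarith
  have hSle : S ≤ 2 * (meanEnergy L u a + c) := by
    have : S ≤ meanEnergy L u a + (c + S / 2) := by
      refine csSup_le ⟨_, a, ⟨le_rfl, hab⟩, rfl⟩ ?_
      rintro _ ⟨t, ht, rfl⟩
      have h1 := (D.meanEnergy_le ha0 ht.1 fun s hs => hM s ⟨hs.1, hs.2.trans ht.2⟩).1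
      linarith [hbound t ht.1]
    linarith
  refine ((D.meanEnergy_le ha0 hab hM).2 n).trans ?_
  refine div_le_div_of_nonneg_right ?_ (by positivity)
  obtain ⟨l0, l1, -⟩ := hloss b hab
  have h1 := mul_le_mul_of_nonneg_left l1 (add_nonneg hc0 (div_nonneg hS0 hL.le))
  have h2 : S / L ≤ 2 * (meanEnergy L u a + c) / L := div_le_div_of_nonneg_right hSle hL.le
  linarith

/-- The energy is controlled by the dissipation and the mean shear. -/
theorem cutInt_eDens_le (D : SmallData f m σ ρ L u w T) (ht : 0 < t) (hη : IsCutoff η η' η'')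
    (h0 : ∀ z, 0 ≤ η z) :
    cutInt L η (fun x z => eDens σ ρ L u w T x z t)
      ≤ (1 / 2 + 1 / (2 * (σ * ρ * L))) * L ^ 2 * cutInt L η (fun x z => dDens u w T x z t)
        + 1 / (2 * (σ * ρ * L)) / L ^ 2 * cutInt L η (fun _ z => meanU L (dz u) z t ^ 2) := by
  have hL := D.L_pos
  have hκ := D.κ_pos
  have hT := D.sol.sm_T.hasGrad D.sol.per_T ht
  have hS := D.sol.sm_T.dx.hasGrad D.sol.per_T.dx ht
  have hω := D.sol.sm_vort.hasGrad D.sol.per_vort ht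
  have ce : Continuous fun q : ℝ × ℝ => eDens σ ρ L u w T q.1 q.2 t := D.contPos_eDens.slice ht
  have cd : Continuous fun q : ℝ × ℝ => dDens u w T q.1 q.2 t := D.contPos_dDens.slice ht
  have cq : Continuous fun z => meanU L (dz u) z t :=
    continuous_iff_continuousAt.2 fun z => (D.hasDerivAt_meanU_dz ht z).continuousAt
  rw [← cutInt_const_mul, ← cutInt_const_mul,
    ← cutInt_add hη.cont hη.supp (by fun_prop) (by fun_prop)]
  refine cutInt_mono_slice hL.le hη.cont hη.supp h0 ce (by fun_prop) fun z => ?_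
  have hs : Continuous fun x : ℝ => (x, z) := by fun_prop
  have sd : Continuous fun x => dDens u w T x z t := cd.comp hs
  have s1 : Continuous fun x => dx (dx T) x z t := hS.cont_x.comp hs
  have s2 : Continuous fun x => dx (vort u w) x z t := hω.cont_x.comp hs
  have s3 : Continuous fun x => dx T x z t := hS.cont.comp hs
  have s4 : Continuous fun x => vort u w x z t := hω.cont.comp hs
  have p1 := poincare hL (fun x => hS.hx x z) s1 (hT.integral_x_eq_zero z)
  have p2 := poincare_mean hL (fun x => hω.hx x z) s2
  rw [D.sol.integral_dz_u ht, neg_sq] at p2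
  have hd1 : ∫ x in (0 : ℝ)..L, dx (dx T) x z t ^ 2 ≤ ∫ x in (0 : ℝ)..L, dDens u w T x z t := by
    refine intervalIntegral.integral_mono_on hL.le ((s1.pow 2).intervalIntegrable _ _)
      (sd.intervalIntegrable _ _) fun x _ => ?_
    unfold dDens
    nlinarith [sq_nonneg (dx (vort u w) x z t), sq_nonneg (dz (dx T) x z t),
      sq_nonneg (dz (vort u w) x z t)]
  have hd2 : ∫ x in (0 : ℝ)..L, dx (vort u w) x z t ^ 2 ≤ ∫ x in (0 : ℝ)..L, dDens u w T x z t := by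
    refine intervalIntegral.integral_mono_on hL.le ((s2.pow 2).intervalIntegrable _ _)
      (sd.intervalIntegrable _ _) fun x _ => ?_
    unfold dDens
    nlinarith [sq_nonneg (dx (dx T) x z t), sq_nonneg (dz (dx T) x z t),
      sq_nonneg (dz (vort u w) x z t)]
  unfold eDens
  rw [intervalIntegral.integral_add (Continuous.intervalIntegrable (by fun_prop) _ _)
      (Continuous.intervalIntegrable (by fun_prop) _ _),
    intervalIntegral.integral_add (Continuous.intervalIntegrable (by fun_prop) _ _)
      (Continuous.intervalIntegrable (by fun_prop) _ _),
    intervalIntegral.integral_const_mul, intervalIntegral.integral_const_mul,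
    intervalIntegral.integral_const_mul, intervalIntegral.integral_const, smul_eq_mul, sub_zero]
  set Q := ∫ x in (0 : ℝ)..L, dDens u w T x z t
  set κ := 1 / (2 * (σ * ρ * L))
  have q1 := mul_le_mul_of_nonneg_left hd1 (sq_nonneg L)
  have q2 := mul_le_mul_of_nonneg_left hd2 (sq_nonneg L)
  have e : L * (κ / L ^ 2 * meanU L (dz u) z t ^ 2) = κ * (meanU L (dz u) z t ^ 2 / L) := by
    field_simp
  rw [e]
  have p3 : ∫ x in (0 : ℝ)..L, vort u w x z t ^ 2 ≤ L ^ 2 * Q + meanU L (dz u) z t ^ 2 / L :=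
    p2.trans (by rw [meanU]; linarith)
  have p4 := mul_le_mul_of_nonneg_left p3 hκ.le
  linarith

/-- The energy tends to zero: it is nonincreasing and integrable in time. -/
theorem tendsto_energy (D : SmallData f m σ ρ L u w T) :
    Tendsto (energy σ ρ L u w T) atTop (𝓝 0) := by
  have hL := D.L_pos
  have hκ := D.κ_pos
  obtain ⟨a, ha1, K, hK⟩ := D.exists_mean_shear_bound
  have ha0 : 0 < a := by linarith
  set K' := (1 / 2 + 1 / (2 * (σ * ρ * L))) * L ^ 2 * (energy σ ρ L u w T a / dissCoeff ρ L)
    + 1 / (2 * (σ * ρ * L)) / L ^ 2 * K with hK'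
  have cuz : ContPos (fun _ z t => meanU L (dz u) z t) := D.sol.sm_u.dz.contPos.mean L
  have c3 : ContPos (fun _ z t => meanU L (dz u) z t ^ 2) := ContinuousOn.pow cuz 2
  have hint : ∀ b, a ≤ b → ∀ n,
      ∫ t in a..b, cutInt L (cut n) (fun x z => eDens σ ρ L u w T x z t) ≤ K' := by
    intro b hab n
    have hcut := isCutoff_cut n
    have ie := intervalIntegrable_cutInt (L := L) hcut.cont hcut.supp D.contPos_eDens ha0 hab
    have iq := intervalIntegrable_cutInt (L := L) hcut.cont hcut.supp c3 ha0 hab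
    have id := intervalIntegrable_cutInt (L := L) hcut.cont hcut.supp D.contPos_dDens ha0 hab
    have h1 := intervalIntegral.integral_mono_on hab ie
      ((id.const_mul ((1 / 2 + 1 / (2 * (σ * ρ * L))) * L ^ 2)).add
        (iq.const_mul (1 / (2 * (σ * ρ * L)) / L ^ 2)))
      fun t ht => D.cutInt_eDens_le (ha0.trans_le ht.1) hcut (cut_nonneg n)
    have h2 := intervalIntegral.integral_add
      (id.const_mul ((1 / 2 + 1 / (2 * (σ * ρ * L))) * L ^ 2))
      (iq.const_mul (1 / (2 * (σ * ρ * L)) / L ^ 2))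
    rw [h2, intervalIntegral.integral_const_mul, intervalIntegral.integral_const_mul] at h1
    have h3 := D.integral_dDens_le ha0 hab n
    have h4 : (energy σ ρ L u w T a - energy σ ρ L u w T b) / dissCoeff ρ L
        ≤ energy σ ρ L u w T a / dissCoeff ρ L :=
      div_le_div_of_nonneg_right (by linarith [D.energy_nonneg b]) D.dissCoeff_pos.le
    have h5 := mul_le_mul_of_nonneg_left (h3.trans h4)
      (by positivity : 0 ≤ (1 / 2 + 1 / (2 * (σ * ρ * L))) * L ^ 2)
    have h6 := mul_le_mul_of_nonneg_left (hK b hab n)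
      (by positivity : 0 ≤ 1 / (2 * (σ * ρ * L)) / L ^ 2)
    rw [hK']
    linarith
  have hK'0 : 0 ≤ K' := by simpa using hint a le_rfl 0
  have hle : ∀ b, a ≤ b → (b - a) * energy σ ρ L u w T b ≤ K' := by
    intro b hab
    have h1 := lintegral_le_of_cutInt_le (fun n => (isCutoff_cut n).cont)
      (fun n => (isCutoff_cut n).supp) cut_nonneg tendsto_cut D.contPos_eDens
      (fun x z t _ => D.eDens_nonneg x z t) ha0 hab (e := fun _ => 0) tendsto_const_nhds
      (fun n => by simpa using hint b hab n)
    have h2 : ∫⁻ _ in Ioc a b, ENNReal.ofReal (energy σ ρ L u w T b)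
        ≤ ∫⁻ t in Ioc a b, ∫⁻ p : ℝ × ℝ,
          ENNReal.ofReal (eDens σ ρ L u w T p.1 p.2 t) ∂(cell L) := by
      refine setLIntegral_mono' measurableSet_Ioc fun t ht => ?_
      have ht0 : 0 < t := ha0.trans ht.1
      rw [← ofReal_integral_eq_lintegral_ofReal (D.integrable_eDens ht0)
        (Eventually.of_forall fun p => D.eDens_nonneg p.1 p.2 t)]
      exact ENNReal.ofReal_le_ofReal (D.energy_antitone ht0 ht.2)
    have h3 := h2.trans h1
    rw [setLIntegral_const, Real.volume_Ioc, ← ENNReal.ofReal_mul (D.energy_nonneg b),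
      ENNReal.ofReal_le_ofReal_iff hK'0] at h3
    linarith
  have hlim : Tendsto (fun b => K' / (b - a)) atTop (𝓝 0) :=
    tendsto_const_nhds.div_atTop (tendsto_atTop_add_const_right _ _ tendsto_id)
  refine squeeze_zero' (Eventually.of_forall D.energy_nonneg) ?_ hlim
  filter_upwards [eventually_gt_atTop a] with b hb
  rw [le_div_iff₀ (sub_pos.2 hb)]
  linarith [hle b hb.le]

/-- The vorticity and `T_x` relax to zero. -/
theorem tendsto_normL2 (D : SmallData f m σ ρ L u w T) :
    Tendsto (fun t => normL2 L (vort u w) t + normL2 L (dx T) t) atTop (𝓝 0) := by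
  have key : ∀ (g : ℝ → ℝ → ℝ → ℝ) (c : ℝ), ContPos g →
      (∀ t, 0 < t → Integrable (fun p : ℝ × ℝ => g p.1 p.2 t ^ 2) (cell L) ∧
        ∫ p : ℝ × ℝ, g p.1 p.2 t ^ 2 ∂(cell L) ≤ c * energy σ ρ L u w T t) →
      Tendsto (fun t => normL2 L g t) atTop (𝓝 0) := by
    intro g c hg h
    have hlim : Tendsto (fun t => ENNReal.ofReal (√(c * energy σ ρ L u w T t))) atTop (𝓝 0) := by
      have h1 := (D.tendsto_energy.const_mul c)
      rw [mul_zero] at h1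
      have h2 := ENNReal.tendsto_ofReal ((Real.continuous_sqrt.tendsto 0).comp h1)
      simpa using h2
    refine tendsto_of_tendsto_of_tendsto_of_le_of_le' tendsto_const_nhds hlim
      (Eventually.of_forall fun _ => zero_le) ?_
    filter_upwards [eventually_gt_atTop 0] with t ht
    obtain ⟨i, j⟩ := h t ht
    have hm : MemLp (fun p : ℝ × ℝ => g p.1 p.2 t) 2 (cell L) :=
      (memLp_two_iff_integrable_sq (hg.slice ht).aestronglyMeasurable).2 i
    rw [(integral_sq_of_memLp (hg.slice ht) hm.2.ne).2]
    exact ENNReal.ofReal_le_ofReal (Real.sqrt_le_sqrt j)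
  have h1 := key (vort u w) _ D.sol.sm_vort.contPos fun t ht =>
    ⟨D.integrable_vort_sq ht, (D.integral_sq_le_energy ht).2⟩
  have h2 := key (dx T) _ D.sol.sm_T.dx.contPos fun t ht =>
    ⟨D.integrable_dx_T_sq ht, (D.integral_sq_le_energy ht).1⟩
  simpa using h1.add h2

end SmallData

/-! ### The maximal vertical velocity -/

namespace SmallData
variable {f : ℝ → ℝ} {m σ ρ L : ℝ} {u w T : ℝ → ℝ → ℝ → ℝ}

/-- Since `w` has zero mean in `x`, its supremum is controlled by its second derivatives. -/
theorem sq_w_le (D : SmallData f m σ ρ L u w T) {t : ℝ} (ht : 0 < t)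
    (hH : Integrable (fun p : ℝ × ℝ => hDens w p.1 p.2 t) (cell L)) {x : ℝ} (hx : x ∈ Icc 0 L)
    (z : ℝ) :
    w x z t ^ 2 ≤ L * (1 + L ^ 2) * ∫ p : ℝ × ℝ, hDens w p.1 p.2 t ∂(cell L) := by
  have hL := D.L_pos
  have hw := D.sol.sm_w.hasGrad D.sol.per_w ht
  have hwx := D.sol.sm_w.dx.hasGrad D.sol.per_w.dx ht
  have hwxz := D.sol.sm_w.dx.dz.hasGrad D.sol.per_w.dx.dz ht
  have c1 := hwx.cont
  have c2 := hwx.cont_x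
  have c3 := hwx.cont_z
  have ch : Continuous fun q : ℝ × ℝ => hDens w q.1 q.2 t := D.contPos_hDens.slice ht
  obtain ⟨K, -, hK⟩ := D.sol.L2_dx_w.exists_bound (b := t) D.sol.sm_w.dx.contPos ht
  have i1 := (hK t ⟨le_rfl, le_rfl⟩).1
  have i2 : Integrable (fun p : ℝ × ℝ => dz (dx w) p.1 p.2 t * dx w p.1 p.2 t
      + dx w p.1 p.2 t * dz (dx w) p.1 p.2 t) (cell L) := by
    refine (i1.add hH).mono' (by fun_prop : Continuous _).aestronglyMeasurable
      (Eventually.of_forall fun p => ?_)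
    rw [Real.norm_eq_abs, abs_le]
    simp only [Pi.add_apply]
    unfold hDens
    constructor <;> nlinarith [sq_nonneg (dx w p.1 p.2 t + dz (dx w) p.1 p.2 t),
      sq_nonneg (dx w p.1 p.2 t - dz (dx w) p.1 p.2 t), sq_nonneg (dx (dx w) p.1 p.2 t),
      sq_nonneg (dz (dz w) p.1 p.2 t), sq_nonneg (dz (dx w) p.1 p.2 t)]
  have hG := le_integral_abs_deriv (fun z => (hwx.mul hwx).hasDerivAt_integral hL.le z)
    (continuous_iff_continuousAt.2 fun z =>
      (((hwxz.mul hwx).add (hwx.mul hwxz)).hasDerivAt_integral hL.le z).continuousAt)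
    (integrable_slice hL.le (by simpa only [pow_two] using i1)) (integrable_slice hL.le i2) z
  have hbd : ∫ y, |∫ x in (0 : ℝ)..L, (dz (dx w) x y t * dx w x y t
      + dx w x y t * dz (dx w) x y t)|
      ≤ ∫ y, (1 + L ^ 2) * ∫ x in (0 : ℝ)..L, hDens w x y t := by
    refine integral_mono (integrable_slice hL.le i2).abs
      ((integrable_slice hL.le hH).const_mul _) fun y => ?_
    have hs : Continuous fun x : ℝ => (x, y) := by fun_prop
    have s1 : Continuous fun x => dx w x y t := c1.comp hs
    have s2 : Continuous fun x => dx (dx w) x y t := c2.comp hs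
    have s3 : Continuous fun x => dz (dx w) x y t := c3.comp hs
    have sh : Continuous fun x => hDens w x y t := ch.comp hs
    have p1 := poincare hL (fun x => hwx.hx x y) s2 (hw.integral_x_eq_zero y)
    have p2 : ∫ x in (0 : ℝ)..L, dx (dx w) x y t ^ 2 ≤ ∫ x in (0 : ℝ)..L, hDens w x y t := by
      refine intervalIntegral.integral_mono_on hL.le ((s2.pow 2).intervalIntegrable _ _)
        (sh.intervalIntegrable _ _) fun x _ => ?_
      unfold hDens
      nlinarith [sq_nonneg (dz (dx w) x y t), sq_nonneg (dz (dz w) x y t)]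
    have p3 : |∫ x in (0 : ℝ)..L, (dz (dx w) x y t * dx w x y t
        + dx w x y t * dz (dx w) x y t)|
        ≤ ∫ x in (0 : ℝ)..L, (dx w x y t ^ 2 + hDens w x y t) := by
      refine (intervalIntegral.abs_integral_le_integral_abs hL.le).trans
        (intervalIntegral.integral_mono_on hL.le ?_ ?_ fun x _ => ?_)
      · exact Continuous.intervalIntegrable (by fun_prop) _ _
      · exact Continuous.intervalIntegrable (by fun_prop) _ _
      · rw [abs_le]
        unfold hDens
        constructor <;> nlinarith [sq_nonneg (dx w x y t + dz (dx w) x y t),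
          sq_nonneg (dx w x y t - dz (dx w) x y t), sq_nonneg (dx (dx w) x y t),
          sq_nonneg (dz (dz w) x y t), sq_nonneg (dz (dx w) x y t)]
    have s4 : Continuous fun x => dx w x y t ^ 2 := s1.pow 2
    rw [intervalIntegral.integral_add (s4.intervalIntegrable _ _)
      (sh.intervalIntegrable _ _)] at p3
    have p4 := mul_le_mul_of_nonneg_left p2 (sq_nonneg L)
    linarith
  have e1 := integral_cell_eq hL.le hH
  rw [integral_const_mul, ← e1] at hbd
  have p0 := sq_le_of_mean_zero hL (fun x => hw.hx x z)
    (hw.cont_x.comp (by fun_prop : Continuous fun x : ℝ => (x, z)))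
    (D.sol.integral_w_eq_zero hL ht z) hx
  have e2 : ∫ x in (0 : ℝ)..L, dx w x z t ^ 2 = ∫ x in (0 : ℝ)..L, dx w x z t * dx w x z t := by
    simp only [pow_two]
  rw [e2] at p0
  have p5 := mul_le_mul_of_nonneg_left (hG.trans hbd) hL.le
  linarith

/-- `w` is bounded by a continuous function of time with arbitrarily small mean growth: the
time integral of the square of `sup |w|` is finite because of the dissipation of energy. -/
theorem exists_velocity_majorant (D : SmallData f m σ ρ L u w T) {ε : ℝ} (hε : 0 < ε) :
    ∃ C : ℝ, 0 ≤ C ∧ ∀ τ : ℝ, ∃ W : ℝ → ℝ, Continuous W ∧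
      (∀ t ∈ Icc 0 τ, ∀ x z, |w x z t| ≤ W t) ∧
      ∀ t ∈ Icc 0 τ, ∫ s in (0 : ℝ)..t, W s ≤ C + ε * t := by
  have hL := D.L_pos
  obtain ⟨B, hB0, hB⟩ := D.sol.exists_bound_w hL 1
  set c : ℝ := L * (1 + L ^ 2) with hc
  have hc0 : 0 < c := by positivity
  set K : ℝ := c * (energy σ ρ L u w T 1 / dissCoeff ρ L) with hK
  have hK0 : 0 ≤ K := mul_nonneg hc0.le (div_nonneg (D.energy_nonneg 1) D.dissCoeff_pos.le)
  refine ⟨B + K / ε, by positivity, fun τ => ?_⟩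
  have hε2 : 0 < ε / 2 := by positivity
  -- beyond height `N` the velocity is negligible up to time `τ`
  obtain ⟨N, hN⟩ := far_of_limits (g := fun x z t => |w x z t|) (τ := τ) (δ := ε / 2)
    (((limitsTo_cocompact D.sol.w_infty).1.exists_far τ hε2).mono fun z h x t ht => by
      simpa using h x t ht)
    (((limitsTo_cocompact D.sol.w_infty).2.exists_far τ hε2).mono fun z h x t ht => by
      simpa using h x t ht)
  set S : Set (ℝ × ℝ) := Icc 0 L ×ˢ Icc (-|N|) |N| with hS
  have hSc : IsCompact S := isCompact_Icc.prod isCompact_Icc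
  have hSn : S.Nonempty := ⟨(0, 0), ⟨⟨le_rfl, hL.le⟩, ⟨by simp, by simp⟩⟩⟩
  set g : ℝ → ℝ × ℝ → ℝ := fun t p => |w p.1 p.2 (max t 0)| with hg
  have hgc : Continuous ↿g := by
    have : Continuous fun q : ℝ × ℝ × ℝ => w q.2.1 q.2.2 (max q.1 0) :=
      D.sol.regular_w.1.comp_continuous
        (f := fun q : ℝ × ℝ × ℝ => (q.2.1, q.2.2, max q.1 0)) (by fun_prop)
        (fun q => show (0 : ℝ) ≤ max q.1 0 from le_max_right _ _)
    exact this.abs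
  set M : ℝ → ℝ := fun t => sSup (g t '' S) with hM
  have hMc : Continuous M := hSc.continuous_sSup hgc
  have hMc2 : Continuous fun t => M t ^ 2 := hMc.pow 2
  have hgt : ∀ t, Continuous (g t) := fun t => hgc.comp (Continuous.prodMk_right t)
  have hatt : ∀ t, ∃ p ∈ S, M t = g t p := fun t => by
    obtain ⟨p, hp, h⟩ := (hSc.image (hgt t)).sSup_mem (hSn.image _)
    exact ⟨p, hp, h.symm⟩
  have hle : ∀ t, ∀ p ∈ S, g t p ≤ M t := fun t p hp =>
    le_csSup (hSc.image (hgt t)).bddAbove (mem_image_of_mem _ hp)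
  have hM0 : ∀ t, 0 ≤ M t := fun t => by
    obtain ⟨p, -, h⟩ := hatt t
    rw [h]; exact abs_nonneg _
  have hsq : ∀ t, 0 < t → ENNReal.ofReal (M t ^ 2) ≤ ENNReal.ofReal c *
      ∫⁻ p : ℝ × ℝ, ENNReal.ofReal (hDens w p.1 p.2 t) ∂(cell L) := fun t ht => by
    by_cases htop : ∫⁻ p : ℝ × ℝ, ENNReal.ofReal (hDens w p.1 p.2 t) ∂(cell L) = ⊤
    · rw [htop, ENNReal.mul_top (by simpa using hc0)]; exact le_top
    have hi : Integrable (fun p : ℝ × ℝ => hDens w p.1 p.2 t) (cell L) := by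
      refine (lintegral_ofReal_ne_top_iff_integrable
        (D.contPos_hDens.slice ht).aestronglyMeasurable
        (Eventually.of_forall fun p => hDens_nonneg w p.1 p.2 t)).1 htop
    obtain ⟨p, hp, h⟩ := hatt t
    rw [← ofReal_integral_eq_lintegral_ofReal hi
      (Eventually.of_forall fun p => hDens_nonneg w p.1 p.2 t), ← ENNReal.ofReal_mul hc0.le, h]
    refine ENNReal.ofReal_le_ofReal ?_
    simp only [hg, max_eq_left ht.le, sq_abs]
    exact D.sq_w_le ht hi hp.1 p.2
  have hI : ∀ b, 1 ≤ b → ∫ t in (1 : ℝ)..b, M t ^ 2 ≤ K := fun b hb => by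
    have h1 := lintegral_le_of_cutInt_le (fun n => (isCutoff_cut n).cont)
      (fun n => (isCutoff_cut n).supp) cut_nonneg tendsto_cut D.contPos_hDens
      (fun x z t _ => hDens_nonneg w x z t) one_pos hb (e := fun _ => 0)
      (K := energy σ ρ L u w T 1 / dissCoeff ρ L) tendsto_const_nhds
      (fun n => by
        refine (D.integral_hDens_le one_pos hb n).trans ?_
        rw [add_zero]
        exact div_le_div_of_nonneg_right (by linarith [D.energy_nonneg b]) D.dissCoeff_pos.le)
    have h2 : ∫⁻ t in Ioc 1 b, ENNReal.ofReal (M t ^ 2)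
        ≤ ∫⁻ t in Ioc 1 b, ENNReal.ofReal c *
          ∫⁻ p : ℝ × ℝ, ENNReal.ofReal (hDens w p.1 p.2 t) ∂(cell L) :=
      setLIntegral_mono' measurableSet_Ioc fun t ht => hsq t (one_pos.trans ht.1)
    rw [lintegral_const_mul' _ _ ENNReal.ofReal_ne_top] at h2
    have h3 := h2.trans (mul_le_mul_right h1 _)
    rw [← ENNReal.ofReal_mul hc0.le, ← ofReal_integral_eq_lintegral_ofReal
      hMc2.integrableOn_Ioc (Eventually.of_forall fun t => sq_nonneg _),
      ENNReal.ofReal_le_ofReal_iff hK0] at h3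
    rwa [intervalIntegral.integral_of_le hb]
  refine ⟨fun t => M t + ε / 2, by fun_prop, fun t ht x z => ?_, fun t ht => ?_⟩
  · rcases le_or_gt N |z| with h | h
    · have := hN x z t ht h
      linarith [hM0 t]
    · obtain ⟨y, hy, e⟩ := exists_period_rep hL D.sol.periodic_w x z t ht.1
      have := hle t (y, z) ⟨hy, abs_le.1 (h.le.trans (le_abs_self N))⟩
      simp only [hg, max_eq_left ht.1] at this
      rw [e]
      linarith
  · have hii : ∀ a b, IntervalIntegrable M volume a b := fun a b => hMc.intervalIntegrable a b
    rw [intervalIntegral.integral_add (hii _ _) intervalIntegrable_const,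
      intervalIntegral.integral_const, smul_eq_mul, sub_zero]
    have hMB : ∀ s ∈ Icc (0 : ℝ) 1, M s ≤ B := fun s hs => by
      obtain ⟨p, -, h⟩ := hatt s
      rw [h]
      simp only [hg, max_eq_left hs.1]
      exact hB _ _ s hs
    have h01 : ∀ b ∈ Icc (0 : ℝ) 1, ∫ s in (0 : ℝ)..b, M s ≤ B := fun b hb => by
      have h1 := intervalIntegral.integral_mono_on hb.1 (hii 0 b)
        (intervalIntegrable_const (c := B)) fun s hs => hMB s ⟨hs.1, hs.2.trans hb.2⟩
      rw [intervalIntegral.integral_const, smul_eq_mul, sub_zero] at h1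
      nlinarith [hb.2]
    have hKε : 0 ≤ K / ε := by positivity
    rcases le_total t 1 with h1 | h1
    · have := h01 t ⟨ht.1, h1⟩
      have := mul_nonneg hε.le ht.1
      linarith
    · have h2 := intervalIntegral.integral_mono_on h1 (hii 1 t)
        (((hMc2.div_const ε).add_const (ε / 4)).intervalIntegrable (μ := volume) 1 t)
        (g := fun s => M s ^ 2 / ε + ε / 4) fun s _ => by
          rw [div_add' _ _ _ hε.ne', le_div_iff₀ hε]
          nlinarith [sq_nonneg (M s - ε / 2)]
      rw [intervalIntegral.integral_add ((hMc2.div_const ε).intervalIntegrable _ _)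
        intervalIntegrable_const, intervalIntegral.integral_const, smul_eq_mul,
        intervalIntegral.integral_div] at h2
      have h3 := div_le_div_of_nonneg_right (hI t h1) hε.le
      have h4 := h01 1 ⟨zero_le_one, le_rfl⟩
      rw [← intervalIntegral.integral_add_adjacent_intervals (hii 0 1) (hii 1 t)]
      nlinarith

end SmallData

/-! ### Exponential barriers for KPP fronts -/

namespace IsConcaveKPP
variable {f : ℝ → ℝ} {m s : ℝ}

theorem nonneg (h : IsConcaveKPP f) (hs : s ∈ Icc (0 : ℝ) 1) : 0 ≤ f s := by
  rcases eq_or_lt_of_le hs.1 with h0 | h0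
  · rw [← h0, h.zero]
  rcases eq_or_lt_of_le hs.2 with h1 | h1
  · rw [h1, h.one]
  exact (h.pos s ⟨h0, h1⟩).le

theorem le_self (h : IsConcaveKPP f) (hs : s ∈ Icc (0 : ℝ) 1) : f s ≤ s := by
  have hd : Differentiable ℝ f := h.smooth.differentiable (by simp)
  have hd1 : ContDiff ℝ 1 (deriv f) :=
    ((contDiff_succ_iff_deriv (n := 1)).1 (h.smooth.of_le (by norm_cast))).2.2
  obtain ⟨M, hM, hM'⟩ := h.concave
  have hanti : AntitoneOn (deriv f) (Icc 0 1) :=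
    antitoneOn_of_deriv_nonpos (convex_Icc 0 1) hd1.continuous.continuousOn
      (hd1.differentiable (by norm_num)).differentiableOn fun x hx => by
        have := hM' x (interior_subset hx)
        linarith
  have hanti2 : AntitoneOn (fun x => f x - x) (Icc 0 1) := by
    refine antitoneOn_of_deriv_nonpos (convex_Icc 0 1)
      (hd.continuous.sub continuous_id).continuousOn
      (hd.sub differentiable_id).differentiableOn fun x hx => ?_
    have hx' : x ∈ Icc (0 : ℝ) 1 := interior_subset hx
    have h1 := hanti ⟨le_rfl, zero_le_one⟩ hx' hx'.1
    rw [h.slope_zero] at h1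
    have h2 : HasDerivAt (fun x => f x - x) (deriv f x - 1) x :=
      (hd x).hasDerivAt.sub (hasDerivAt_id x)
    rw [h2.deriv]
    linarith
  have := hanti2 ⟨le_rfl, zero_le_one⟩ hs hs.1
  simp only [h.zero] at this
  linarith

/-- The reaction is dominated by the logistic one. -/
theorem le_logistic (h : IsConcaveKPP f) (hm : ∀ s ∈ Icc (0 : ℝ) 1, |deriv f s| ≤ m)
    (hs : s ∈ Icc (0 : ℝ) 1) : f s ≤ 2 * (1 + m) * (s - s * s) := by
  have h1 := h.le_self hs
  have h2 := (convex_Icc (0 : ℝ) 1).norm_image_sub_le_of_norm_deriv_le (f := f) (C := m)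
    (fun x _ => h.smooth.differentiable (by simp) x) (fun x hx => hm x hx)
    (⟨zero_le_one, le_rfl⟩ : (1 : ℝ) ∈ Icc (0 : ℝ) 1) hs
  have hm0 : 0 ≤ m := (abs_nonneg _).trans (hm 0 ⟨le_rfl, zero_le_one⟩)
  rw [h.one, sub_zero, Real.norm_eq_abs, Real.norm_eq_abs, abs_sub_comm,
    abs_of_nonneg (sub_nonneg.2 hs.2)] at h2
  have h3 := (le_abs_self _).trans h2
  have h0 := hs.1
  have h4 := hs.2
  rcases le_total s (1 / 2) with h5 | h5
  · nlinarith [mul_nonneg hm0 (mul_nonneg h0 (sub_nonneg.2 h4)),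
      mul_nonneg h0 (sub_nonneg.2 h5)]
  · nlinarith [mul_nonneg h0 (sub_nonneg.2 h4), mul_nonneg (mul_nonneg hm0 (sub_nonneg.2 h4))
      (sub_nonneg.2 h5)]

end IsConcaveKPP

/-- A solution with a concave KPP reaction and front-like initial temperature, under the
smallness conditions of `SmallData`. -/
structure FrontData (f : ℝ → ℝ) (m σ ρ L : ℝ) (u w T : ℝ → ℝ → ℝ → ℝ) : Prop
    extends SmallData f m σ ρ L u w T where
  kpp : IsConcaveKPP f
  front : FrontLike T

/-- A moving exponential profile `exp (α + a z + q t)` stays above the affine image `c + s T` of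
the temperature when its exponent grows faster than diffusion, advection and reaction allow. -/
theorem IsSolution.le_exp {f : ℝ → ℝ} {σ ρ L : ℝ} {u w T : ℝ → ℝ → ℝ → ℝ}
    (h : IsSolution f σ ρ L u w T) (hL : 0 < L) {c s κ α a τ : ℝ} {q q' : ℝ → ℝ}
    (hq : ∀ t, HasDerivAt q (q' t) t) (hq0 : q 0 = 0)
    (hfar : ∀ δ > 0, ∃ N : ℝ, ∀ x z, ∀ t ∈ Icc 0 τ, N ≤ |z| →
      c + s * T x z t - Real.exp (α + a * z + q t) < δ)
    (h0 : ∀ x z, c + s * T x z 0 ≤ Real.exp (α + a * z))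
    (hf : ∀ x z, ∀ t ∈ Icc 0 τ, s * f (T x z t) ≤ κ * (c + s * T x z t))
    (hq' : ∀ x z, ∀ t ∈ Icc 0 τ, a ^ 2 - a * w x z t + κ ≤ q' t) :
    ∀ x z, ∀ t ∈ Icc 0 τ, c + s * T x z t ≤ Real.exp (α + a * z + q t) := by
  have hqc : Continuous q := continuous_iff_continuousAt.2 fun t => (hq t).continuousAt
  suffices H : ∀ x z, ∀ t ∈ Icc 0 τ, c + s * T x z t - Real.exp (α + a * z + q t) ≤ 0 from
    fun x z t ht => by linarith [H x z t ht]
  refine comparison (g := fun x z t => c + s * T x z t - Real.exp (α + a * z + q t)) (K := κ) hL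
    ?_ ?_ hfar (fun x z => by simpa [hq0] using h0 x z) ?_
  · have := h.regular_T.1
    exact ((continuousOn_const.add (continuousOn_const.mul this)).sub
      (by fun_prop : Continuous fun p : ℝ × ℝ × ℝ =>
        Real.exp (α + a * p.2.1 + q p.2.2)).continuousOn)
  · intro x z t ht
    simp only [h.periodic_T x z t ht]
  · intro x z t ht htτ hpos hx hz
    set E : ℝ := Real.exp (α + a * z + q t) with hE
    have hE0 : 0 < E := Real.exp_pos _
    have smT := h.sm_T
    have dE : ∀ y, HasDerivAt (fun y => Real.exp (α + a * y + q t))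
        (a * Real.exp (α + a * y + q t)) y := fun y => by
      have := ((((hasDerivAt_id y).const_mul a).const_add α).add_const (q t)).exp
      refine this.congr_deriv ?_
      simp only [id]; ring
    have gx : ∀ y, HasDerivAt (fun y => c + s * T y z t - Real.exp (α + a * z + q t))
        (s * dx T y z t) y := fun y =>
      (((smT.hasDerivAt_x ht).const_mul s).const_add c).sub_const _
    have gz : ∀ y, HasDerivAt (fun y => c + s * T x y t - Real.exp (α + a * y + q t))
        (s * dz T x y t - a * Real.exp (α + a * y + q t)) y := fun y =>
      (((smT.hasDerivAt_z ht).const_mul s).const_add c).sub (dE y)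
    obtain ⟨x1, x2⟩ := deriv_deriv_of_max (gx x).continuousAt hx
    obtain ⟨z1, z2⟩ := deriv_deriv_of_max (gz z).continuousAt hz
    rw [funext fun y => (gx y).deriv, ((smT.dx.hasDerivAt_x ht).const_mul s).deriv] at x2
    have gzz : HasDerivAt (fun y => s * dz T x y t - a * Real.exp (α + a * y + q t))
        (s * dz (dz T) x z t - a * (a * Real.exp (α + a * z + q t))) z :=
      ((smT.dz.hasDerivAt_z ht).const_mul s).sub ((dE z).const_mul a)
    rw [funext fun y => (gz y).deriv, gzz.deriv] at z2
    rw [(gx x).deriv] at x1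
    rw [(gz z).deriv] at z1
    refine ⟨_, ((((smT.hasDerivAt_t ht).const_mul s).const_add c).sub
      ((((hq t).const_add (α + a * z))).exp)), ?_⟩
    rw [h.dt_T ht]
    have e1 := hf x z t ⟨ht.le, htτ⟩
    have e2 := mul_le_mul_of_nonneg_right (hq' x z t ⟨ht.le, htτ⟩) hE0.le
    have e3 : s * (dx (dx T) x z t + dz (dz T) x z t - u x z t * dx T x z t
        - w x z t * dz T x z t + f (T x z t)) = s * dx (dx T) x z t
        + s * dz (dz T) x z t - u x z t * (s * dx T x z t) - w x z t * (s * dz T x z t)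
        + s * f (T x z t) := by ring
    have e4 : s * dz T x z t = a * E := by linarith
    rw [e3, x1, e4]
    simp only [← hE] at z2 ⊢
    linarith

namespace FrontData
variable {f : ℝ → ℝ} {m σ ρ L : ℝ} {u w T : ℝ → ℝ → ℝ → ℝ}

/-- The front advances at most at speed `2 + ε`, up to a bounded shift. -/
theorem exists_T_le_exp (D : FrontData f m σ ρ L u w T) {ε : ℝ} (hε : 0 < ε) :
    ∃ C : ℝ, 0 ≤ C ∧ ∀ x z t, 0 ≤ t → T x z t ≤ Real.exp (C + (2 + ε) * t - z) := by
  have hL := D.L_pos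
  obtain ⟨C, hC, hW⟩ := D.exists_velocity_majorant hε
  obtain ⟨⟨α, hα⟩, -⟩ := D.front
  refine ⟨|α| + C, by positivity, fun x z τ hτ => ?_⟩
  obtain ⟨W, hWc, hwW, hWint⟩ := hW τ
  have hq : ∀ t, HasDerivAt (fun t => 2 * t + ∫ s in (0 : ℝ)..t, W s) (2 + W t) t := fun t => by
    refine HasDerivAt.add ?_ (hWc.integral_hasStrictDerivAt 0 t).hasDerivAt
    simpa using (hasDerivAt_id t).const_mul 2
  have hq0 : ∀ t ∈ Icc 0 τ, 0 ≤ 2 * t + ∫ s in (0 : ℝ)..t, W s := fun t ht =>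
    add_nonneg (by linarith [ht.1]) (intervalIntegral.integral_nonneg ht.1 fun s hs =>
      (abs_nonneg _).trans (hwW s ⟨hs.1, hs.2.trans ht.2⟩ 0 0))
  have key := D.sol.le_exp hL (c := 0) (s := 1) (κ := 1) (α := α) (a := -1) (τ := τ) hq (by simp)
    (fun δ hδ => by
      refine far_of_limits (g := fun x z t => 0 + 1 * T x z t
        - Real.exp (α + -1 * z + (2 * t + ∫ s in (0 : ℝ)..t, W s))) ?_ ?_
      · filter_upwards [eventually_le_atBot (α - 1)] with z hz x t ht
        have h1 := Real.add_one_le_exp (α + -1 * z + (2 * t + ∫ s in (0 : ℝ)..t, W s))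
        have h2 := (D.T_mem x z t ht.1).2
        linarith [hq0 t ht]
      · filter_upwards [D.sol.T_top.exists_far τ hδ] with z hz x t ht
        have h1 := (abs_lt.1 (hz x t ht)).2
        linarith [Real.exp_pos (α + -1 * z + (2 * t + ∫ s in (0 : ℝ)..t, W s))])
    (fun x z => by
      have := hα x z
      rw [show α + -1 * z = α - z by ring]
      linarith)
    (fun x z t ht => by
      have := D.kpp.le_self (D.T_mem x z t ht.1)
      linarith)
    (fun x z t ht => by
      have := (le_abs_self _).trans (hwW t ht x z)
      linarith) x z τ ⟨hτ, le_rfl⟩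
  rw [zero_add, one_mul] at key
  refine key.trans (Real.exp_le_exp.2 ?_)
  have := hWint τ ⟨hτ, le_rfl⟩
  linarith [le_abs_self α]

/-- Behind the front the temperature is exponentially close to one. -/
theorem exists_one_sub_T_le_exp (D : FrontData f m σ ρ L u w T) (τ : ℝ) :
    ∃ A a : ℝ, 0 < a ∧ ∀ x z, ∀ t ∈ Icc 0 τ, 1 - T x z t ≤ Real.exp (A + a * z) := by
  have hL := D.L_pos
  obtain ⟨-, α, a, ha, hα⟩ := D.front
  obtain ⟨B, hB0, hB⟩ := D.sol.exists_bound_w hL τ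
  refine ⟨α + (a ^ 2 + a * B) * |τ|, a, ha, fun x z t ht => ?_⟩
  have hb : 0 ≤ a ^ 2 + a * B := by positivity
  have key := D.sol.le_exp hL (c := 1) (s := -1) (κ := 0) (α := α) (a := a) (τ := τ)
    (q := fun t => (a ^ 2 + a * B) * t) (q' := fun _ => a ^ 2 + a * B)
    (fun t => by simpa using (hasDerivAt_id t).const_mul (a ^ 2 + a * B)) (by simp)
    (fun δ hδ => by
      refine far_of_limits (g := fun x z t => 1 + -1 * T x z t
        - Real.exp (α + a * z + (a ^ 2 + a * B) * t)) ?_ ?_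
      · filter_upwards [D.sol.T_bot.exists_far τ hδ] with z hz x t ht
        have h1 := (abs_lt.1 (hz x t ht)).1
        linarith [Real.exp_pos (α + a * z + (a ^ 2 + a * B) * t)]
      · filter_upwards [eventually_ge_atTop (-α / a)] with z hz x t ht
        have h1 := Real.add_one_le_exp (α + a * z + (a ^ 2 + a * B) * t)
        have h2 := (D.T_mem x z t ht.1).1
        rw [div_le_iff₀ ha] at hz
        linarith [mul_nonneg hb ht.1])
    (fun x z => by linarith [hα x z])
    (fun x z t ht => by
      have := D.kpp.nonneg (D.T_mem x z t ht.1)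
      linarith)
    (fun x z t ht => by
      have := mul_le_mul_of_nonneg_left ((neg_le_abs _).trans (hB x z t ht)) ha.le
      linarith) x z t ht
  have h1 : (a ^ 2 + a * B) * t ≤ (a ^ 2 + a * B) * |τ| :=
    mul_le_mul_of_nonneg_left (ht.2.trans (le_abs_self _)) hb
  have h2 := Real.exp_le_exp.2 (show α + a * z + (a ^ 2 + a * B) * t
    ≤ α + (a ^ 2 + a * B) * |τ| + a * z by linarith)
  linarith

/-- On bounded time intervals `T (1 - T)` decays faster than `(1 + z²)⁻³`. -/
theorem exists_decay (D : FrontData f m σ ρ L u w T) (τ : ℝ) :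
    ∃ K : ℝ, 0 ≤ K ∧ ∀ x z, ∀ t ∈ Icc 0 τ,
      (1 + z ^ 2) ^ 3 * (T x z t - T x z t * T x z t) ≤ K := by
  obtain ⟨C, -, h1⟩ := D.exists_T_le_exp one_pos
  obtain ⟨A, a, ha, h2⟩ := D.exists_one_sub_T_le_exp τ
  have key : ∀ c : ℝ, 0 < c → ∃ K : ℝ, 0 ≤ K ∧ ∀ y : ℝ, 0 ≤ y →
      (1 + y ^ 2) ^ 3 * Real.exp (-(c * y)) ≤ K := fun c hc => by
    refine ⟨720 / c ^ 6 * Real.exp c, by positivity, fun y hy => ?_⟩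
    have e1 := Real.pow_div_factorial_le_exp (c * (1 + y)) (by positivity) 6
    have e2 : (1 + y ^ 2) ^ 3 ≤ (1 + y) ^ 6 := by
      rw [show (1 + y) ^ 6 = ((1 + y) ^ 2) ^ 3 by ring]
      exact pow_le_pow_left₀ (by positivity) (by nlinarith) 3
    have e3 : (1 + y) ^ 6 ≤ 720 / c ^ 6 * Real.exp (c * (1 + y)) := by
      rw [div_mul_eq_mul_div, le_div_iff₀ (by positivity)]
      rw [div_le_iff₀ (by positivity)] at e1
      calc (1 + y) ^ 6 * c ^ 6 = (c * (1 + y)) ^ 6 := by ring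
        _ ≤ _ := e1
        _ = _ := by norm_num [Nat.factorial]; ring
    calc (1 + y ^ 2) ^ 3 * Real.exp (-(c * y))
        ≤ 720 / c ^ 6 * Real.exp (c * (1 + y)) * Real.exp (-(c * y)) :=
          mul_le_mul_of_nonneg_right (e2.trans e3) (Real.exp_pos _).le
      _ = 720 / c ^ 6 * Real.exp c := by
          rw [mul_assoc, ← Real.exp_add]; congr 2; ring
  obtain ⟨K₁, hK₁, k1⟩ := key 1 one_pos
  obtain ⟨K₂, hK₂, k2⟩ := key a ha
  refine ⟨Real.exp (C + 3 * |τ|) * K₁ + Real.exp A * K₂, by positivity, fun x z t ht => ?_⟩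
  obtain ⟨T0, T1⟩ := D.T_mem x z t ht.1
  have hp : 0 ≤ (1 + z ^ 2) ^ 3 := by positivity
  rcases le_total 0 z with hz | hz
  · have e1 : T x z t ≤ Real.exp (C + 3 * |τ|) * Real.exp (-(1 * z)) := by
      rw [← Real.exp_add]
      refine (h1 x z t ht.1).trans (Real.exp_le_exp.2 ?_)
      linarith [ht.2, le_abs_self τ]
    have e2 := mul_le_mul_of_nonneg_left (k1 z hz) (Real.exp_pos (C + 3 * |τ|)).le
    have e3 : T x z t - T x z t * T x z t ≤ T x z t := by nlinarith
    have e4 := mul_le_mul_of_nonneg_left (e3.trans e1) hp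
    have e5 : 0 ≤ Real.exp A * K₂ := by positivity
    linarith
  · have e1 : 1 - T x z t ≤ Real.exp A * Real.exp (-(a * -z)) := by
      rw [← Real.exp_add]
      exact (h2 x z t ht).trans (Real.exp_le_exp.2 (by linarith))
    have e2 := mul_le_mul_of_nonneg_left (k2 (-z) (by linarith)) (Real.exp_pos A).le
    rw [neg_sq] at e2
    have e3 : T x z t - T x z t * T x z t ≤ 1 - T x z t := by nlinarith
    have e4 := mul_le_mul_of_nonneg_left (e3.trans e1) hp
    have e5 : 0 ≤ Real.exp (C + 3 * |τ|) * K₁ := by positivity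
    linarith

end FrontData

/-! ### Weighted estimates for the temperature gradient and `T_t` -/

/-- The square of a cutoff is a cutoff. -/
theorem IsCutoff.sq {ψ ψ' ψ'' : ℝ → ℝ} (h : IsCutoff ψ ψ' ψ'') :
    IsCutoff (fun z => ψ z ^ 2) (fun z => 2 * ψ z * ψ' z)
      (fun z => 2 * ψ' z ^ 2 + 2 * ψ z * ψ'' z) where
  deriv₁ z := ((h.deriv₁ z).pow 2).congr_deriv (by norm_num)
  deriv₂ z := (((h.deriv₁ z).const_mul 2).mul (h.deriv₂ z)).congr_deriv (by ring)
  cont₂ := by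
    have c0 := h.cont
    have c1 := h.cont₁
    have c2 := h.cont₂
    fun_prop
  supp := h.supp.comp_left (g := fun y => y ^ 2) (by simp)

/-- The cutoff functions `(1 + z²) cut n` and their derivatives are of size `1 + z²`, uniformly
in `n`. -/
theorem exists_weighted_cutoff : ∃ C : ℝ, 0 ≤ C ∧ ∀ n : ℕ, ∃ ψ' ψ'' : ℝ → ℝ,
    IsCutoff (fun z => (1 + z ^ 2) * cut n z) ψ' ψ'' ∧
      ∀ z, |ψ' z| ≤ C * (1 + z ^ 2) ∧ |ψ'' z| ≤ C * (1 + z ^ 2) := by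
  obtain ⟨C, hC0, hC⟩ := exists_cut_bound
  refine ⟨2 + 3 * C, by positivity, fun n => ⟨fun z => 2 * z * cut n z + (1 + z ^ 2) * cut₁ n z,
    fun z => 2 * cut n z + 4 * z * cut₁ n z + (1 + z ^ 2) * cut₂ n z, ?_, fun z => ?_⟩⟩
  · have h := isCutoff_cut n
    have c0 := h.cont
    have c1 := h.cont₁
    have c2 := h.cont₂
    have hp : ∀ z : ℝ, HasDerivAt (fun z : ℝ => 1 + z ^ 2) (2 * z) z := fun z => by
      simpa using ((hasDerivAt_id z).pow 2).const_add 1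
    have hz : ∀ z : ℝ, HasDerivAt (fun z : ℝ => 2 * z) 2 z := fun z => by
      simpa using (hasDerivAt_id z).const_mul 2
    exact
      { deriv₁ := fun z => (hp z).mul (h.deriv₁ z)
        deriv₂ := fun z => (((hz z).mul (h.deriv₁ z)).add
          ((hp z).mul (h.deriv₂ z))).congr_deriv (by ring)
        cont₂ := by fun_prop
        supp := h.supp.mul_left }
  · have hn : C / ((n : ℝ) + 1) ≤ C := div_le_self hC0 (by linarith [n.cast_nonneg (α := ℝ)])
    have b1 := ((hC n).1 z).trans hn
    have b2 := ((hC n).2.1 z).trans hn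
    have b0 : |cut n z| ≤ 1 := by
      rw [abs_of_nonneg (cut_nonneg n z)]; exact cut_le_one n z
    have hz : 2 * |z| ≤ 1 + z ^ 2 := by nlinarith [sq_nonneg (|z| - 1), sq_abs z]
    have hp : |1 + z ^ 2| = 1 + z ^ 2 := abs_of_nonneg (by positivity)
    have hp0 : (0 : ℝ) ≤ 1 + z ^ 2 := by positivity
    have m0 := mul_le_mul hz b0 (abs_nonneg _) hp0
    have m1 := mul_le_mul_of_nonneg_left b1 hp0
    have m2 := mul_le_mul_of_nonneg_left b2 hp0
    have m3 := mul_le_mul hz b1 (abs_nonneg _) hp0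
    have hCz : 0 ≤ C * (1 + z ^ 2) := by positivity
    constructor
    · refine (abs_add_le _ _).trans ?_
      simp only [abs_mul, hp, abs_two]
      linarith
    · refine (abs_add_three _ _ _).trans ?_
      simp only [abs_mul, hp, abs_two, abs_of_pos (four_pos : (0 : ℝ) < 4)]
      nlinarith

/-- Young's inequality for the cross term produced by a squared cutoff. -/
theorem abs_cutInt_cross_le {L : ℝ} {ψ ψ' ψ'' : ℝ → ℝ} (h : IsCutoff ψ ψ' ψ'')
    {a b : ℝ → ℝ → ℝ} (ha : Continuous fun q : ℝ × ℝ => a q.1 q.2)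
    (hb : Continuous fun q : ℝ × ℝ => b q.1 q.2) :
    |cutInt L (fun z => 2 * ψ z * ψ' z) (fun x z => a x z * b x z)|
      ≤ 1 / 4 * cutInt L (fun z => ψ z ^ 2) (fun x z => a x z ^ 2)
        + 4 * cutInt L (fun z => ψ' z ^ 2) (fun x z => b x z ^ 2) := by
  have c0 := h.cont
  have c1 := h.cont₁
  have i1 := integrable_cutoff (η := fun z => ψ z ^ 2) (by fun_prop)
    (h.supp.comp_left (g := fun y => y ^ 2) (by simp)) L (F := fun x z => a x z ^ 2) (by fun_prop)
  have i2 := integrable_cutoff (η := fun z => ψ' z ^ 2) (by fun_prop)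
    (h.supp₁.comp_left (g := fun y => y ^ 2) (by simp)) L (F := fun x z => b x z ^ 2)
    (by fun_prop)
  unfold cutInt
  rw [← integral_const_mul, ← integral_const_mul, ← integral_add (i1.const_mul _) (i2.const_mul _)]
  rw [← Real.norm_eq_abs]
  refine norm_integral_le_of_norm_le ((i1.const_mul _).add (i2.const_mul _))
    (Eventually.of_forall fun p => ?_)
  rw [Real.norm_eq_abs, abs_le]
  beta_reduce
  constructor <;> nlinarith [sq_nonneg (ψ p.2 * a p.1 p.2 / 2 - 2 * (ψ' p.2 * b p.1 p.2)),
    sq_nonneg (ψ p.2 * a p.1 p.2 / 2 + 2 * (ψ' p.2 * b p.1 p.2))]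

theorem integrable_cell_inv {L : ℝ} (hL : 0 ≤ L) :
    Integrable (fun p : ℝ × ℝ => (1 + p.2 ^ 2)⁻¹) (cell L) :=
  (integral_cell_of_z hL integrable_inv_one_add_sq).1

/-- Fields decaying like `(1 + z²)⁻³` have integrals bounded uniformly over weights of size
`(1 + z²)²`. -/
theorem abs_cutInt_le_of_decay {L c K : ℝ} (hL : 0 ≤ L) (hc : 0 ≤ c) {η : ℝ → ℝ}
    {F : ℝ → ℝ → ℝ}
    (hη : ∀ z, |η z| ≤ c * (1 + z ^ 2) ^ 2) (hF : ∀ x z, (1 + z ^ 2) ^ 3 * |F x z| ≤ K) :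
    |cutInt L η F| ≤ c * (K * ∫ p : ℝ × ℝ, (1 + p.2 ^ 2)⁻¹ ∂(cell L)) := by
  unfold cutInt
  rw [← integral_const_mul, ← integral_const_mul]
  rw [← Real.norm_eq_abs]
  refine norm_integral_le_of_norm_le (((integrable_cell_inv hL).const_mul K).const_mul c)
    (Eventually.of_forall fun p => ?_)
  have hp : (0 : ℝ) < 1 + p.2 ^ 2 := by positivity
  rw [norm_mul, Real.norm_eq_abs, Real.norm_eq_abs, ← div_eq_mul_inv, ← mul_div_assoc,
    le_div_iff₀ hp]
  calc |η p.2| * |F p.1 p.2| * (1 + p.2 ^ 2)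
      ≤ c * (1 + p.2 ^ 2) ^ 2 * |F p.1 p.2| * (1 + p.2 ^ 2) := by
        gcongr
        exact hη p.2
    _ = c * ((1 + p.2 ^ 2) ^ 3 * |F p.1 p.2|) := by ring
    _ ≤ c * K := mul_le_mul_of_nonneg_left (hF _ _) hc

namespace FrontData
variable {f : ℝ → ℝ} {m σ ρ L : ℝ} {u w T : ℝ → ℝ → ℝ → ℝ} {a b : ℝ}

/-- Reaction and boundary terms in the weighted estimates: everything dominated by `T - T²`
decays in `z`, uniformly on bounded time intervals. -/
theorem exists_decay_f (D : FrontData f m σ ρ L u w T) (τ : ℝ) :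
    ∃ K : ℝ, 0 ≤ K ∧ ∀ x z, ∀ t ∈ Icc 0 τ,
      (1 + z ^ 2) ^ 3 * (T x z t - T x z t * T x z t) ≤ K ∧ (1 + z ^ 2) ^ 3 * f (T x z t) ≤ K := by
  obtain ⟨K, hK, h⟩ := D.exists_decay τ
  have hm := D.m_nonneg
  refine ⟨2 * (1 + m) * K + K, by positivity, fun x z t ht => ⟨?_, ?_⟩⟩
  · have : 0 ≤ 2 * (1 + m) * K := by positivity
    linarith [h x z t ht]
  · have h1 := D.kpp.le_logistic D.slope (D.T_mem x z t ht.1)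
    have h2 := mul_le_mul_of_nonneg_left h1 (by positivity : (0 : ℝ) ≤ (1 + z ^ 2) ^ 3)
    have h3 := mul_le_mul_of_nonneg_left (h x z t ht) (by positivity : 0 ≤ 2 * (1 + m))
    linarith

theorem contPos_f (D : FrontData f m σ ρ L u w T) : ContPos (fun x z t => f (T x z t)) :=
  D.smooth.continuous.comp_continuousOn D.sol.sm_T.contPos

/-- The evolution of `T - T²` bounds the weighted Dirichlet integral of the temperature. -/
theorem exists_weighted_grad_bound (D : FrontData f m σ ρ L u w T) (ha : 0 < a) (hab : a ≤ b) :
    ∃ K : ℝ, 0 ≤ K ∧ ∀ (η : ℝ → ℝ) (c : ℝ), Continuous η → HasCompactSupport η →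
      (∀ z, 0 ≤ η z) → 0 < c → (∀ z, η z ≤ c * (1 + z ^ 2) ^ 2) →
      ∫ t in a..b, cutInt L η (fun x z => dx T x z t ^ 2 + dz T x z t ^ 2) ≤ c * K := by
  have hL := D.L_pos
  obtain ⟨C, hC0, hC⟩ := exists_weighted_cutoff
  obtain ⟨K, hK0, hK⟩ := D.exists_decay_f b
  obtain ⟨B, hB0, hB⟩ := D.sol.exists_bound_w hL b
  set J : ℝ := ∫ p : ℝ × ℝ, (1 + p.2 ^ 2)⁻¹ ∂(cell L) with hJ
  have hJ0 : 0 ≤ J := integral_nonneg fun p => by positivity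
  set A : ℝ := (2 * C ^ 2 + 2 * C) * (K * J) + 2 * C * (B * K * J) + 1 * (K * J) with hA
  set K' : ℝ := (1 * (K * J) + (b - a) * A) / 2 with hK'
  have hba : 0 ≤ b - a := sub_nonneg.2 hab
  have hK'0 : 0 ≤ K' := by positivity
  have cT : ContPos T := D.sol.sm_T.contPos
  have cTt : ContPos (dt T) := D.sol.sm_T.dt.contPos
  have ch : ContPos (fun x z t => T x z t - T x z t * T x z t) := by
    unfold ContPos at *; fun_prop
  have chd : ContPos (fun x z t => (1 - 2 * T x z t) * dt T x z t) := by
    unfold ContPos at *; fun_prop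
  have cg : ContPos (fun x z t => dx T x z t ^ 2 + dz T x z t ^ 2) := by
    have c1 := D.sol.sm_T.dx.contPos
    have c2 := D.sol.sm_T.dz.contPos
    unfold ContPos at *; fun_prop
  have cP : ContPos (fun x z t => (1 + z ^ 2) ^ 2 * (dx T x z t ^ 2 + dz T x z t ^ 2)) := by
    unfold ContPos at *; fun_prop
  have hbd : ∀ n, ∫ t in a..b, cutInt L (fun z => cut n z ^ 2)
      (fun x z => (1 + z ^ 2) ^ 2 * (dx T x z t ^ 2 + dz T x z t ^ 2)) ≤ K' + 0 := by
    intro n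
    obtain ⟨ψ', ψ'', hψ, hψb⟩ := hC n
    have hη := hψ.sq
    set η : ℝ → ℝ := fun z => ((1 + z ^ 2) * cut n z) ^ 2 with hηd
    have hη0 : ∀ z, 0 ≤ η z := fun z => sq_nonneg _
    have hψ0 : ∀ z, |(1 + z ^ 2) * cut n z| ≤ 1 + z ^ 2 := fun z => by
      rw [abs_of_nonneg (mul_nonneg (by positivity) (cut_nonneg n z))]
      exact mul_le_of_le_one_right (by positivity) (cut_le_one n z)
    have hη1 : ∀ z, |η z| ≤ 1 * (1 + z ^ 2) ^ 2 := fun z => by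
      rw [one_mul, hηd, abs_pow]
      exact pow_le_pow_left₀ (abs_nonneg _) (hψ0 z) 2
    have hη2 : ∀ z, |2 * ((1 + z ^ 2) * cut n z) * ψ' z| ≤ 2 * C * (1 + z ^ 2) ^ 2 := fun z => by
      rw [abs_mul, abs_mul, abs_two]
      have := mul_le_mul (hψ0 z) (hψb z).1 (abs_nonneg _) (by positivity)
      nlinarith
    have hη3 : ∀ z, |2 * ψ' z ^ 2 + 2 * ((1 + z ^ 2) * cut n z) * ψ'' z|
        ≤ (2 * C ^ 2 + 2 * C) * (1 + z ^ 2) ^ 2 := fun z => by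
      refine (abs_add_le _ _).trans ?_
      rw [abs_mul, abs_mul, abs_mul, abs_two, abs_pow]
      have h1 := mul_le_mul (hψ0 z) (hψb z).2 (abs_nonneg _) (by positivity)
      have h2 := pow_le_pow_left₀ (abs_nonneg _) (hψb z).1 2
      nlinarith
    have hcg : ∀ t, cutInt L (fun z => cut n z ^ 2)
        (fun x z => (1 + z ^ 2) ^ 2 * (dx T x z t ^ 2 + dz T x z t ^ 2))
        = cutInt L η (fun x z => dx T x z t ^ 2 + dz T x z t ^ 2) := fun t => by
      unfold cutInt
      refine integral_congr_ae (Eventually.of_forall fun p => ?_)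
      simp only [hηd]; ring
    simp only [hcg]
    have hrate : ∀ t ∈ Icc a b, 2 * cutInt L η (fun x z => dx T x z t ^ 2 + dz T x z t ^ 2)
        ≤ cutInt L η (fun x z => (1 - 2 * T x z t) * dt T x z t) + A := by
      intro t ht
      have ht0 : 0 < t := ha.trans_le ht.1
      have htb : t ∈ Icc 0 b := ⟨ht0.le, ht.2⟩
      have hT := D.sol.sm_T.hasGrad D.sol.per_T ht0
      have hTx := D.sol.sm_T.dx.hasGrad D.sol.per_T.dx ht0
      have hTz := D.sol.sm_T.dz.hasGrad D.sol.per_T.dz ht0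
      have hu := D.sol.sm_u.hasGrad D.sol.per_u ht0
      have hw := D.sol.sm_w.hasGrad D.sol.per_w ht0
      have c0 := hT.cont
      have c1 := hTx.cont
      have c2 := hTz.cont
      have c3 := hTx.cont_x
      have c4 := hTz.cont_z
      have c5 := hu.cont
      have c6 := hw.cont
      have c7 : Continuous f := D.smooth.continuous
      have e1 := cutInt_concave hL.le hη hu hw (fun x z => D.sol.div_free x z t ht0) hT hTx hTz
      have e2 : cutInt L η (fun x z => (1 - 2 * T x z t) * dt T x z t)
          = cutInt L η (fun x z => (1 - 2 * T x z t) * (dx (dx T) x z t + dz (dz T) x z t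
            - u x z t * dx T x z t - w x z t * dz T x z t))
            + cutInt L η (fun x z => (1 - 2 * T x z t) * f (T x z t)) := by
        rw [← cutInt_add hη.cont hη.supp (by fun_prop) (by fun_prop)]
        refine cutInt_congr fun x z => ?_
        rw [D.sol.dt_T ht0]; ring
      have hh : ∀ x z, 0 ≤ T x z t - T x z t * T x z t := fun x z => by
        obtain ⟨T0, T1⟩ := D.T_mem x z t ht0.le
        nlinarith
      have b1 := abs_cutInt_le_of_decay (L := L) hL.le (by positivity) hη3
        (F := fun x z => T x z t - T x z t * T x z t) (K := K) fun x z => by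
          rw [abs_of_nonneg (hh x z)]; exact (hK x z t htb).1
      have b2 := abs_cutInt_le_of_decay (L := L) hL.le (by positivity) hη2
        (F := fun x z => w x z t * (T x z t - T x z t * T x z t)) (K := B * K) fun x z => by
          rw [abs_mul, abs_of_nonneg (hh x z)]
          calc (1 + z ^ 2) ^ 3 * (|w x z t| * (T x z t - T x z t * T x z t))
              = |w x z t| * ((1 + z ^ 2) ^ 3 * (T x z t - T x z t * T x z t)) := by ring
            _ ≤ B * K := mul_le_mul (hB x z t htb) (hK x z t htb).1
                (mul_nonneg (by positivity) (hh x z)) hB0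
      have b3 := abs_cutInt_le_of_decay (L := L) hL.le zero_le_one hη1
        (F := fun x z => (1 - 2 * T x z t) * f (T x z t)) (K := K) fun x z => by
          have T01 := D.T_mem x z t ht0.le
          have hf0 := D.kpp.nonneg T01
          rw [abs_mul, abs_of_nonneg hf0]
          have h1 : |1 - 2 * T x z t| ≤ 1 := abs_le.2 ⟨by linarith [T01.2], by linarith [T01.1]⟩
          calc (1 + z ^ 2) ^ 3 * (|1 - 2 * T x z t| * f (T x z t))
              ≤ (1 + z ^ 2) ^ 3 * (1 * f (T x z t)) := by gcongr
            _ ≤ K := by rw [one_mul]; exact (hK x z t htb).2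
      rw [e2, e1]
      have b1' := (abs_le.1 b1).1
      have b2' := (abs_le.1 b2).1
      have b3' := (abs_le.1 b3).1
      rw [hA]
      linarith
    have hFTC := cutInt_sub_eq_integral (L := L) hη.cont hη.supp ch chd (fun x z t ht => by
      have hT := D.sol.sm_T.hasDerivAt_t (x := x) (z := z) ht
      exact (hT.sub (hT.mul hT)).congr_deriv (by ring)) ha hab
    have ig := (intervalIntegrable_cutInt (L := L) hη.cont hη.supp cg ha hab).const_mul 2
    have id := intervalIntegrable_cutInt (L := L) hη.cont hη.supp chd ha hab
    have hint := intervalIntegral.integral_mono_on hab ig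
      (id.add (intervalIntegrable_const (c := A))) hrate
    rw [intervalIntegral.integral_const_mul, intervalIntegral.integral_add id
      intervalIntegrable_const, ← hFTC, intervalIntegral.integral_const, smul_eq_mul] at hint
    have hb0 : b ∈ Icc 0 b := ⟨ha.le.trans hab, le_rfl⟩
    have b4 := (le_abs_self _).trans (abs_cutInt_le_of_decay (L := L) hL.le zero_le_one hη1
      (F := fun x z => T x z b - T x z b * T x z b) (K := K) fun x z => by
        obtain ⟨T0, T1⟩ := D.T_mem x z b hb0.1
        rw [abs_of_nonneg (by nlinarith)]; exact (hK x z b hb0).1)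
    have b5 : 0 ≤ cutInt L η (fun x z => T x z a - T x z a * T x z a) :=
      cutInt_nonneg hη0 fun x z => by
        obtain ⟨T0, T1⟩ := D.T_mem x z a ha.le
        nlinarith
    rw [hK']
    linarith
  have hF := lintegral_le_of_cutInt_le (L := L) (η := fun n z => cut n z ^ 2)
    (fun n => (isCutoff_cut n).sq.cont) (fun n => (isCutoff_cut n).sq.supp)
    (fun n z => sq_nonneg _) (fun z => by simpa using (tendsto_cut z).pow 2) cP
    (fun x z t _ => by positivity) ha hab (e := fun _ => 0) tendsto_const_nhds hbd
  refine ⟨K', hK'0, fun η c hηc hηs hη0 hc hηle => ?_⟩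
  have hP : ∀ z : ℝ, c * (1 + z ^ 2) ^ 2 ≠ 0 := fun z => by positivity
  have h1 := cutInt_le_of_lintegral_le (L := L) (η := fun z => η z / (c * (1 + z ^ 2) ^ 2))
    (hηc.div (by fun_prop) hP)
    (by simp only [div_eq_mul_inv]; exact hηs.mul_right)
    (fun z => div_nonneg (hη0 z) (by positivity))
    (fun z => div_le_one_of_le₀ (hηle z) (by positivity)) cP (fun x z t _ => by positivity) ha hab
    hK'0 hF
  have h2 : ∀ t, cutInt L η (fun x z => dx T x z t ^ 2 + dz T x z t ^ 2)
      = c * cutInt L (fun z => η z / (c * (1 + z ^ 2) ^ 2))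
        (fun x z => (1 + z ^ 2) ^ 2 * (dx T x z t ^ 2 + dz T x z t ^ 2)) := fun t => by
    rw [← cutInt_const_mul]
    unfold cutInt
    refine integral_congr_ae (Eventually.of_forall fun p => ?_)
    have := hP p.2
    field_simp
  simp only [h2, intervalIntegral.integral_const_mul]
  exact mul_le_mul_of_nonneg_left h1 hc.le

end FrontData

namespace FrontData
variable {f : ℝ → ℝ} {m σ ρ L : ℝ} {u w T : ℝ → ℝ → ℝ → ℝ} {a b : ℝ}

/-- Testing the temperature equation with `T_t`, weighted in space: the time derivative of the
weighted Dirichlet density is absorbed up to lower order terms. -/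
theorem cutInt_dt_grad_le (D : FrontData f m σ ρ L u w T) {t B : ℝ} (ht : 0 < t)
    (hu : ∀ x z, |u x z t| ≤ B) (hw : ∀ x z, |w x z t| ≤ B) {ψ ψ' ψ'' : ℝ → ℝ}
    (hψ : IsCutoff ψ ψ' ψ'') :
    2 * cutInt L (fun z => ψ z ^ 2)
        (fun x z => dx T x z t * dx (dt T) x z t + dz T x z t * dz (dt T) x z t)
      ≤ -cutInt L (fun z => ψ z ^ 2) (fun x z => dt T x z t ^ 2)
        + 8 * cutInt L (fun z => ψ' z ^ 2) (fun x z => dx T x z t ^ 2 + dz T x z t ^ 2)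
        + 8 * B ^ 2 * cutInt L (fun z => ψ z ^ 2) (fun x z => dx T x z t ^ 2 + dz T x z t ^ 2)
        + 4 * cutInt L (fun z => ψ z ^ 2) (fun x z => f (T x z t) ^ 2) := by
  have hL := D.L_pos
  have hη := hψ.sq
  have hTt := D.sol.sm_T.dt.hasGrad D.sol.per_T.dt ht
  have hTx := D.sol.sm_T.dx.hasGrad D.sol.per_T.dx ht
  have hTz := D.sol.sm_T.dz.hasGrad D.sol.per_T.dz ht
  have c0 := (D.sol.sm_T.hasGrad D.sol.per_T ht).cont
  have c1 := hTx.cont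
  have c2 := hTz.cont
  have c3 := hTt.cont
  have c4 := hTx.cont_x
  have c5 := hTz.cont_z
  have c6 : Continuous f := D.smooth.continuous
  have cψ' : Continuous fun z => ψ' z ^ 2 := hψ.cont₁.pow 2
  have sψ' : HasCompactSupport fun z => ψ' z ^ 2 :=
    hψ.supp₁.comp_left (g := fun y => y ^ 2) (by simp)
  have e1 := cutInt_grad_mul (L := L) hL.le hη hTt hTx hTz
  have e2 := abs_cutInt_cross_le (L := L) hψ (a := fun x z => dt T x z t)
    (b := fun x z => dz T x z t) c3 c2
  have e3 : cutInt L (fun z => ψ' z ^ 2) (fun x z => dz T x z t ^ 2)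
      ≤ cutInt L (fun z => ψ' z ^ 2) (fun x z => dx T x z t ^ 2 + dz T x z t ^ 2) :=
    cutInt_mono cψ' sψ' (fun z => sq_nonneg _) (by fun_prop) (by fun_prop) fun x z =>
      le_add_of_nonneg_left (sq_nonneg _)
  have e4 : cutInt L (fun z => ψ z ^ 2) (fun x z => 3 / 4 * dt T x z t ^ 2)
      ≤ cutInt L (fun z => ψ z ^ 2) (fun x z => dt T x z t * (dx (dx T) x z t + dz (dz T) x z t)
        + (4 * B ^ 2 * (dx T x z t ^ 2 + dz T x z t ^ 2) + 2 * f (T x z t) ^ 2)) := by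
    refine cutInt_mono hη.cont hη.supp (fun z => sq_nonneg _) (by fun_prop) (by fun_prop)
      fun x z => ?_
    have h1 := D.sol.dt_T (x := x) (z := z) ht
    have h2 := sq_le_sq' (abs_le.1 (hu x z)).1 (abs_le.1 (hu x z)).2
    have h3 := sq_le_sq' (abs_le.1 (hw x z)).1 (abs_le.1 (hw x z)).2
    set U := u x z t * dx T x z t
    set V := w x z t * dz T x z t
    have h4 : U ^ 2 ≤ B ^ 2 * dx T x z t ^ 2 := by
      rw [mul_pow]; exact mul_le_mul_of_nonneg_right h2 (sq_nonneg _)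
    have h5 : V ^ 2 ≤ B ^ 2 * dz T x z t ^ 2 := by
      rw [mul_pow]; exact mul_le_mul_of_nonneg_right h3 (sq_nonneg _)
    have h6 : dx (dx T) x z t + dz (dz T) x z t = dt T x z t + (U + V - f (T x z t)) := by
      linarith
    rw [h6]
    nlinarith [sq_nonneg (dt T x z t / 2 + (U + V - f (T x z t))), sq_nonneg (U - V),
      sq_nonneg (U + V + f (T x z t))]
  rw [cutInt_const_mul, cutInt_add hη.cont hη.supp (by fun_prop) (by fun_prop),
    cutInt_add hη.cont hη.supp (by fun_prop) (by fun_prop), cutInt_const_mul,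
    cutInt_const_mul] at e4
  have e2' := (abs_le.1 e2).1
  rw [e1]
  linarith

/-- Parabolic smoothing in weighted spaces; the factor `t - a` avoids assumptions on the gradient
at the initial time `a`. -/
theorem lintegral_dt_T_sq_lt_top (D : FrontData f m σ ρ L u w T) (ha : 0 < a) (hab : a ≤ b) :
    ∫⁻ t in Ioc a b, ∫⁻ p : ℝ × ℝ,
      ENNReal.ofReal (|t - a| * ((1 + p.2 ^ 2) ^ 2 * dt T p.1 p.2 t ^ 2)) ∂(cell L) < ⊤ := by
  have hL := D.L_pos
  obtain ⟨C, hC0, hC⟩ := exists_weighted_cutoff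
  obtain ⟨K, hK0, hK⟩ := D.exists_decay_f b
  obtain ⟨G, hG0, hG⟩ := D.exists_weighted_grad_bound ha hab
  obtain ⟨B₁, -, hB₁⟩ := D.sol.exists_bound_u hL b
  obtain ⟨B₂, -, hB₂⟩ := D.sol.exists_bound_w hL b
  set B := max B₁ B₂ with hB
  set J : ℝ := ∫ p : ℝ × ℝ, (1 + p.2 ^ 2)⁻¹ ∂(cell L) with hJ
  have hba : 0 ≤ b - a := sub_nonneg.2 hab
  set K' : ℝ := G + (b - a) * (8 * ((C ^ 2 + 1) * G) + 8 * B ^ 2 * G + (b - a) * (4 * (K * J)))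
    with hK'
  have cTt : ContPos (dt T) := D.sol.sm_T.dt.contPos
  have c1 : ContPos (dx T) := D.sol.sm_T.dx.contPos
  have c2 : ContPos (dz T) := D.sol.sm_T.dz.contPos
  have c3 : ContPos (dx (dt T)) := D.sol.sm_T.dt.dx.contPos
  have c4 : ContPos (dz (dt T)) := D.sol.sm_T.dt.dz.contPos
  have cg : ContPos (fun x z t => dx T x z t ^ 2 + dz T x z t ^ 2) := by
    unfold ContPos at *; fun_prop
  have ct2 : ContPos (fun x z t => |t - a| * dt T x z t ^ 2) := by
    unfold ContPos at *; fun_prop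
  have cE : ContPos (fun x z t => (t - a) * (dx T x z t ^ 2 + dz T x z t ^ 2)) := by
    unfold ContPos at *; fun_prop
  have cE' : ContPos (fun x z t => (dx T x z t ^ 2 + dz T x z t ^ 2)
      + (t - a) * (2 * (dx T x z t * dx (dt T) x z t + dz T x z t * dz (dt T) x z t))) := by
    unfold ContPos at *; fun_prop
  have cP : ContPos (fun x z t => |t - a| * ((1 + z ^ 2) ^ 2 * dt T x z t ^ 2)) := by
    unfold ContPos at *; fun_prop
  refine (lintegral_le_of_cutInt_le (L := L) (η := fun n z => cut n z ^ 2) (K := K')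
    (fun n => (isCutoff_cut n).sq.cont) (fun n => (isCutoff_cut n).sq.supp)
    (fun n z => sq_nonneg _) (fun z => by simpa using (tendsto_cut z).pow 2) cP
    (fun x z t _ => by positivity) ha hab (e := fun _ => 0) tendsto_const_nhds
    fun n => ?_).trans_lt ENNReal.ofReal_lt_top
  obtain ⟨ψ', ψ'', hψ, hψb⟩ := hC n
  have hη := hψ.sq
  set ψ : ℝ → ℝ := fun z => (1 + z ^ 2) * cut n z with hψd
  have hη1 : ∀ z, ψ z ^ 2 ≤ 1 * (1 + z ^ 2) ^ 2 := fun z => by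
    rw [one_mul]
    exact pow_le_pow_left₀ (mul_nonneg (by positivity) (cut_nonneg n z))
      (mul_le_of_le_one_right (by positivity) (cut_le_one n z)) 2
  have hη2 : ∀ z, ψ' z ^ 2 ≤ (C ^ 2 + 1) * (1 + z ^ 2) ^ 2 := fun z => by
    have := pow_le_pow_left₀ (abs_nonneg _) (hψb z).1 2
    rw [sq_abs] at this
    nlinarith [sq_nonneg (1 + z ^ 2)]
  have cψ' : Continuous fun z => ψ' z ^ 2 := hψ.cont₁.pow 2
  have sψ' : HasCompactSupport fun z => ψ' z ^ 2 :=
    hψ.supp₁.comp_left (g := fun y => y ^ 2) (by simp)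
  have hcg : ∀ t, cutInt L (fun z => cut n z ^ 2)
      (fun x z => |t - a| * ((1 + z ^ 2) ^ 2 * dt T x z t ^ 2))
      = cutInt L (fun z => ψ z ^ 2) (fun x z => |t - a| * dt T x z t ^ 2) := fun t => by
    unfold cutInt
    refine integral_congr_ae (Eventually.of_forall fun p => ?_)
    simp only [hψd]; ring
  simp only [hcg, add_zero]
  have iT := intervalIntegrable_cutInt (L := L) hη.cont hη.supp ct2 ha hab
  have iE := intervalIntegrable_cutInt (L := L) hη.cont hη.supp cE' ha hab
  have ig := intervalIntegrable_cutInt (L := L) hη.cont hη.supp cg ha hab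
  have ig' := intervalIntegrable_cutInt (L := L) cψ' sψ' cg ha hab
  have hrate : ∀ t ∈ Icc a b,
      cutInt L (fun z => ψ z ^ 2) (fun x z => |t - a| * dt T x z t ^ 2)
        + cutInt L (fun z => ψ z ^ 2) (fun x z => (dx T x z t ^ 2 + dz T x z t ^ 2)
          + (t - a) * (2 * (dx T x z t * dx (dt T) x z t + dz T x z t * dz (dt T) x z t)))
      ≤ cutInt L (fun z => ψ z ^ 2) (fun x z => dx T x z t ^ 2 + dz T x z t ^ 2)
        + (b - a) * (8 * cutInt L (fun z => ψ' z ^ 2) (fun x z => dx T x z t ^ 2 + dz T x z t ^ 2)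
          + 8 * B ^ 2 * cutInt L (fun z => ψ z ^ 2) (fun x z => dx T x z t ^ 2 + dz T x z t ^ 2)
          + 4 * (K * J)) := by
    intro t ht
    have ht0 : 0 < t := ha.trans_le ht.1
    have htb : t ∈ Icc 0 b := ⟨ht0.le, ht.2⟩
    have hta : 0 ≤ t - a := sub_nonneg.2 ht.1
    have s1 := c1.slice ht0
    have s2 := c2.slice ht0
    have s3 := c3.slice ht0
    have s4 := c4.slice ht0
    have key := D.cutInt_dt_grad_le ht0 (fun x z => (hB₁ x z t htb).trans (le_max_left _ _))
      (fun x z => (hB₂ x z t htb).trans (le_max_right _ _)) hψ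
    have hf2 := (le_abs_self _).trans (abs_cutInt_le_of_decay (L := L) hL.le zero_le_one
      (η := fun z => ψ z ^ 2) (fun z => by rw [abs_of_nonneg (sq_nonneg _)]; exact hη1 z)
      (F := fun x z => f (T x z t) ^ 2) (K := K) fun x z => by
        have T01 := D.T_mem x z t ht0.le
        have h0 := D.kpp.nonneg T01
        have h1 := (D.kpp.le_self T01).trans T01.2
        rw [abs_of_nonneg (sq_nonneg _)]
        calc (1 + z ^ 2) ^ 3 * f (T x z t) ^ 2
            ≤ (1 + z ^ 2) ^ 3 * f (T x z t) := by gcongr; nlinarith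
          _ ≤ K := (hK x z t htb).2)
    rw [one_mul] at hf2
    have hg0 : 0 ≤ cutInt L (fun z => ψ z ^ 2) (fun x z => dx T x z t ^ 2 + dz T x z t ^ 2) :=
      cutInt_nonneg (fun z => sq_nonneg _) fun x z => by positivity
    have hg0' : 0 ≤ cutInt L (fun z => ψ' z ^ 2) (fun x z => dx T x z t ^ 2 + dz T x z t ^ 2) :=
      cutInt_nonneg (fun z => sq_nonneg _) fun x z => by positivity
    have hKJ : 0 ≤ K * J := mul_nonneg hK0 (integral_nonneg fun p => by positivity)
    rw [cutInt_add hη.cont hη.supp (by fun_prop) (by fun_prop), cutInt_const_mul,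
      cutInt_const_mul, cutInt_const_mul, abs_of_nonneg hta]
    have h1 := mul_le_mul_of_nonneg_left key hta
    have h2 := mul_le_mul_of_nonneg_right (show t - a ≤ b - a by linarith [ht.2])
      (show 0 ≤ 8 * cutInt L (fun z => ψ' z ^ 2) (fun x z => dx T x z t ^ 2 + dz T x z t ^ 2)
          + 8 * B ^ 2 * cutInt L (fun z => ψ z ^ 2) (fun x z => dx T x z t ^ 2 + dz T x z t ^ 2)
          + 4 * (K * J) by positivity)
    have h3 := mul_le_mul_of_nonneg_left hf2 hta
    linarith
  have hFTC := cutInt_sub_eq_integral (L := L) hη.cont hη.supp cE cE' (fun x z t ht => by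
    have hx := D.sol.sm_T.dx.hasDerivAt_t (x := x) (z := z) ht
    have hz := D.sol.sm_T.dz.hasDerivAt_t (x := x) (z := z) ht
    rw [(D.sol.sm_T.mono (by norm_num)).dx_dt_comm ht, (D.sol.sm_T.mono (by norm_num)).dz_dt_comm ht]
    have hq : HasDerivAt (fun s => dx T x z s ^ 2 + dz T x z s ^ 2)
        (2 * (dx T x z t * dt (dx T) x z t + dz T x z t * dt (dz T) x z t)) t :=
      ((hx.pow 2).add (hz.pow 2)).congr_deriv (by norm_num; ring)
    exact (((hasDerivAt_id t).sub_const a).mul hq).congr_deriv (by simp only [id, one_mul])) ha hab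
  have hint := intervalIntegral.integral_mono_on hab (iT.add iE)
    (ig.add ((((ig'.const_mul 8).add (ig.const_mul (8 * B ^ 2))).add
      (intervalIntegrable_const (c := 4 * (K * J)))).const_mul (b - a))) hrate
  rw [intervalIntegral.integral_add iT iE, ← hFTC, intervalIntegral.integral_add ig
    ((((ig'.const_mul 8).add (ig.const_mul (8 * B ^ 2))).add
      (intervalIntegrable_const (c := 4 * (K * J)))).const_mul (b - a)),
    intervalIntegral.integral_const_mul, intervalIntegral.integral_add
      ((ig'.const_mul 8).add (ig.const_mul (8 * B ^ 2))) intervalIntegrable_const,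
    intervalIntegral.integral_add (ig'.const_mul 8) (ig.const_mul (8 * B ^ 2)),
    intervalIntegral.integral_const_mul, intervalIntegral.integral_const_mul,
    intervalIntegral.integral_const, smul_eq_mul] at hint
  have g1 := hG _ 1 hη.cont hη.supp (fun z => sq_nonneg _) one_pos hη1
  have g2 := hG _ (C ^ 2 + 1) cψ' sψ' (fun z => sq_nonneg _) (by positivity) hη2
  rw [one_mul] at g1
  have n1 : cutInt L (fun z => ψ z ^ 2) (fun x z => (a - a) * (dx T x z a ^ 2 + dz T x z a ^ 2))
      = 0 := by simp [cutInt]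
  have n2 : 0 ≤ cutInt L (fun z => ψ z ^ 2)
      (fun x z => (b - a) * (dx T x z b ^ 2 + dz T x z b ^ 2)) :=
    cutInt_nonneg (fun z => sq_nonneg _) fun x z => by positivity
  rw [n1] at hint
  have h4 := mul_le_mul_of_nonneg_left g1 (show 0 ≤ 8 * B ^ 2 by positivity)
  have h5 := mul_le_mul_of_nonneg_left (show
    8 * (∫ t in a..b, cutInt L (fun z => ψ' z ^ 2) (fun x z => dx T x z t ^ 2 + dz T x z t ^ 2))
      + 8 * B ^ 2 * (∫ t in a..b, cutInt L (fun z => ψ z ^ 2)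
        (fun x z => dx T x z t ^ 2 + dz T x z t ^ 2)) + (b - a) * (4 * (K * J))
      ≤ 8 * ((C ^ 2 + 1) * G) + 8 * B ^ 2 * G + (b - a) * (4 * (K * J)) by linarith) hba
  rw [hK']
  linarith

/-- The weighted `L²` bound on `T_t` implies integrability, by Cauchy-Schwarz. -/
theorem ae_integrable_dt_T (D : FrontData f m σ ρ L u w T) :
    ∀ᵐ t : ℝ, 0 < t → Integrable (fun p : ℝ × ℝ => dt T p.1 p.2 t) (cell L) := by
  have key : ∀ n : ℕ, ∀ᵐ t : ℝ, t ∈ Ioc (1 / ((n : ℝ) + 1)) (n + 1) →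
      Integrable (fun p : ℝ × ℝ => dt T p.1 p.2 t) (cell L) := by
    intro n
    have ha : 0 < 1 / ((n : ℝ) + 1) := by positivity
    have hab : 1 / ((n : ℝ) + 1) ≤ n + 1 := by
      rw [div_le_iff₀ (by positivity)]
      nlinarith [n.cast_nonneg (α := ℝ)]
    have cTt : ContPos (dt T) := D.sol.sm_T.dt.contPos
    have cP : ContPos (fun x z t =>
        |t - 1 / ((n : ℝ) + 1)| * ((1 + z ^ 2) ^ 2 * dt T x z t ^ 2)) := by
      unfold ContPos at *; fun_prop
    have h1 := ae_lt_top' (aemeasurable_lintegral_cell (L := L) cP ha)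
      (D.lintegral_dt_T_sq_lt_top ha hab).ne
    rw [ae_restrict_iff' measurableSet_Ioc] at h1
    filter_upwards [h1] with t h ht
    have ht0 : 0 < t := ha.trans ht.1
    have hpos : 0 < |t - 1 / ((n : ℝ) + 1)| := abs_pos.2 (sub_pos.2 ht.1).ne'
    have h2 := (lintegral_ofReal_ne_top_iff_integrable (cP.slice ht0).aestronglyMeasurable
      (Eventually.of_forall fun p => by positivity)).1 (h ht).ne
    have h3 := (h2.const_mul (|t - 1 / ((n : ℝ) + 1)|⁻¹)).add (integrable_cell_inv D.L_pos.le)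
    refine h3.mono' (cTt.slice ht0).aestronglyMeasurable (Eventually.of_forall fun p => ?_)
    rw [Pi.add_apply, inv_mul_cancel_left₀ hpos.ne', Real.norm_eq_abs]
    -- `|y| ≤ P² y² + P⁻¹` whenever `P ≥ 1`
    have hP : (1 : ℝ) ≤ 1 + p.2 ^ 2 := by linarith [sq_nonneg p.2]
    have hP0 : (0 : ℝ) < 1 + p.2 ^ 2 := by linarith
    set P := 1 + p.2 ^ 2
    have hPi : P * P⁻¹ = 1 := mul_inv_cancel₀ hP0.ne'
    have hi0 : 0 < P⁻¹ := inv_pos.2 hP0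
    have hi1 : P⁻¹ ≤ 1 := inv_le_one_of_one_le₀ hP
    have h4 : P * |dt T p.1 p.2 t| * P⁻¹ = |dt T p.1 p.2 t| := by
      rw [mul_comm P, mul_assoc, hPi, mul_one]
    have h5 : P ^ 2 * dt T p.1 p.2 t ^ 2 = (P * |dt T p.1 p.2 t|) ^ 2 := by
      rw [mul_pow, sq_abs]
    rw [h5]
    nlinarith [sq_nonneg (P * |dt T p.1 p.2 t| - P⁻¹)]
  filter_upwards [ae_all_iff.2 key] with t h ht
  obtain ⟨n, hn⟩ := exists_nat_gt (max t (1 / t))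
  refine h n ⟨?_, ?_⟩
  · rw [div_lt_iff₀ (by positivity)]
    have := (le_max_right t (1 / t)).trans_lt hn
    rw [div_lt_iff₀ ht] at this
    nlinarith
  · linarith [(le_max_left t (1 / t)).trans_lt hn]

end FrontData

/-! ### The bulk burning rate -/

namespace FrontData
variable {f : ℝ → ℝ} {m σ ρ L : ℝ} {u w T : ℝ → ℝ → ℝ → ℝ}

/-- The horizontally averaged heat flux through high levels is negligible, because `w` has zero
mean in `x`. -/
theorem abs_cutInt_flux_T_le (D : FrontData f m σ ρ L u w T) {t c : ℝ} (ht : 0 < t) {η : ℝ → ℝ}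
    (hη : Continuous η) (hs : HasCompactSupport η) (hc : ∀ z, |η z| ≤ c) :
    |cutInt L η (fun x z => w x z t * T x z t)|
      ≤ c * (1 / 2 * (∫ p : ℝ × ℝ, w p.1 p.2 t ^ 2 ∂(cell L))
        + L ^ 2 / 2 * ∫ p : ℝ × ℝ, dx T p.1 p.2 t ^ 2 ∂(cell L)) := by
  have hL := D.L_pos
  have hw := D.sol.sm_w.hasGrad D.sol.per_w ht
  have hT := D.sol.sm_T.hasGrad D.sol.per_T ht
  have c0 := hw.cont
  have c1 := hT.cont
  obtain ⟨K₁, -, iw⟩ := D.sol.L2_w.exists_bound (b := t) D.sol.sm_w.contPos ht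
  obtain ⟨K₂, -, iT⟩ := D.sol.L2_dx_T.exists_bound (b := t) D.sol.sm_T.dx.contPos ht
  have iw := (iw t ⟨le_rfl, le_rfl⟩).1
  have iT := (iT t ⟨le_rfl, le_rfl⟩).1
  have hint := integrable_cutoff hη hs L (F := fun x z => w x z t * T x z t) (by fun_prop)
  unfold cutInt
  rw [integral_cell_eq hL.le hint, integral_cell_eq hL.le iw, integral_cell_eq hL.le iT,
    ← integral_const_mul, ← integral_const_mul,
    ← integral_add ((integrable_slice hL.le iw).const_mul _)
      ((integrable_slice hL.le iT).const_mul _), ← integral_const_mul, ← Real.norm_eq_abs]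
  refine norm_integral_le_of_norm_le ((((integrable_slice hL.le iw).const_mul _).add
      ((integrable_slice hL.le iT).const_mul _)).const_mul _) (Eventually.of_forall fun z => ?_)
  have hsl : Continuous fun x : ℝ => (x, z) := by fun_prop
  have h1 := integral_mul_le_of_mean_zero hL (hw.cont.comp hsl)
    (D.sol.integral_w_eq_zero hL ht z) (fun x => hT.hx x z) (hT.cont_x.comp hsl) one_pos
  simp only [Function.comp_def] at h1
  simp only [intervalIntegral.integral_const_mul, norm_mul, Real.norm_eq_abs]
  refine mul_le_mul (hc z) (h1.trans (le_of_eq ?_)) (abs_nonneg _) ((abs_nonneg _).trans (hc z))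
  ring

/-- Mass balance on the truncated cell. -/
theorem cutInt_dt_T (D : FrontData f m σ ρ L u w T) {t : ℝ} (ht : 0 < t) (n : ℕ) :
    cutInt L (cut n) (fun x z => dt T x z t)
      = cutInt L (cut₂ n) (fun x z => T x z t)
        + cutInt L (cut₁ n) (fun x z => w x z t * T x z t)
        + cutInt L (cut n) (fun x z => f (T x z t)) := by
  have hL := D.L_pos
  have hη := isCutoff_cut n
  have hT := D.sol.sm_T.hasGrad D.sol.per_T ht
  have hTx := D.sol.sm_T.dx.hasGrad D.sol.per_T.dx ht
  have hTz := D.sol.sm_T.dz.hasGrad D.sol.per_T.dz ht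
  have hu := D.sol.sm_u.hasGrad D.sol.per_u ht
  have hw := D.sol.sm_w.hasGrad D.sol.per_w ht
  have c0 := hT.cont
  have c1 := hTx.cont
  have c2 := hTz.cont
  have c3 := hTx.cont_x
  have c4 := hTz.cont_z
  have c5 := hu.cont
  have c6 := hw.cont
  have c7 : Continuous f := D.smooth.continuous
  rw [← cutInt_mass hL.le hη hu hw (fun x z => D.sol.div_free x z t ht) hT hTx hTz,
    ← cutInt_add hη.cont hη.supp (by fun_prop) (by fun_prop)]
  exact cutInt_congr fun x z => D.sol.dt_T ht

/-- The boundary terms of the mass balance vanish as the truncation height grows, uniformly on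
compact time intervals. -/
theorem exists_mass_error (D : FrontData f m σ ρ L u w T) {a b : ℝ} (ha : 0 < a) :
    ∃ C : ℝ, 0 ≤ C ∧ ∀ n : ℕ, ∀ t ∈ Icc a b,
      |cutInt L (cut n) (fun x z => dt T x z t) - cutInt L (cut n) (fun x z => f (T x z t))|
        ≤ C / (n + 1) := by
  have hL := D.L_pos
  obtain ⟨C, hC0, hC⟩ := exists_cut_bound
  obtain ⟨K₁, hK₁0, hK₁⟩ := D.sol.L2_w.exists_bound (b := b) D.sol.sm_w.contPos ha
  obtain ⟨K₂, hK₂0, hK₂⟩ := D.sol.L2_dx_T.exists_bound (b := b) D.sol.sm_T.dx.contPos ha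
  refine ⟨C * L + C * (1 / 2 * K₁ + L ^ 2 / 2 * K₂), by positivity, fun n t ht => ?_⟩
  have ht0 : 0 < t := ha.trans_le ht.1
  have hη := isCutoff_cut n
  have h1 := D.abs_cutInt_flux_T_le ht0 hη.cont₁ hη.supp₁ (hC n).1
  have h2 : |cutInt L (cut₂ n) (fun x z => T x z t)| ≤ L * (C / (n + 1)) := by
    have hi := integral_cell_of_z hL.le (hη.cont₂.abs.integrable_of_hasCompactSupport
      (μ := volume) (hη.supp₂.comp_left (g := fun y => |y|) abs_zero))
    unfold cutInt
    rw [← Real.norm_eq_abs]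
    refine (norm_integral_le_of_norm_le hi.1 (Eventually.of_forall fun p => ?_)).trans
      (hi.2.le.trans (mul_le_mul_of_nonneg_left (hC n).2.2 hL.le))
    obtain ⟨T0, T1⟩ := D.T_mem p.1 p.2 t ht0.le
    rw [norm_mul, Real.norm_eq_abs, Real.norm_eq_abs, abs_of_nonneg T0]
    exact mul_le_of_le_one_right (abs_nonneg _) T1
  have h3 : C / ((n : ℝ) + 1) * (1 / 2 * (∫ p : ℝ × ℝ, w p.1 p.2 t ^ 2 ∂(cell L))
        + L ^ 2 / 2 * ∫ p : ℝ × ℝ, dx T p.1 p.2 t ^ 2 ∂(cell L))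
      ≤ C / (n + 1) * (1 / 2 * K₁ + L ^ 2 / 2 * K₂) := by
    have := (hK₁ t ht).2
    have := (hK₂ t ht).2
    gcongr
  rw [D.cutInt_dt_T ht0 n, add_sub_cancel_right]
  refine (abs_add_le _ _).trans ?_
  have h4 : (C * L + C * (1 / 2 * K₁ + L ^ 2 / 2 * K₂)) / ((n : ℝ) + 1)
      = L * (C / (n + 1)) + C / (n + 1) * (1 / 2 * K₁ + L ^ 2 / 2 * K₂) := by ring
  rw [h4]
  linarith

theorem integrable_f (D : FrontData f m σ ρ L u w T) {t : ℝ} (ht : 0 < t) :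
    Integrable (fun p : ℝ × ℝ => f (T p.1 p.2 t)) (cell L) := by
  obtain ⟨K, hK0, hK⟩ := D.exists_decay_f t
  refine ((integrable_cell_inv D.L_pos.le).const_mul K).mono'
    (D.contPos_f.slice ht).aestronglyMeasurable (Eventually.of_forall fun p => ?_)
  have h0 := D.kpp.nonneg (D.T_mem p.1 p.2 t ht.le)
  have h1 := (hK p.1 p.2 t ⟨ht.le, le_rfl⟩).2
  rw [Real.norm_eq_abs, abs_of_nonneg h0, ← div_eq_mul_inv, le_div_iff₀ (by positivity)]
  refine le_trans ?_ h1
  rw [mul_comm]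
  exact mul_le_mul_of_nonneg_right (le_self_pow₀ (by linarith [sq_nonneg p.2]) (by norm_num)) h0

/-- The burning rate is the total reaction rate. -/
theorem integral_dt_T_eq (D : FrontData f m σ ρ L u w T) {t : ℝ} (ht : 0 < t)
    (hi : Integrable (fun p : ℝ × ℝ => dt T p.1 p.2 t) (cell L)) :
    ∫ p : ℝ × ℝ, dt T p.1 p.2 t ∂(cell L) = ∫ p : ℝ × ℝ, f (T p.1 p.2 t) ∂(cell L) := by
  obtain ⟨C, hC0, hC⟩ := D.exists_mass_error (b := t) ht
  have h1 := (tendsto_cutInt (F := fun x z => dt T x z t) hi).sub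
    (tendsto_cutInt (F := fun x z => f (T x z t)) (D.integrable_f ht))
  have h2 := squeeze_zero_norm (fun n => (Real.norm_eq_abs _).trans_le (hC n t ⟨le_rfl, le_rfl⟩))
    (tendsto_div_nat C)
  exact sub_eq_zero.1 (tendsto_nhds_unique h1 h2)

theorem continuousOn_integral_f (D : FrontData f m σ ρ L u w T) (τ : ℝ) :
    ContinuousOn (fun t => ∫ p : ℝ × ℝ, f (T p.1 p.2 t) ∂(cell L)) (Icc 0 τ) := by
  obtain ⟨K, hK0, hK⟩ := D.exists_decay_f τ
  have hcont := D.smooth.continuous.comp_continuousOn D.sol.regular_T.1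
  refine continuousOn_of_dominated (bound := fun p : ℝ × ℝ => K * (1 + p.2 ^ 2)⁻¹)
    (fun t ht => ?_) (fun t ht => Eventually.of_forall fun p => ?_)
    ((integrable_cell_inv D.L_pos.le).const_mul K) (Eventually.of_forall fun p => ?_)
  · exact (hcont.comp_continuous (f := fun p : ℝ × ℝ => (p.1, p.2, t)) (by fun_prop)
      fun _ => ht.1).aestronglyMeasurable
  · have h0 := D.kpp.nonneg (D.T_mem p.1 p.2 t ht.1)
    have h1 := (hK p.1 p.2 t ht).2
    rw [Real.norm_eq_abs, abs_of_nonneg h0, ← div_eq_mul_inv, le_div_iff₀ (by positivity)]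
    refine le_trans ?_ h1
    rw [mul_comm]
    exact mul_le_mul_of_nonneg_right (le_self_pow₀ (by linarith [sq_nonneg p.2]) (by norm_num)) h0
  · exact hcont.comp (f := fun t : ℝ => (p.1, p.2, t)) (by fun_prop) fun t ht => ht.1

theorem ae_burningRate_eq (D : FrontData f m σ ρ L u w T) :
    ∀ᵐ t : ℝ, 0 < t →
      1 / L * ∫ p : ℝ × ℝ, f (T p.1 p.2 t) ∂(cell L) = burningRate L T t := by
  filter_upwards [D.ae_integrable_dt_T] with t h ht
  rw [burningRate, D.integral_dt_T_eq ht (h ht)]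

theorem intervalIntegrable_burningRate (D : FrontData f m σ ρ L u w T) {t : ℝ} (ht : 0 < t) :
    IntervalIntegrable (burningRate L T) volume 0 t := by
  have h1 : IntervalIntegrable (fun s => 1 / L * ∫ p : ℝ × ℝ, f (T p.1 p.2 s) ∂(cell L))
      volume 0 t := by
    refine ContinuousOn.intervalIntegrable ?_
    rw [uIcc_of_le ht.le]
    exact continuousOn_const.mul (D.continuousOn_integral_f t)
  refine h1.congr_ae ?_
  rw [uIoc_of_le ht.le]
  exact (ae_restrict_iff' measurableSet_Ioc).2
    (D.ae_burningRate_eq.mono fun s hs hst => hs hst.1)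

/-- The profile trapped between two exponential fronts at distance `β` has mass at most `β` plus
a constant. -/
theorem _root_.ReactiveBoussinesq.integral_min_exp_le {A a β : ℝ} (ha : 0 < a) (hβ : 0 ≤ β) :
    Integrable (fun z : ℝ => min (Real.exp (A + a * z)) (min 1 (Real.exp (β - z)))) ∧
    ∫ z : ℝ, min (Real.exp (A + a * z)) (min 1 (Real.exp (β - z)))
      ≤ Real.exp A / a + β + 1 := by
  set g : ℝ → ℝ := fun z => min (Real.exp (A + a * z)) (min 1 (Real.exp (β - z))) with hg
  have hgc : Continuous g := by fun_prop
  have hg0 : ∀ z, 0 ≤ g z := fun z => by positivity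
  have i1 : IntegrableOn (fun z => Real.exp A * Real.exp (a * z)) (Iic 0) :=
    (integrableOn_exp_mul_Iic ha 0).const_mul _
  have i3 : IntegrableOn (fun z => Real.exp β * Real.exp (-z)) (Ioi β) :=
    (integrableOn_exp_neg_Ioi β).const_mul _
  have b1 : ∀ z, g z ≤ Real.exp A * Real.exp (a * z) := fun z => by
    rw [← Real.exp_add]; exact min_le_left _ _
  have b2 : ∀ z, g z ≤ 1 := fun z => (min_le_right _ _).trans (min_le_left _ _)
  have b3 : ∀ z, g z ≤ Real.exp β * Real.exp (-z) := fun z => by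
    rw [← Real.exp_add, ← sub_eq_add_neg]; exact (min_le_right _ _).trans (min_le_right _ _)
  have g1 : IntegrableOn g (Iic 0) := i1.mono' hgc.aestronglyMeasurable
    (Eventually.of_forall fun z => by rw [Real.norm_eq_abs, abs_of_nonneg (hg0 z)]; exact b1 z)
  have g2 : IntegrableOn g (Ioc 0 β) := hgc.integrableOn_Ioc
  have g3 : IntegrableOn g (Ioi β) := i3.mono' hgc.aestronglyMeasurable
    (Eventually.of_forall fun z => by rw [Real.norm_eq_abs, abs_of_nonneg (hg0 z)]; exact b3 z)
  have g23 : IntegrableOn g (Ioi 0) := by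
    rw [← Ioc_union_Ioi_eq_Ioi hβ]; exact g2.union g3
  refine ⟨by rw [← integrableOn_univ, ← Iic_union_Ioi (a := (0 : ℝ))]; exact g1.union g23, ?_⟩
  rw [← intervalIntegral.integral_Iic_add_Ioi g1 g23, ← Ioc_union_Ioi_eq_Ioi hβ,
    setIntegral_union (Ioc_disjoint_Ioi le_rfl) measurableSet_Ioi g2 g3]
  have e1 : ∫ z in Iic 0, g z ≤ Real.exp A / a := by
    refine (setIntegral_mono g1 i1 b1).trans (le_of_eq ?_)
    rw [integral_const_mul, integral_exp_mul_Iic ha]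
    simp [div_eq_mul_inv]
  have e2 : ∫ z in Ioc 0 β, g z ≤ β := by
    refine (setIntegral_mono g2 (integrableOn_const (by simp)) b2).trans (le_of_eq ?_)
    simp [hβ]
  have e3 : ∫ z in Ioi β, g z ≤ 1 := by
    refine (setIntegral_mono g3 i3 b3).trans (le_of_eq ?_)
    rw [integral_const_mul, integral_exp_neg_Ioi, ← Real.exp_add]
    simp
  linarith

/-- The mass burnt up to time `t` grows at most at rate `2 + ε`. -/
theorem exists_integral_f_le (D : FrontData f m σ ρ L u w T) {ε : ℝ} (hε : 0 < ε) :
    ∃ C : ℝ, ∀ t, 1 ≤ t →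
      ∫ s in (0 : ℝ)..t, ∫ p : ℝ × ℝ, f (T p.1 p.2 s) ∂(cell L) ≤ L * (C + (2 + ε) * t) := by
  have hL := D.L_pos
  obtain ⟨C, hC0, hC⟩ := D.exists_T_le_exp hε
  obtain ⟨A, a, ha, hA⟩ := D.exists_one_sub_T_le_exp 1
  have hii : ∀ c d, 0 ≤ c → c ≤ d → IntervalIntegrable
      (fun s => ∫ p : ℝ × ℝ, f (T p.1 p.2 s) ∂(cell L)) volume c d := fun c d hc hcd => by
    refine ContinuousOn.intervalIntegrable ?_
    rw [uIcc_of_le hcd]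
    exact (D.continuousOn_integral_f d).mono (Icc_subset_Icc_left hc)
  set J := ∫ s in (0 : ℝ)..1, ∫ p : ℝ × ℝ, f (T p.1 p.2 s) ∂(cell L) with hJ
  refine ⟨J / L + (Real.exp A / a + C + 1), fun t ht => ?_⟩
  have ht0 : 0 < t := one_pos.trans_le ht
  set β := C + (2 + ε) * t with hβ
  have hβ0 : 0 ≤ β := by positivity
  obtain ⟨hBi, hBle⟩ := integral_min_exp_le (A := A) ha hβ0
  obtain ⟨E, hE0, hE⟩ := D.exists_mass_error (b := t) one_pos
  set K := L * (Real.exp A / a + β + 1) with hK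
  have hK0 : 0 ≤ K := by positivity
  have hf0 : ∀ x z t, 0 < t → 0 ≤ f (T x z t) := fun x z t ht => D.kpp.nonneg (D.T_mem x z t ht.le)
  have hcut : ∀ n : ℕ, ∫ s in (1 : ℝ)..t, cutInt L (cut n) (fun x z => f (T x z s))
      ≤ K + (t - 1) * E / (n + 1) := fun n => by
    have hη := isCutoff_cut n
    have c1 := D.sol.sm_T.contPos.slice ht0
    have c2 := D.sol.sm_T.contPos.slice one_pos
    have hFTC := cutInt_sub_eq_integral (L := L) hη.cont hη.supp D.sol.sm_T.contPos
      D.sol.sm_T.dt.contPos (fun x z t ht => D.sol.sm_T.hasDerivAt_t ht) one_pos ht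
    have i1 := intervalIntegrable_cutInt (L := L) hη.cont hη.supp D.contPos_f one_pos ht
    have i2 := intervalIntegrable_cutInt (L := L) hη.cont hη.supp D.sol.sm_T.dt.contPos one_pos ht
    have h1 := intervalIntegral.integral_mono_on ht i1
      (i2.add (intervalIntegrable_const (c := E / ((n : ℝ) + 1)))) fun s hs => by
        have := (abs_le.1 (hE n s hs)).1
        change _ ≤ cutInt L (cut n) (fun x z => dt T x z s) + E / ((n : ℝ) + 1)
        linarith
    rw [intervalIntegral.integral_add i2 intervalIntegrable_const, ← hFTC,
      intervalIntegral.integral_const, smul_eq_mul, ← cutInt_sub hη.cont hη.supp c1 c2] at h1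
    have h2 : cutInt L (cut n) (fun x z => T x z t - T x z 1) ≤ K := by
      have hB := integral_cell_of_z hL.le hBi
      refine (integral_mono (integrable_cutoff hη.cont hη.supp L
        (F := fun x z => T x z t - T x z 1) (c1.sub c2)) hB.1
        fun p => ?_).trans (hB.2.le.trans (mul_le_mul_of_nonneg_left hBle hL.le))
      have T1 := D.T_mem p.1 p.2 t ht0.le
      have T2 := D.T_mem p.1 p.2 1 zero_le_one
      have T3 := hA p.1 p.2 1 ⟨zero_le_one, le_rfl⟩
      have T4 := hC p.1 p.2 t ht0.le
      have h0 : 0 ≤ min (Real.exp (A + a * p.2)) (min 1 (Real.exp (β - p.2))) := by positivity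
      have hle : T p.1 p.2 t - T p.1 p.2 1
          ≤ min (Real.exp (A + a * p.2)) (min 1 (Real.exp (β - p.2))) :=
        le_min (by linarith [T1.2]) (le_min (by linarith [T1.2, T2.1]) (by linarith [T2.1]))
      exact (mul_le_mul_of_nonneg_left hle (cut_nonneg n p.2)).trans
        (mul_le_of_le_one_left h0 (cut_le_one n p.2))
    have h3 : (t - 1) * E / ((n : ℝ) + 1) = (t - 1) * (E / (n + 1)) := by ring
    rw [h3]
    linarith
  have h1 := lintegral_le_of_cutInt_le (fun n => (isCutoff_cut n).cont)
    (fun n => (isCutoff_cut n).supp) cut_nonneg tendsto_cut D.contPos_f hf0 one_pos ht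
    (tendsto_div_nat _) hcut
  have h2 : ∫⁻ s in Ioc 1 t, ENNReal.ofReal (∫ p : ℝ × ℝ, f (T p.1 p.2 s) ∂(cell L))
      ≤ ENNReal.ofReal K := by
    refine le_trans (le_of_eq ?_) h1
    refine setLIntegral_congr_fun measurableSet_Ioc fun s hs => ?_
    exact ofReal_integral_eq_lintegral_ofReal (D.integrable_f (one_pos.trans hs.1))
      (Eventually.of_forall fun p => hf0 _ _ _ (one_pos.trans hs.1))
  have i3 := hii 1 t zero_le_one ht
  rw [← ofReal_integral_eq_lintegral_ofReal ((intervalIntegrable_iff_integrableOn_Ioc_of_le ht).1 i3)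
    ((ae_restrict_iff' measurableSet_Ioc).2 (Eventually.of_forall fun s hs =>
      integral_nonneg fun p => hf0 _ _ _ (one_pos.trans hs.1))),
    ENNReal.ofReal_le_ofReal_iff hK0, ← intervalIntegral.integral_of_le ht] at h2
  rw [← intervalIntegral.integral_add_adjacent_intervals (hii 0 1 le_rfl zero_le_one) i3]
  have h4 : L * (J / L + (Real.exp A / a + C + 1) + (2 + ε) * t) = J + K := by
    rw [hK, hβ]; field_simp; ring
  rw [h4]
  exact add_le_add le_rfl h2

/-- The mass burnt up to time `t` is at most `L (C + (2 + ε) t)` for every `ε > 0`. -/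
theorem limsup_avgBurningRate_le (D : FrontData f m σ ρ L u w T) :
    limsup (fun t : ℝ => (avgBurningRate L T t : EReal)) atTop ≤ 2 := by
  refine EReal.le_of_forall_lt_iff_le.1 fun r hr => ?_
  have hr2 : (2 : ℝ) < r := EReal.coe_lt_coe_iff.1 hr
  have hε : 0 < (r - 2) / 2 := by linarith
  obtain ⟨C, hC⟩ := D.exists_integral_f_le hε
  refine limsup_le_of_le (by isBoundedDefault) ?_
  filter_upwards [eventually_ge_atTop 1, eventually_ge_atTop (C / ((r - 2) / 2))] with t h1 h2
  have ht : 0 < t := one_pos.trans_le h1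
  rw [div_le_iff₀ hε] at h2
  refine EReal.coe_le_coe_iff.2 ?_
  have e : ∫ s in (0 : ℝ)..t, burningRate L T s
      = 1 / L * ∫ s in (0 : ℝ)..t, ∫ p : ℝ × ℝ, f (T p.1 p.2 s) ∂(cell L) := by
    rw [← intervalIntegral.integral_const_mul]
    refine intervalIntegral.integral_congr_ae (D.ae_burningRate_eq.mono fun s hs hst => ?_)
    rw [uIoc_of_le ht.le] at hst
    exact (hs hst.1).symm
  rw [avgBurningRate, e, one_div_mul_eq_div, one_div_mul_eq_div, div_le_iff₀ ht,
    div_le_iff₀ D.L_pos]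
  refine (hC t h1).trans ?_
  rw [mul_comm (r * t)]
  exact mul_le_mul_of_nonneg_left (by linarith) D.L_pos.le

end FrontData

end ReactiveBoussinesq

end
open ReactiveBoussinesq in
theorem mainTheorem3 :
    ∃ C₂ : ℝ, 0 < C₂ ∧ ∀ m₁ : ℝ, ∃ C₁ : ℝ, 0 < C₁ ∧
      ∀ f : ℝ → ℝ, IsReaction f → (∀ s ∈ Set.Icc (0 : ℝ) 1, |deriv f s| ≤ m₁) →
      ∀ σ ρ L : ℝ, 0 < σ → 0 < ρ → 0 < L → L < C₁ → ρ < C₂ / L ^ 3 →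
      ∀ u w T : ℝ → ℝ → ℝ → ℝ, IsSolution f σ ρ L u w T →
        Filter.Tendsto (fun t => normL2 L (vort u w) t + normL2 L (dx T) t)
          Filter.atTop (nhds 0) ∧
        (IsConcaveKPP f → FrontLike T →
          (∀ᵐ t : ℝ, 0 < t →
            MeasureTheory.Integrable (fun p : ℝ × ℝ => dt T p.1 p.2 t) (cell L)) ∧
          (∀ t : ℝ, 0 < t →
            IntervalIntegrable (burningRate L T) MeasureTheory.volume 0 t) ∧
          Filter.limsup (fun t : ℝ => (avgBurningRate L T t : EReal)) Filter.atTop ≤ 2) := by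
  -- the constants are those for which `ρ L³ ≤ 1/4` and `m₁ L² ≤ 1/4`
  refine ⟨1 / 4, by norm_num, fun m₁ => ⟨1 / (2 * (|m₁| + 1)), by positivity, ?_⟩⟩
  intro f hf hm σ ρ L hσ hρ hL hL1 hρ1 u w T h
  obtain ⟨hsm, h0, h1⟩ : ContDiff ℝ (⊤ : ℕ∞) f ∧ f 0 = 0 ∧ f 1 = 0 := by
    rcases hf with h | h | h <;> exact ⟨h.smooth, h.zero, h.one⟩
  have hm0 : 0 ≤ m₁ := (abs_nonneg _).trans (hm 0 (by simp))
  rw [abs_of_nonneg hm0, lt_div_iff₀ (by positivity)] at hL1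
  -- `2 L (m₁ + 1) < 1` implies `m₁ L² ≤ 1/4`
  have hmL : m₁ * L ^ 2 ≤ 1 / 4 := by
    nlinarith [mul_nonneg hm0 hL.le, mul_nonneg hm0 (mul_nonneg hm0 (sq_nonneg L))]
  have hρL : ρ * L ^ 3 ≤ 1 / 4 := ((lt_div_iff₀ (by positivity)).1 hρ1).le
  have D : SmallData f m₁ σ ρ L u w T :=
    ⟨h, hsm, h0, h1, hm, hσ, hρ, hL, hmL, hρL⟩
  refine ⟨D.tendsto_normL2, fun hk hfr => ?_⟩
  have F : FrontData f m₁ σ ρ L u w T := ⟨D, hk, hfr⟩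
  exact ⟨F.ae_integrable_dt_T, fun t ht => F.intervalIntegrable_burningRate ht,
    F.limsup_avgBurningRate_le⟩
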